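/- \textbf{Setting.} Let $\mathrm R$ be a finite (spherical, not necessarily crystallographic) real root system with a basis $B$ and positive roots $\mathrm R^+$, let $F\subseteq\mathbb R$ be a subfield containing all $\langle\alpha,\beta^\vee\rangle$ ($\alpha,\beta\in\mathrm R$), and let $\Lambda$ be a totally ordered abelian group with an $F$-module structure such that multiplication by non-negative scalars preserves the order. Put $\mathbb A=\operatorname{span}_F(\mathrm R)\otimes_F\Lambda$, with the linearly extended action of the spherical Weyl group $\overline W$ and of the coroots, with fundamental Weyl chamber $\mathcal C_f=\{x:\langle x,\alpha^\vee\rangle\ge 0\ \forall\alpha\in\mathrm R^+\}$ and with the $\Lambda$-valued distance $d(x,y)=\sum_{\alpha\in\mathrm R^+}|\langle y-x,\alpha^\vee\rangle|$. Let $T\ne 0$ be a group of translations of $\mathbb A$ normalized by $\overline W$; put $\overline WT=\overline W\ltimes T$, and let $W=\overline W\ltimes\mathbb A$ be the full affine Weyl group. Weyl chambers of $\mathbb A$ are the sets $w(\mathcal C_f)$, $w\in W$, with base point $w(0)$. Half-apartments are the sets $\{x:\langle x,\alpha^\vee\rangle\ge k\}$ ($\alpha\in \mathrm R$, $k\in\Lambda$);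 such a set is special if the reflection in $\{x:\langle x,\alpha^\vee\rangle=k\}$ lies in $\overline WT$. Convex sets are the intersections of finitely many special half-apartments. Let $(X,\mathcal A)$ be a generalized affine building modeled on $(\mathbb A,T)$: $X$ is a set and $\mathcal A$ a set of injective charts $f:\mathbb A\to X$; the images $f(\mathbb A)$ are called apartments, and Weyl chambers and half-apartments of $X$ are images under charts of those of $\mathbb A$. The following hold. (A1) $f\circ w\in\mathcal A$ for $f\in\mathcal A$, $w\in\overline WT$. (A2) If $f,g\in\mathcal A$ and $f(\mathbb A)\cap g(\mathbb A)\ne\emptyset$, then $f^{-1}(g(\mathbb A))$ is convex and $f=g\circ w$ on it for some $w\in\overline WT$. (A3) Any two points lie in a common apartment; thus $d$ induces a function $d:X\times X\to\Lambda$. (A4) Any two Weyl chambers contain sub-Weyl chambers that lie in a common apartment. (A5) For every apartment $A$ and $x\in A$ there is a distance non-increasing retraction $r:X\to A$ with $r^{-1}(x)=\{x\}$. (A6) If three apartments pairwise intersect in half-apartments, then the three have a common point. Two Weyl chambers based at the same point $x$ have the same germ at $x$ if their intersection is a neighbourhood of $x$ in both. The germ $\mu$ of $S$ at $x$ is contained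 in $Y\subseteq X$ if $S\cap B_\varepsilon(x)\subseteq Y$ for some $\varepsilon>0$ in $\Lambda$ (for $S$ or another Weyl chamber with germ $\mu$). A chamber at infinity is a class $c=\partial S$ of Weyl chambers of $X$ at bounded distance from each other; $c\in\partial A$ means that the apartment $A$ contains a Weyl chamber of class $c$. Let $A=f(\mathbb A)$, $f\in\mathcal A$, be an apartment. (1) Let $\mu\subset A$ be a germ of a Weyl chamber. The retraction $r_{A,\mu}:X\to A$ centered at $\mu$ is defined by $r_{A,\mu}(y)=(f\circ w\circ g^{-1})(y)$, where $g\in\mathcal A$ is a chart such that $g(\mathbb A)$ contains $y$ and $\mu$, and $w\in W$ satisfies $g=f\circ w$ on $g^{-1}(f(\mathbb A))$. (2) Let $c\in\partial A$ be a chamber at infinity. The retraction $\rho_{A,c}:X\to A$ centered at $c$ is defined by $\rho_{A,c}(y)=(f\circ w\circ g^{-1})(y)$, where $g\in\mathcal A$ is a chart such that $y\in g(\mathbb A)$ and $c\in\partial(g(\mathbb A))$, and $w\in W$ satisfies $g=f\circ w$ on $g^{-1}(f(\mathbb A))$. \textbf{Claim.} For every apartment $A$, every germ $\mu\subset A$ of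 a Weyl chamber and every chamber $c\in\partial A$ at infinity, the maps $r_{A,\mu}$ and $\rho_{A,c}$ are well defined and do not increase distances: $$d(r_{A,\mu}(y),r_{A,\mu}(z))\le d(y,z)\quad\text{and}\quad d(\rho_{A,c}(y),\rho_{A,c}(z))\le d(y,z)\qquad\text{for all }y,z\in X.$$ -/

import Mathlib

open scoped TensorProduct

noncomputable section

namespace LambdaBuilding

universe u₁ u₂ u₃ u₄ u₅

section RootSystem

variable {ι : Type u₁} {V : Type u₂} {N : Type u₃}
  [AddCommGroup V] [Module ℝ V] [AddCommGroup N] [Module ℝ N]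

/-- A basis (simple system) of a real root system which need not be crystallographic: a linearly
independent set of roots such that each root or its negative is a linear combination of the
basis roots with non-negative real coefficients. -/
structure RootBasis (P : RootPairing ι ℝ V N) where
  /-- the indices of the basis roots -/
  support : Finset ι
  linearIndepOn : LinearIndepOn ℝ P.root (support : Set ι)
  pos_or_neg : ∀ i, ∃ c : ι → ℝ, (∀ j, 0 ≤ c j) ∧
    (P.root i = ∑ j ∈ support, c j • P.root j ∨ -P.root i = ∑ j ∈ support, c j • P.root j)

/-- The root with index `i` is positive with respect to the basis `B`. -/
def RootBasis.IsPos {P : RootPairing ι ℝ V N} (B : RootBasis P) (i : ι) : Prop :=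
  ∃ c : ι → ℝ, (∀ j, 0 ≤ c j) ∧ P.root i = ∑ j ∈ B.support, c j • P.root j

end RootSystem

section ModelSpace

variable {ι : Type u₁} {V : Type u₂} {N : Type u₃}
  [AddCommGroup V] [Module ℝ V] [AddCommGroup N] [Module ℝ N]
  (P : RootPairing ι ℝ V N) (F : Subfield ℝ) (Λ : Type u₄) [AddCommGroup Λ] [Module F Λ]

/-- The model space `span_F(R) ⊗_F Λ`. -/
abbrev ModelSpace : Type (max u₂ u₄) := ↥(P.rootSpan F) ⊗[F] Λ

variable [P.IsValuedIn F]

/-- The evaluation `x ↦ ⟨x, αᵢ^∨⟩`, extended from `span_F(R)` to the model space. -/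
def eval (i : ι) : ModelSpace P F Λ →ₗ[F] Λ :=
  (TensorProduct.lid F Λ).toLinearMap ∘ₗ (P.coroot'In F i).rTensor Λ

/-- The reflection `s_α : β ↦ β - ⟨β, α^∨⟩ α` on `span_F(R)`. -/
def rootReflection (i : ι) : ↥(P.rootSpan F) ≃ₗ[F] ↥(P.rootSpan F) :=
  Module.reflection (x := P.rootSpanMem F i) (f := P.coroot'In F i) (by simp)

/-- The linear extension `r_α` of `s_α` to the model space. -/
def modelReflection (i : ι) : ModelSpace P F Λ ≃ₗ[F] ModelSpace P F Λ :=
  (rootReflection P F i).rTensor Λ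

/-- The spherical Weyl group, acting on the model space. -/
def sphericalWeylGroup : Subgroup (ModelSpace P F Λ ≃ₗ[F] ModelSpace P F Λ) :=
  Subgroup.closure (Set.range (modelReflection P F Λ))

variable {P F Λ}

/-- The transformations of the model space of the form "element of the spherical Weyl group
followed by a translation in `T`". For `T` normalized by the spherical Weyl group this is the affine
Weyl group with translation group `T`; `T = ⊤` gives the full affine Weyl group. -/
def affineWeylGroup (T : AddSubgroup (ModelSpace P F Λ)) :
    Set (ModelSpace P F Λ → ModelSpace P F Λ) :=
  {w | ∃ u ∈ sphericalWeylGroup P F Λ, ∃ t ∈ T, ∀ x, w x = u x + t}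

variable (P F) in
/-- The affine reflection in the hyperplane `⟨x, αᵢ^∨⟩ = k`. -/
def affineReflection (i : ι) (k : Λ) (x : ModelSpace P F Λ) : ModelSpace P F Λ :=
  modelReflection P F Λ i x + P.rootSpanMem F i ⊗ₜ[F] k

variable [LinearOrder Λ]

variable (P F) in
/-- The half-apartment `{x | ⟨x, αᵢ^∨⟩ ≥ k}` of the model space, bounded by the hyperplane
`⟨x, αᵢ^∨⟩ = k`. The opposite half-apartment is obtained from the root `-αᵢ`. -/
def modelHalf (i : ι) (k : Λ) : Set (ModelSpace P F Λ) := {x | k ≤ eval P F Λ i x}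

/-- Half-apartments bounded by a hyperplane that is special with respect to `T`, that is, by the
fixed point set of a reflection belonging to the affine Weyl group with translation group `T`. -/
def IsSpecialHalf (T : AddSubgroup (ModelSpace P F Λ)) (H : Set (ModelSpace P F Λ)) : Prop :=
  ∃ (i : ι) (k : Λ), affineReflection P F i k ∈ affineWeylGroup T ∧ H = modelHalf P F i k

/-- Convexity in the model space: an intersection of finitely many special half-apartments (the
empty intersection being the whole model space). Such sets are automatically closed. -/
def IsWeylConvex (T : AddSubgroup (ModelSpace P F Λ)) (Y : Set (ModelSpace P F Λ)) : Prop :=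
  ∃ 𝓗 : Set (Set (ModelSpace P F Λ)), 𝓗.Finite ∧ (∀ H ∈ 𝓗, IsSpecialHalf T H) ∧ Y = ⋂₀ 𝓗

variable (F Λ) in
/-- The fundamental Weyl chamber with respect to the basis `B`. -/
def fundamentalChamber (B : RootBasis P) : Set (ModelSpace P F Λ) :=
  {x | ∀ i, B.IsPos i → 0 ≤ eval P F Λ i x}

open scoped Classical in
/-- The `Λ`-valued distance `∑_{α ∈ R⁺} |⟨y - x, α^∨⟩|` on the model space. -/
def modelDist [Fintype ι] (B : RootBasis P) (x y : ModelSpace P F Λ) : Λ :=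
  ∑ i with B.IsPos i, |eval P F Λ i (y - x)|

end ModelSpace

section Building

variable {ι : Type u₁} {V : Type u₂} {N : Type u₃}
  [Fintype ι] [AddCommGroup V] [Module ℝ V] [AddCommGroup N] [Module ℝ N]
  {P : RootPairing ι ℝ V N} {F : Subfield ℝ} {Λ : Type u₄} [AddCommGroup Λ] [LinearOrder Λ]
  [Module F Λ] [P.IsValuedIn F] {X : Type u₅}
  (B : RootBasis P) (𝒜 : Set (ModelSpace P F Λ → X))

open scoped Classical in
/-- The distance on `X` induced by the atlas `𝒜`: the distance of the preimages of the two points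
under some chart whose image contains both. (By the axioms (A1)-(A3) such a chart exists, and the
value does not depend on it.) -/
def buildingDist (x y : X) : Λ :=
  if h : ∃ p : ModelSpace P F Λ × ModelSpace P F Λ, ∃ f ∈ 𝒜, f p.1 = x ∧ f p.2 = y then
    modelDist B h.choose.1 h.choose.2
  else 0

/-- `S` is a Weyl chamber of `X` with base point `p`: the image under a chart of a Weyl chamber of
the model space, which is an image of the fundamental one under the full affine Weyl group. -/
def IsWeylChamberAt (p : X) (S : Set X) : Prop :=
  ∃ f ∈ 𝒜, ∃ w ∈ affineWeylGroup (⊤ : AddSubgroup (ModelSpace P F Λ)),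
    f (w 0) = p ∧ S = f '' (w '' fundamentalChamber F Λ B)

/-- `S` is a Weyl chamber of `X`. -/
def IsWeylChamber (S : Set X) : Prop := ∃ p, IsWeylChamberAt B 𝒜 p S

/-- `S` is a half-apartment of `X`. -/
def IsHalfApartment (S : Set X) : Prop :=
  ∃ f ∈ 𝒜, ∃ (i : ι) (k : Λ), S = f '' modelHalf P F i k

/-- `(X, 𝒜)` is a generalized affine building modeled on the model space with affine Weyl group
of translation part `T`. The apartments are the images `Set.range f` of the charts `f ∈ 𝒜`. -/
structure IsAffineBuilding (T : AddSubgroup (ModelSpace P F Λ)) : Prop where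
  injective : ∀ f ∈ 𝒜, Function.Injective f
  A1 : ∀ f ∈ 𝒜, ∀ w ∈ affineWeylGroup T, f ∘ w ∈ 𝒜
  A2 : ∀ f ∈ 𝒜, ∀ g ∈ 𝒜, (Set.range f ∩ Set.range g).Nonempty →
    IsWeylConvex T (f ⁻¹' Set.range g) ∧
    ∃ w ∈ affineWeylGroup T, ∀ a ∈ f ⁻¹' Set.range g, f a = g (w a)
  A3 : ∀ x y : X, ∃ f ∈ 𝒜, x ∈ Set.range f ∧ y ∈ Set.range f
  A4 : ∀ S₁ S₂, IsWeylChamber B 𝒜 S₁ → IsWeylChamber B 𝒜 S₂ →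
    ∃ S₁' S₂', IsWeylChamber B 𝒜 S₁' ∧ IsWeylChamber B 𝒜 S₂' ∧ S₁' ⊆ S₁ ∧ S₂' ⊆ S₂ ∧
      ∃ f ∈ 𝒜, S₁' ∪ S₂' ⊆ Set.range f
  A5 : ∀ f ∈ 𝒜, ∀ x ∈ Set.range f, ∃ r : X → X,
    (∀ y, r y ∈ Set.range f) ∧ (∀ y ∈ Set.range f, r y = y) ∧
    (∀ y z, buildingDist B 𝒜 (r y) (r z) ≤ buildingDist B 𝒜 y z) ∧ r ⁻¹' {x} = {x}
  A6 : ∀ f ∈ 𝒜, ∀ g ∈ 𝒜, ∀ h ∈ 𝒜,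
    IsHalfApartment 𝒜 (Set.range f ∩ Set.range g) →
    IsHalfApartment 𝒜 (Set.range g ∩ Set.range h) →
    IsHalfApartment 𝒜 (Set.range f ∩ Set.range h) →
    (Set.range f ∩ Set.range g ∩ Set.range h).Nonempty

/-- The ball of radius `ε` around `x`. -/
def ball (x : X) (ε : Λ) : Set X := {y | buildingDist B 𝒜 x y < ε}

/-- Two Weyl chambers share the same germ at `x`: both are based at `x`, and their intersection is
a neighbourhood of `x` in each of them. -/
def ShareGerm (x : X) (S S' : Set X) : Prop :=
  IsWeylChamberAt B 𝒜 x S ∧ IsWeylChamberAt B 𝒜 x S' ∧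
    ∃ ε : Λ, 0 < ε ∧ S ∩ ball B 𝒜 x ε ⊆ S ∩ S' ∧ S' ∩ ball B 𝒜 x ε ⊆ S ∩ S'

/-- The germ `Δ_x S` of a Weyl chamber `S` based at `x`, as an equivalence class. -/
def germ (x : X) (S : Set X) : Set (Set X) := {S' | ShareGerm B 𝒜 x S S'}

/-- The germ `μ` at `x` is contained in the set `Y`. -/
def GermContained (x : X) (μ : Set (Set X)) (Y : Set X) : Prop :=
  ∃ S ∈ μ, ∃ ε : Λ, 0 < ε ∧ S ∩ ball B 𝒜 x ε ⊆ Y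

/-- Two subsets of `X` are parallel if they are at bounded distance. -/
def Parallel (S S' : Set X) : Prop :=
  ∃ n : Λ, (∀ x ∈ S, ∃ y ∈ S', buildingDist B 𝒜 x y ≤ n) ∧
    (∀ x ∈ S', ∃ y ∈ S, buildingDist B 𝒜 x y ≤ n)

/-- The chamber at infinity `∂S` determined by a Weyl chamber `S`: its parallel class. -/
def chamberAtInfinity (S : Set X) : Set (Set X) :=
  {S' | IsWeylChamber B 𝒜 S' ∧ Parallel B 𝒜 S S'}

/-- The chamber `c` at infinity belongs to `∂Y`: the set `Y` contains a representative of `c`. -/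
def MemBoundary (c : Set (Set X)) (Y : Set X) : Prop := ∃ S ∈ c, S ⊆ Y

/-- `z` is the point `(f ∘ w ∘ g⁻¹) y`, where `g` is a chart whose image contains `y` and `w` is an
element of the full affine Weyl group such that `g = f ∘ w` on `g⁻¹(f(𝔸))`. -/
def IsTransport (f g : ModelSpace P F Λ → X) (y z : X) : Prop :=
  ∃ w ∈ affineWeylGroup (⊤ : AddSubgroup (ModelSpace P F Λ)),
    (∀ a ∈ g ⁻¹' Set.range f, g a = f (w a)) ∧ ∃ a, g a = y ∧ z = f (w a)

/-- `r` is the retraction onto the apartment `f(𝔸)` centered at the germ `μ` at `x`: each value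
`r y` is computed in a chart `g` whose image contains `y` and `μ`. -/
def IsGermRetraction (f : ModelSpace P F Λ → X) (x : X) (μ : Set (Set X)) (r : X → X) : Prop :=
  ∀ y, ∃ g ∈ 𝒜, GermContained B 𝒜 x μ (Set.range g) ∧ IsTransport f g y (r y)

/-- `ρ` is the retraction onto the apartment `f(𝔸)` centered at the chamber `c` at infinity: each
value `ρ y` is computed in a chart `g` whose image contains `y` and a representative of `c`. -/
def IsRetractionAtInfinity (f : ModelSpace P F Λ → X) (c : Set (Set X)) (ρ : X → X) : Prop :=
  ∀ y, ∃ g ∈ 𝒜, MemBoundary c (Set.range g) ∧ IsTransport f g y (ρ y)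

/-- A self-map of `X` that does not increase distances. -/
def NonIncreasing (r : X → X) : Prop :=
  ∀ y z, buildingDist B 𝒜 (r y) (r z) ≤ buildingDist B 𝒜 y z

end Building

end LambdaBuilding

end

open LambdaBuilding

set_option linter.unusedSectionVars false

/-! Both retractions are instances of one construction (`IsCentre`). Take all charts containing the
germ `μ`, respectively a chamber of class `c`, normalized so that any two of them differ on their
overlap by a prescribed translation. If every point lies in such a chart, sending it to the point of
`A` with the same normalized coordinates is well defined, and the map is isometric on each chart of
the family. It does not increase distances as soon as every segment of an apartment has a finite
subdivision such that both ends of each piece lie in one chart of the family: lengths add up along a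
line, and any two points are joined by a path of segments in dominant directions whose total length
is their distance (`IsCentre.dist_le`). Since `Λ` need not be Archimedean, compactness is replaced
by explicit finite subdivisions (`Subdiv`).

Chamber `c` at infinity. The chambers at infinity form a spherical building (`Atlas.infinity`) with
the usual Weyl distance (`ChamberSystem.Delta.mul_refl`). If `c` is adjacent to a chamber of `∂A`
but not in `∂A`, two apartments with `c` at infinity meet `A` in half-apartments, and (A6) forces
these to cover `A` (`Atlas.sundial`). Induction along a gallery from `∂A` to `c` cuts every segment
of `A` into pieces lying in apartments with `c` at infinity (`Atlas.subdiv_lineInf`).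

Germ `μ` at `x`. The first piece of such a subdivision puts two germs at a point into a common
apartment, so the germs at a point also form a spherical building (`Atlas.residue`). A Weyl chamber
and a segment leaving its base point in the opposite direction lie in one apartment
(`exists_apartment_of_opposite`); hence so do a germ and any regular segment from its base point
(`exists_apartment_of_germ`). Opposite germs also show that each point of `A` lies in a Weyl chamber
based at `x` pointing to one of the finitely many chambers of `∂A` (`exists_opposite_apartment`).
Linear inequalities decide which one, so a segment of `A` is cut into pieces with both ends in one
such chamber (`subdiv_cone`), and these ends share an apartment with `μ`.

All of this is done for abstract coroot data over `F` (`WeylData`, `WeylModel`) and for the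
consequences `Atlas` of the axioms; the root system and the building enter only at the end. -/

namespace LambdaBuilding

/-! ### Finite Weyl groups: simple reflections and the exchange condition -/

/-- A finite root system with a simple system, presented by its coroots as functionals on an
`F`-vector space `E` and by its Weyl group `W`. The vectors `om j` are dual to the simple
coroots. -/
structure WeylData (ι F E W : Type*) [Fintype ι] [Field F] [LinearOrder F]
    [IsStrictOrderedRing F] [AddCommGroup E] [Module F E] [Group W] [DistribMulAction W E] where
  co : ι → E →ₗ[F] F
  al : ι → E
  refl : ι → W
  perm : ι → Equiv.Perm ι
  pos : ι → Prop
  simple : Finset ι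
  om : ι → E
  refl_smul : ∀ i v, refl i • v = v - co i v • al i
  co_al : ∀ i, co i (al i) = 2
  co_refl : ∀ i k v, co k (refl i • v) = co (perm i k) v
  faithful : ∀ u : W, (∀ v : E, u • v = v) → u = 1
  gen : Subgroup.closure (Set.range refl) = ⊤
  sep : ∀ v, (∀ k, co k v = 0) → v = 0
  co_om_self : ∀ i ∈ simple, co i (om i) = 1
  co_om_ne : ∀ i ∈ simple, ∀ j ∈ simple, i ≠ j → co i (om j) = 0
  co_sum : ∀ k v, co k v = ∑ j ∈ simple, co k (om j) * co j v
  pos_om : ∀ k, pos k → ∀ j ∈ simple, 0 ≤ co k (om j)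
  neg_om : ∀ k, ¬ pos k → ∀ j ∈ simple, co k (om j) ≤ 0
  exists_simple : ∀ k, pos k → ∃ j ∈ simple, 0 < co k (al j)

namespace WeylData

variable {ι F E W : Type*} [Fintype ι] [Field F] [LinearOrder F]
    [IsStrictOrderedRing F] [AddCommGroup E] [Module F E] [Group W] [DistribMulAction W E]
    (D : WeylData ι F E W)

/-- A dominant regular vector. -/
def omega : E := ∑ j ∈ D.simple, D.om j

/-- A vector in the interior of the `i`-th panel of the fundamental chamber. -/
def eta (i : ι) : E := D.omega - D.om i

theorem co_ne_zero (k : ι) : D.co k ≠ 0 := by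
  intro h
  have := D.co_al k
  simp [h] at this

theorem refl_mul_self (i : ι) : D.refl i * D.refl i = 1 := by
  apply D.faithful
  intro v
  rw [mul_smul, D.refl_smul, D.refl_smul]
  simp only [map_sub, map_smul, D.co_al, smul_eq_mul]
  rw [sub_sub, ← add_smul]
  ring_nf
  simp

theorem refl_inv (i : ι) : (D.refl i)⁻¹ = D.refl i :=
  inv_eq_of_mul_eq_one_left (D.refl_mul_self i)

theorem exists_om_ne (k : ι) : ∃ j ∈ D.simple, D.co k (D.om j) ≠ 0 := by
  by_contra! h
  apply D.co_ne_zero k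
  ext v
  rw [D.co_sum]
  exact Finset.sum_eq_zero fun j hj => by rw [h j hj, zero_mul]

theorem pos_omega {k : ι} (hk : D.pos k) : 0 < D.co k D.omega := by
  obtain ⟨j, hj, hne⟩ := D.exists_om_ne k
  rw [omega, map_sum]
  exact Finset.sum_pos' (fun j hj => D.pos_om k hk j hj)
    ⟨j, hj, lt_of_le_of_ne (D.pos_om k hk j hj) hne.symm⟩

theorem neg_omega {k : ι} (hk : ¬ D.pos k) : D.co k D.omega < 0 := by
  obtain ⟨j, hj, hne⟩ := D.exists_om_ne k
  rw [omega, map_sum]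
  exact Finset.sum_neg' (fun j hj => D.neg_om k hk j hj)
    ⟨j, hj, lt_of_le_of_ne (D.neg_om k hk j hj) hne⟩

theorem pos_iff {k : ι} : D.pos k ↔ 0 < D.co k D.omega :=
  ⟨D.pos_omega, fun h => by by_contra hk; exact lt_asymm h (D.neg_omega hk)⟩

theorem pos_of_nonneg {k : ι} (h : 0 ≤ D.co k D.omega) : D.pos k := by
  by_contra hk
  exact absurd (D.neg_omega hk) (not_lt.2 h)

theorem simple_pos {i : ι} (hi : i ∈ D.simple) : D.pos i := by
  by_contra h
  have := D.neg_om i h i hi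
  rw [D.co_om_self i hi] at this
  exact absurd this (not_le.2 one_pos)

theorem co_refl_self (i : ι) (v : E) : D.co i (D.refl i • v) = - D.co i v := by
  rw [D.refl_smul, map_sub, map_smul, D.co_al, smul_eq_mul]
  ring

theorem refl_om {i j : ι} (hi : i ∈ D.simple) (hj : j ∈ D.simple) (h : i ≠ j) :
    D.refl i • D.om j = D.om j := by
  rw [D.refl_smul, D.co_om_ne i hi j hj h, zero_smul, sub_zero]

/-- A simple reflection makes only multiples of its own root negative: it fixes `om j` for `j ≠ i`,
so the coefficient `co k (om j)` is both `≥ 0` and `≤ 0`. The root system need not be reduced, hence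
multiples. -/
theorem prop_of_not_pos {i k : ι} (hi : i ∈ D.simple) (hk : D.pos k)
    (hik : ¬ D.pos (D.perm i k)) :
    0 < D.co k (D.om i) ∧ ∀ v, D.co k v = D.co k (D.om i) * D.co i v := by
  have h0 : ∀ j ∈ D.simple, j ≠ i → D.co k (D.om j) = 0 := by
    intro j hj hji
    apply le_antisymm _ (D.pos_om k hk j hj)
    have := D.neg_om _ hik j hj
    rwa [← D.co_refl, D.refl_om hi hj hji.symm] at this
  have h1 : ∀ v, D.co k v = D.co k (D.om i) * D.co i v := by
    intro v
    rw [D.co_sum, Finset.sum_eq_single_of_mem i hi]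
    intro j hj hji
    rw [h0 j hj hji, zero_mul]
  refine ⟨lt_of_le_of_ne (D.pos_om k hk i hi) ?_, h1⟩
  intro h
  apply D.co_ne_zero k
  ext v
  rw [h1, ← h, zero_mul, LinearMap.zero_apply]

/-- The invariant bilinear form. -/
def form (x y : E) : F := ∑ k, D.co k x * D.co k y

theorem perm_smul (u : W) : ∃ σ : Equiv.Perm ι, ∀ k (v : E), D.co k (u • v) = D.co (σ k) v := by
  have hu : u ∈ Subgroup.closure (Set.range D.refl) := by rw [D.gen]; trivial
  induction hu using Subgroup.closure_induction with
  | mem x hx =>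
    obtain ⟨i, rfl⟩ := hx
    exact ⟨D.perm i, D.co_refl i⟩
  | one => exact ⟨1, by simp⟩
  | mul x y _ _ hx hy =>
    obtain ⟨σ, hσ⟩ := hx
    obtain ⟨τ, hτ⟩ := hy
    exact ⟨τ * σ, fun k v => by rw [mul_smul, hσ, hτ]; rfl⟩
  | inv x _ hx =>
    obtain ⟨σ, hσ⟩ := hx
    exact ⟨σ⁻¹, fun k v => by
      have := hσ (σ⁻¹ k) (x⁻¹ • v)
      rw [smul_inv_smul] at this
      rw [this]; simp⟩

theorem form_smul (u : W) (x y : E) : D.form (u • x) (u • y) = D.form x y := by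
  obtain ⟨σ, hσ⟩ := D.perm_smul u
  simp only [form, hσ]
  exact Equiv.sum_comp σ (fun k => D.co k x * D.co k y)

theorem form_comm (x y : E) : D.form x y = D.form y x := by
  simp only [form, mul_comm]

theorem form_sub (x y z : E) : D.form x (y - z) = D.form x y - D.form x z := by
  simp only [form, map_sub, mul_sub, Finset.sum_sub_distrib]

theorem form_smul_right (x y : E) (c : F) : D.form x (c • y) = c * D.form x y := by
  simp only [form, map_smul, smul_eq_mul, Finset.mul_sum]
  exact Finset.sum_congr rfl fun _ _ => by ring

theorem form_self_eq_zero {x : E} (h : D.form x x = 0) : x = 0 := by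
  apply D.sep
  intro k
  have := (Finset.sum_eq_zero_iff_of_nonneg (fun k _ => mul_self_nonneg (D.co k x))).1 h k
    (Finset.mem_univ k)
  exact mul_self_eq_zero.1 this

theorem form_al (i : ι) (x : E) : 2 * D.form (D.al i) x = D.form (D.al i) (D.al i) * D.co i x := by
  have h := D.form_smul (D.refl i) (D.al i) x
  have h1 : D.refl i • D.al i = (-1 : F) • D.al i := by
    rw [D.refl_smul, D.co_al, neg_smul, one_smul, two_smul]; abel
  rw [h1, form_comm, form_smul_right, D.refl_smul, form_comm, form_sub, form_smul_right] at h
  linarith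

theorem form_al_pos (i : ι) : 0 < D.form (D.al i) (D.al i) := by
  have h0 : 0 ≤ D.form (D.al i) (D.al i) := Finset.sum_nonneg fun k _ => mul_self_nonneg _
  refine lt_of_le_of_ne h0 fun h => ?_
  have := D.co_al i
  rw [D.form_self_eq_zero h.symm, map_zero] at this
  exact two_ne_zero this.symm

theorem smul_comm' (D : WeylData ι F E W) (u : W) (t : F) (y : E) : u • (t • y) = t • (u • y) := by
  obtain ⟨σ, hσ⟩ := D.perm_smul u
  rw [← sub_eq_zero]
  apply D.sep
  intro k
  rw [map_sub, hσ, map_smul, map_smul, hσ, sub_self]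

/-- Invariance of `form` turns the relation between the coroots into `u⁻¹ • al i = c⁻¹ • al j`, so
`u` conjugates one reflection into the other. -/
theorem refl_mul_eq {i j : ι} {u : W} {c : F} (h : ∀ v : E, D.co i (u • v) = c * D.co j v) :
    D.refl i * u = u * D.refl j := by
  have hc : c ≠ 0 := by
    rintro rfl
    apply D.co_ne_zero i
    ext v
    have := h (u⁻¹ • v)
    rw [smul_inv_smul] at this
    rw [this, zero_mul, LinearMap.zero_apply]
  set a := D.form (D.al i) (D.al i) with ha
  set b := D.form (D.al j) (D.al j) with hb
  have hb0 : b ≠ 0 := (D.form_al_pos j).ne'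
  have key : u⁻¹ • D.al i = c⁻¹ • D.al j := by
    have h1 : ∀ x, 2 * D.form (u⁻¹ • D.al i) x = a * c * D.co j x := by
      intro x
      have := D.form_al i (u • x)
      rw [h, ← D.form_smul u⁻¹, inv_smul_smul] at this
      rw [this]; ring
    have h2 : u⁻¹ • D.al i = (a * c / b) • D.al j := by
      rw [← sub_eq_zero]
      apply D.form_self_eq_zero
      have h3 : ∀ x, D.form (u⁻¹ • D.al i - (a * c / b) • D.al j) x = 0 := by
        intro x
        rw [form_comm, form_sub, form_smul_right, form_comm, D.form_comm x (D.al j)]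
        have e1 := h1 x
        have e2 := D.form_al j x
        rw [← hb] at e2
        have : (2 : F) * (D.form (u⁻¹ • D.al i) x - a * c / b * D.form (D.al j) x) = 0 := by
          rw [mul_sub, e1]
          have : 2 * (a * c / b * D.form (D.al j) x) = a * c / b * (b * D.co j x) := by
            rw [← e2]; ring
          rw [this]; field_simp; ring
        exact (mul_eq_zero.1 this).resolve_left two_ne_zero
      exact h3 _
    have h4 := h (u⁻¹ • D.al i)
    rw [smul_inv_smul, D.co_al, h2, map_smul, D.co_al, smul_eq_mul] at h4
    rw [h2]
    congr 1
    have : c * (a * c / b) = 1 := by linarith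
    exact eq_inv_of_mul_eq_one_right this
  have h5 : ∀ v : E, (u⁻¹ * (D.refl i * u)) • v = D.refl j • v := by
    intro v
    rw [mul_smul, mul_smul, D.refl_smul, D.refl_smul, h, smul_sub, inv_smul_smul,
      D.smul_comm', key, smul_smul]
    congr 2
    field_simp
  have h6 : (D.refl j)⁻¹ * (u⁻¹ * (D.refl i * u)) = 1 := by
    apply D.faithful
    intro v
    rw [mul_smul, h5, inv_smul_smul]
  have h7 := (inv_mul_eq_one.1 h6).symm
  rw [inv_mul_eq_iff_eq_mul] at h7
  exact h7

theorem refl_eq_of_prop {i k : ι} {c : F} (h : ∀ v, D.co k v = c * D.co i v) :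
    D.refl k = D.refl i := by
  have := D.refl_mul_eq (i := k) (j := i) (u := 1) (c := c) (by simpa using h)
  simpa using this

/-- Descent on the height `co k omega`: for `j` simple with `0 < co k (al j)`, either `refl j`
carries `k` to a positive root of smaller height, or `k` is a multiple of `j`. -/
theorem refl_mem_simple (k : ι) (hk : D.pos k) :
    D.refl k ∈ Subgroup.closure (D.refl '' (D.simple : Set ι)) := by
  classical
  have hsimp : ∀ j ∈ D.simple, D.refl j ∈ Subgroup.closure (D.refl '' (D.simple : Set ι)) :=
    fun j hj => Subgroup.subset_closure ⟨j, hj, rfl⟩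
  by_contra hcon
  obtain ⟨k, hk', hmin⟩ := Finset.exists_min_image
    (Finset.univ.filter fun k => D.pos k ∧
      D.refl k ∉ Subgroup.closure (D.refl '' (D.simple : Set ι)))
    (fun k => D.co k D.omega) ⟨k, by simp [hk, hcon]⟩
  simp only [Finset.mem_filter, Finset.mem_univ, true_and, and_imp] at hk' hmin
  obtain ⟨hk, hcon⟩ := hk'
  obtain ⟨j, hj, hjk⟩ := D.exists_simple k hk
  by_cases hp : D.pos (D.perm j k)
  · have hlt : D.co (D.perm j k) D.omega < D.co k D.omega := by
      rw [← D.co_refl, D.refl_smul, map_sub, map_smul, smul_eq_mul]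
      have := mul_pos (D.pos_omega (D.simple_pos hj)) hjk
      linarith
    have hmem : D.refl (D.perm j k) ∈ Subgroup.closure (D.refl '' (D.simple : Set ι)) := by
      by_contra hn
      exact absurd (hmin _ hp hn) (not_le.2 hlt)
    apply hcon
    have h := D.refl_mul_eq (i := k) (j := D.perm j k) (u := D.refl j) (c := 1)
      (by intro v; rw [D.co_refl, one_mul])
    have : D.refl k = D.refl j * D.refl (D.perm j k) * D.refl j := by
      rw [← h, mul_assoc, D.refl_mul_self, mul_one]
    rw [this]
    exact mul_mem (mul_mem (hsimp j hj) hmem) (hsimp j hj)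
  · apply hcon
    rw [D.refl_eq_of_prop (D.prop_of_not_pos hj hk hp).2]
    exact hsimp j hj

theorem co_perm_self (i : ι) (v : E) : D.co (D.perm i i) v = - D.co i v := by
  rw [← D.co_refl, D.co_refl_self]

theorem pos_perm_self {i : ι} (h : ¬ D.pos i) : D.pos (D.perm i i) := by
  rw [D.pos_iff, D.co_perm_self]
  exact neg_pos.2 (D.neg_omega h)

theorem closure_simple : Subgroup.closure (D.refl '' (D.simple : Set ι)) = ⊤ := by
  rw [eq_top_iff, ← D.gen, Subgroup.closure_le]
  rintro _ ⟨k, rfl⟩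
  by_cases hk : D.pos k
  · exact D.refl_mem_simple k hk
  · have := D.refl_mem_simple _ (D.pos_perm_self hk)
    rwa [D.refl_eq_of_prop (i := k) (k := D.perm k k) (c := -1)
      (by intro v; rw [D.co_perm_self]; ring)] at this

/-- `u` is a product of `n` simple reflections. -/
def IsWord (n : ℕ) (u : W) : Prop :=
  ∃ L : List ι, L.length = n ∧ (∀ j ∈ L, j ∈ D.simple) ∧ u = (L.map D.refl).prod

theorem isWord_zero {u : W} : D.IsWord 0 u ↔ u = 1 := by
  constructor
  · rintro ⟨L, hL, -, rfl⟩
    rw [List.length_eq_zero_iff.1 hL]; simp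
  · rintro rfl
    exact ⟨[], rfl, by simp, by simp⟩

theorem isWord_succ {n : ℕ} {u : W} :
    D.IsWord (n + 1) u ↔ ∃ v, ∃ j ∈ D.simple, D.IsWord n v ∧ u = v * D.refl j := by
  constructor
  · rintro ⟨L, hL, hs, rfl⟩
    have hne : L ≠ [] := by rintro rfl; simp at hL
    refine ⟨(L.dropLast.map D.refl).prod, L.getLast hne, hs _ (List.getLast_mem hne),
      ⟨L.dropLast, by simp [hL], fun j hj => hs j (List.mem_of_mem_dropLast hj), rfl⟩, ?_⟩
    conv_lhs => rw [← List.dropLast_append_getLast hne]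
    simp
  · rintro ⟨v, j, hj, ⟨L, hL, hs, rfl⟩, rfl⟩
    refine ⟨L ++ [j], by simp [hL], ?_, by simp⟩
    intro l hl
    rcases List.mem_append.1 hl with h | h
    · exact hs l h
    · rw [List.mem_singleton.1 h]; exact hj

theorem IsWord.inv {n : ℕ} {u : W} (h : D.IsWord n u) : D.IsWord n u⁻¹ := by
  obtain ⟨L, hL, hs, rfl⟩ := h
  refine ⟨L.reverse, by simp [hL], fun j hj => hs j (List.mem_reverse.1 hj), ?_⟩
  rw [List.prod_inv_reverse, List.map_map, List.map_reverse]
  congr 2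
  exact List.map_congr_left fun j _ => D.refl_inv j

theorem exists_isWord (u : W) : ∃ n, D.IsWord n u := by
  have hu : u ∈ Subgroup.closure (D.refl '' (D.simple : Set ι)) := by
    rw [D.closure_simple]; trivial
  induction hu using Subgroup.closure_induction_right with
  | one => exact ⟨0, D.isWord_zero.2 rfl⟩
  | mul_right x _ y hy hx =>
    obtain ⟨n, hn⟩ := hx
    obtain ⟨j, hj, rfl⟩ := hy
    exact ⟨n + 1, D.isWord_succ.2 ⟨x, j, hj, hn, rfl⟩⟩
  | mul_inv_cancel x _ y hy hx =>
    obtain ⟨n, hn⟩ := hx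
    obtain ⟨j, hj, rfl⟩ := hy
    exact ⟨n + 1, D.isWord_succ.2 ⟨x, j, hj, hn, by rw [D.refl_inv]⟩⟩

theorem co_smul_omega_ne (u : W) (k : ι) : D.co k (u • D.omega) ≠ 0 := by
  obtain ⟨σ, hσ⟩ := D.perm_smul u
  rw [hσ]
  by_cases h : D.pos (σ k)
  · exact (D.pos_omega h).ne'
  · exact (D.neg_omega h).ne

/-- Applied to `omega`, the prefixes of the word change the sign of `co i` at some letter `j`. There
the pulled back coroot is a multiple of `co j`, so moving `refl i` through the prefix turns it into
`refl j`, which cancels that letter. -/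
theorem exchange {n : ℕ} {u : W} {i : ι} (hi : i ∈ D.simple) (hu : D.IsWord n u)
    (h : D.co i (u • D.omega) < 0) : ∃ m, n = m + 1 ∧ D.IsWord m (D.refl i * u) := by
  induction n generalizing u with
  | zero =>
    rw [D.isWord_zero] at hu
    rw [hu, one_smul] at h
    exact absurd (D.pos_omega (D.simple_pos hi)) (not_lt.2 h.le)
  | succ n ih =>
    refine ⟨n, rfl, ?_⟩
    obtain ⟨v, j, hj, hv, rfl⟩ := D.isWord_succ.1 hu
    by_cases hv0 : D.co i (v • D.omega) < 0
    · obtain ⟨m, rfl, hm⟩ := ih hv hv0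
      exact D.isWord_succ.2 ⟨_, j, hj, hm, by rw [mul_assoc]⟩
    · obtain ⟨σ, hσ⟩ := D.perm_smul v
      have hp : D.pos (σ i) := by
        apply D.pos_of_nonneg
        rw [← hσ]
        exact not_lt.1 hv0
      have hnp : ¬ D.pos (D.perm j (σ i)) := by
        rw [D.pos_iff, ← D.co_refl, ← hσ, ← mul_smul]
        exact not_lt.2 h.le
      have hprop := (D.prop_of_not_pos hj hp hnp).2
      have := D.refl_mul_eq (i := i) (j := j) (u := v) (fun x => by rw [hσ, hprop])
      rw [← mul_assoc, this, mul_assoc, D.refl_mul_self, mul_one]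
      exact hv

/-- A word for `u` starts with some letter `i`, `u = refl i * x⁻¹`. If `co i` is negative on `x⁻¹ •
omega`, the exchange condition shortens the word of `u`; otherwise `co i` is negative on `u •
omega`. -/
theorem exists_neg {u : W} (hu : u ≠ 1) : ∃ i ∈ D.simple, D.co i (u • D.omega) < 0 := by
  by_contra! h
  have hu' : ∀ u : W, (∀ i ∈ D.simple, 0 ≤ D.co i (u • D.omega)) → ∀ n, D.IsWord n u → u = 1 := by
    intro u h n
    induction n using Nat.strong_induction_on with
    | _ n ih =>
      intro hn
      cases n with
      | zero => exact D.isWord_zero.1 hn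
      | succ n =>
        obtain ⟨x, i, hi, hx, hux⟩ := D.isWord_succ.1 hn.inv
        have hpos : 0 ≤ D.co i (u⁻¹ • D.omega) := by
          obtain ⟨σ, hσ⟩ := D.perm_smul u⁻¹
          rw [hσ]
          apply le_of_lt
          rw [← D.pos_iff]
          by_contra hnp
          obtain ⟨τ, hτ⟩ := D.perm_smul u
          have h1 : ∀ v, D.co i v = D.co (σ i) (u • v) := by
            intro v; rw [← hσ, inv_smul_smul]
          have h2 := D.pos_omega (D.simple_pos hi)
          rw [h1, D.co_sum] at h2
          refine absurd h2 (not_lt.2 (Finset.sum_nonpos fun j hj => ?_))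
          exact mul_nonpos_of_nonpos_of_nonneg (D.neg_om _ hnp j hj) (h j hj)
        have hxy : u⁻¹ * D.refl i = x := by rw [hux, mul_assoc, D.refl_mul_self, mul_one]
        have hu2 : u = D.refl i * x⁻¹ := by
          rw [← inv_inv u, hux, mul_inv_rev, D.refl_inv]
        by_cases hlt : D.co i (x⁻¹ • D.omega) < 0
        · obtain ⟨m, rfl, hm⟩ := D.exchange hi hx.inv hlt
          rw [← hu2] at hm
          exact ih m (by omega) hm
        · exfalso
          have h3 := h i hi
          rw [hu2, mul_smul, D.co_refl_self] at h3
          have h4 := D.co_smul_omega_ne x⁻¹ i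
          have h5 := not_lt.1 hlt
          exact h4 (le_antisymm (by linarith) h5)
  obtain ⟨n, hn⟩ := D.exists_isWord u
  exact hu (hu' u h n hn)

theorem eq_one_of_nonneg {u : W} (h : ∀ i ∈ D.simple, 0 ≤ D.co i (u • D.omega)) : u = 1 := by
  by_contra hu
  obtain ⟨i, hi, hlt⟩ := D.exists_neg hu
  exact absurd (h i hi) (not_le.2 hlt)

theorem eq_one_of_fix {u : W} (h : u • D.omega = D.omega) : u = 1 :=
  D.eq_one_of_nonneg fun i hi => by rw [h]; exact (D.pos_omega (D.simple_pos hi)).le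

theorem eq_of_smul_omega {u v : W} (h : u • D.omega = v • D.omega) : u = v := by
  have : v⁻¹ * u = 1 := D.eq_one_of_fix (by rw [mul_smul, h, inv_smul_smul])
  exact (inv_mul_eq_one.1 this).symm

end WeylData
end LambdaBuilding

/-! ### Dominant vectors, the longest element and panels -/

namespace LambdaBuilding
namespace WeylData

variable {ι F E W : Type*} [Fintype ι] [Field F] [LinearOrder F]
    [IsStrictOrderedRing F] [AddCommGroup E] [Module F E] [Group W] [DistribMulAction W E]
    (D : WeylData ι F E W)

-- The permutation `perm i` maps the positive coroots negative at `refl i • y` into those negative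
-- at `y`, and misses `i` itself. A general `ev` is allowed so that the descent serves both vectors
-- and points of the model apartment.
open scoped Classical in
theorem card_neg_lt {Y G : Type*} [MulAction W Y] [AddCommGroup G] [LinearOrder G]
    [IsOrderedAddMonoid G] [Module F G] [PosSMulStrictMono F G] (ev : ι → Y → G)
    (h1 : ∀ i k y, ev k (D.refl i • y) = ev (D.perm i k) y)
    (h2 : ∀ k y, ev k y = ∑ j ∈ D.simple, D.co k (D.om j) • ev j y) {y : Y} {i : ι}
    (hi : i ∈ D.simple) (hneg : ev i y < 0) :
    (Finset.univ.filter fun k => D.pos k ∧ ev k (D.refl i • y) < 0).card <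
      (Finset.univ.filter fun k => D.pos k ∧ ev k y < 0).card := by
  have hscale : ∀ {k i : ι} {c : F}, (∀ v, D.co k v = c * D.co i v) → ∀ y, ev k y = c • ev i y := by
    intro k i c h y
    rw [h2, h2 i, Finset.smul_sum]
    exact Finset.sum_congr rfl fun j _ => by rw [h, mul_smul]
  have hself : ∀ i y, ev i (D.refl i • y) = - ev i y := by
    intro i y
    rw [h1, hscale (c := -1) (k := D.perm i i) (i := i) (by intro v; rw [D.co_perm_self]; ring)]
    simp
  rw [← Finset.card_map (D.perm i).toEmbedding]
  apply Finset.card_lt_card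
  rw [Finset.ssubset_iff_of_subset]
  · refine ⟨i, by simp [D.simple_pos hi, hneg], ?_⟩
    simp only [Finset.mem_map, Finset.mem_filter, Finset.mem_univ, true_and, not_exists, not_and,
      and_imp]
    rintro k hk - hki
    have h3 : D.co k D.omega = - D.co i D.omega := by
      have := D.co_refl i k (D.refl i • D.omega)
      rw [← mul_smul, D.refl_mul_self, one_smul] at this
      change D.perm i k = i at hki
      rw [this, hki, D.co_refl_self]
    have h4 := D.pos_omega hk
    have h5 := D.pos_omega (D.simple_pos hi)
    linarith
  · intro l hl
    simp only [Finset.mem_map, Finset.mem_filter, Finset.mem_univ, true_and] at hl ⊢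
    obtain ⟨k, ⟨hk, hk0⟩, rfl⟩ := hl
    refine ⟨?_, by rw [h1] at hk0; exact hk0⟩
    by_contra hnp
    obtain ⟨hc, hprop⟩ := D.prop_of_not_pos hi hk hnp
    rw [hscale hprop, hself] at hk0
    exact absurd (smul_nonneg hc.le (neg_nonneg.2 hneg.le)) (not_le.2 hk0)

theorem exists_smul_nonneg {Y G : Type*} [MulAction W Y] [AddCommGroup G] [LinearOrder G]
    [IsOrderedAddMonoid G] [Module F G] [PosSMulStrictMono F G] (ev : ι → Y → G)
    (h1 : ∀ i k y, ev k (D.refl i • y) = ev (D.perm i k) y)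
    (h2 : ∀ k y, ev k y = ∑ j ∈ D.simple, D.co k (D.om j) • ev j y) (y : Y) :
    ∃ u : W, ∀ j ∈ D.simple, 0 ≤ ev j (u • y) := by
  classical
  generalize hn : (Finset.univ.filter fun k => D.pos k ∧ ev k y < 0).card = n
  induction n using Nat.strong_induction_on generalizing y with
  | _ n ih =>
    by_cases hy : ∀ j ∈ D.simple, 0 ≤ ev j y
    · exact ⟨1, by simpa using hy⟩
    push Not at hy
    obtain ⟨i, hi, hneg⟩ := hy
    have hlt := D.card_neg_lt ev h1 h2 hi hneg
    obtain ⟨u, hu⟩ := ih _ (hn ▸ hlt) _ (by congr)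
    exact ⟨u * D.refl i, by simpa [mul_smul] using hu⟩

theorem co_nonneg {v : E} (hv : ∀ j ∈ D.simple, 0 ≤ D.co j v) {k : ι} (hk : D.pos k) :
    0 ≤ D.co k v := by
  rw [D.co_sum]
  exact Finset.sum_nonneg fun j hj => mul_nonneg (D.pos_om k hk j hj) (hv j hj)

theorem exists_dominant (v : E) : ∃ u : W, ∀ j ∈ D.simple, 0 ≤ D.co j (u • v) :=
  D.exists_smul_nonneg (fun k v => D.co k v) D.co_refl D.co_sum v

theorem exists_longest : ∃ u : W, ∀ j ∈ D.simple, D.co j (u • D.omega) < 0 := by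
  obtain ⟨u, hu⟩ := D.exists_dominant (-D.omega)
  refine ⟨u, fun j hj => lt_of_le_of_ne ?_ (D.co_smul_omega_ne u j)⟩
  have := hu j hj
  rw [smul_neg, map_neg] at this
  linarith

/-- The longest element of the Weyl group. -/
noncomputable def w0 : W := D.exists_longest.choose

theorem w0_simple {j : ι} (hj : j ∈ D.simple) : D.co j (D.w0 • D.omega) < 0 :=
  D.exists_longest.choose_spec j hj

theorem longest_neg {u : W} (h : ∀ j ∈ D.simple, D.co j (u • D.omega) < 0) {k : ι}
    (hk : D.pos k) : D.co k (u • D.omega) < 0 := by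
  refine lt_of_le_of_ne ?_ (D.co_smul_omega_ne u k)
  have := D.co_nonneg (v := - (u • D.omega)) (fun j hj => by
    rw [map_neg]; exact neg_nonneg.2 (h j hj).le) hk
  rw [map_neg] at this
  linarith

/-- Each factor reverses the sign of every simple coroot on the orbit of `omega`, so the product
keeps `omega` dominant. -/
theorem longest_mul_longest {u v : W} (hu : ∀ j ∈ D.simple, D.co j (u • D.omega) < 0)
    (hv : ∀ j ∈ D.simple, D.co j (v • D.omega) < 0) : u * v = 1 := by
  apply D.eq_one_of_nonneg
  intro i hi
  obtain ⟨σ, hσ⟩ := D.perm_smul u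
  have h1 : ¬ D.pos (σ i) := by
    rw [D.pos_iff, ← hσ]
    exact not_lt.2 (hu i hi).le
  rw [mul_smul, hσ, D.co_sum]
  exact Finset.sum_nonneg fun j hj => mul_nonneg_of_nonpos_of_nonpos (D.neg_om _ h1 j hj) (hv j hj).le

theorem w0_mul_self : D.w0 * D.w0 = 1 :=
  D.longest_mul_longest (fun _ => D.w0_simple) (fun _ => D.w0_simple)

theorem w0_inv : D.w0⁻¹ = D.w0 := inv_eq_of_mul_eq_one_left D.w0_mul_self

theorem eq_w0 {u : W} (hu : ∀ j ∈ D.simple, D.co j (u • D.omega) < 0) : u = D.w0 := by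
  have := D.longest_mul_longest hu (fun _ => D.w0_simple)
  rw [mul_eq_one_iff_eq_inv, D.w0_inv] at this
  exact this

theorem refl_ne_one (i : ι) : D.refl i ≠ 1 := by
  intro h
  have := D.co_refl_self i (D.al i)
  rw [h, one_smul, D.co_al] at this
  linarith

/-- Since `w0 * refl i` is not longest, some simple coroot `j` is positive on it. Its pullback by
`w0` is a negative coroot whose sign is changed by `refl i`, hence a multiple of `co i`. -/
theorem exists_refl_mul_w0 {i : ι} (hi : i ∈ D.simple) :
    ∃ j ∈ D.simple, D.refl i * D.w0 = D.w0 * D.refl j := by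
  have h1 : ∃ j ∈ D.simple, 0 < D.co j ((D.w0 * D.refl i) • D.omega) := by
    by_contra! h
    have := D.eq_w0 (u := D.w0 * D.refl i) fun j hj =>
      lt_of_le_of_ne (h j hj) (D.co_smul_omega_ne _ j)
    exact D.refl_ne_one i (mul_eq_left.1 this)
  obtain ⟨j, hj, hpos⟩ := h1
  obtain ⟨σ, hσ⟩ := D.perm_smul D.w0
  have hk : ¬ D.pos (σ j) := by
    rw [D.pos_iff, ← hσ]
    exact not_lt.2 (D.w0_simple hj).le
  have hk' := D.pos_perm_self hk
  have hnp : ¬ D.pos (D.perm i (D.perm (σ j) (σ j))) := by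
    rw [D.pos_iff, ← D.co_refl, D.co_perm_self, ← hσ, ← mul_smul]
    linarith
  obtain ⟨-, hprop⟩ := D.prop_of_not_pos hi hk' hnp
  set c := D.co (D.perm (σ j) (σ j)) (D.om i)
  have h2 := D.refl_mul_eq (i := j) (j := i) (u := D.w0) (c := -c) (by
    intro v
    have := hprop v
    rw [D.co_perm_self, ← hσ] at this
    linarith)
  refine ⟨j, hj, ?_⟩
  have h3 : D.w0 * (D.refl j * D.w0) = D.refl i := by
    rw [h2, ← mul_assoc, D.w0_mul_self, one_mul]
  rw [← h3, mul_assoc, mul_assoc, D.w0_mul_self, mul_one]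

theorem co_eta (i : ι) (hi : i ∈ D.simple) : D.co i (D.eta i) = 0 := by
  rw [eta, map_sub, D.co_om_self i hi, omega, map_sum, Finset.sum_eq_single_of_mem i hi,
    D.co_om_self i hi, sub_self]
  intro j hj hji
  exact D.co_om_ne i hi j hj hji.symm

theorem refl_eta {i : ι} (hi : i ∈ D.simple) : D.refl i • D.eta i = D.eta i := by
  rw [D.refl_smul, D.co_eta i hi, zero_smul, sub_zero]

theorem eta_eq_sum [DecidableEq ι] {i : ι} (hi : i ∈ D.simple) :
    D.eta i = ∑ j ∈ D.simple.erase i, D.om j := by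
  rw [eta, omega, ← Finset.add_sum_erase _ _ hi, add_sub_cancel_left]

theorem eta_nonneg {i k : ι} (hi : i ∈ D.simple) (hk : D.pos k) : 0 ≤ D.co k (D.eta i) := by
  classical
  rw [D.eta_eq_sum hi, map_sum]
  exact Finset.sum_nonneg fun j hj => D.pos_om k hk j (Finset.mem_of_mem_erase hj)

theorem pos_of_eta_pos {i k : ι} (hi : i ∈ D.simple) (h : 0 < D.co k (D.eta i)) : D.pos k := by
  classical
  by_contra hk
  rw [D.eta_eq_sum hi, map_sum] at h
  exact absurd h (not_lt.2
    (Finset.sum_nonpos fun j hj => D.neg_om k hk j (Finset.mem_of_mem_erase hj)))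

theorem eq_of_eta_eq_zero {i k : ι} (hi : i ∈ D.simple) (hk : D.pos k)
    (h : D.co k (D.eta i) = 0) :
    0 < D.co k (D.om i) ∧ ∀ v, D.co k v = D.co k (D.om i) * D.co i v := by
  apply D.prop_of_not_pos hi hk
  rw [D.pos_iff, ← D.co_refl]
  have h1 : D.omega = D.eta i + D.om i := by rw [eta, sub_add_cancel]
  have h2 := D.pos_omega hk
  rw [h1, map_add, h, zero_add] at h2
  have h4 : ∀ v, D.co k v = D.co k (D.om i) * D.co i v := by
    classical
    intro v
    rw [D.co_sum, Finset.sum_eq_single_of_mem i hi]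
    intro j hj hji
    rw [D.eta_eq_sum hi, map_sum, Finset.sum_eq_zero_iff_of_nonneg
      (fun j hj => D.pos_om k hk j (Finset.mem_of_mem_erase hj))] at h
    rw [h j (Finset.mem_erase.2 ⟨hji, hj⟩), zero_mul]
  rw [h4, D.co_refl_self]
  have := mul_pos h2 (D.pos_omega (D.simple_pos hi))
  linarith

/-- The only coroots vanishing on `eta i` are multiples of `co i`. A stabilizing `u` thus preserves
the sign of all other simple coroots, and that of `co i` too after possibly multiplying by `refl i`.
-/
theorem stab_eta {i : ι} (hi : i ∈ D.simple) {u : W} (hu : u • D.eta i = D.eta i) :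
    u = 1 ∨ u = D.refl i := by
  have key : ∀ u : W, u • D.eta i = D.eta i → 0 < D.co i (u • D.omega) → u = 1 := by
    intro u hu h0
    apply D.eq_one_of_nonneg
    intro k hk
    rcases (D.eta_nonneg hi (D.simple_pos hk)).eq_or_lt with h | h
    · obtain ⟨hc, hp⟩ := D.eq_of_eta_eq_zero hi (D.simple_pos hk) h.symm
      rw [hp]
      exact (mul_pos hc h0).le
    · obtain ⟨σ, hσ⟩ := D.perm_smul u
      rw [← hu, hσ] at h
      rw [hσ]
      exact (D.pos_omega (D.pos_of_eta_pos hi h)).le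
  rcases lt_or_gt_of_ne (D.co_smul_omega_ne u i) with h | h
  · right
    have := key (D.refl i * u) (by rw [mul_smul, hu, D.refl_eta hi])
      (by rw [mul_smul, D.co_refl_self]; linarith)
    rw [mul_eq_one_iff_eq_inv, ] at this
    rw [← inv_inv u, ← this, D.refl_inv]
  · exact Or.inl (key u hu h)

theorem smul_eta_eq {i : ι} (hi : i ∈ D.simple) {w w' : W} (h : w • D.eta i = w' • D.eta i) :
    w' = w ∨ w' = w * D.refl i := by
  have : (w⁻¹ * w') • D.eta i = D.eta i := by rw [mul_smul, ← h, inv_smul_smul]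
  rcases D.stab_eta hi this with h | h
  · exact Or.inl (inv_mul_eq_one.1 h).symm
  · exact Or.inr (inv_mul_eq_iff_eq_mul.1 h)

/-- If `j` is a left descent of `u`, then `co j (u • v)` is both `≥ 0` and `≤ 0`. So `refl j` fixes
`u • v`, and the exchange condition shortens `u`. -/
theorem smul_eq_of_dominant {v : E} {u : W} (hv : ∀ j ∈ D.simple, 0 ≤ D.co j v)
    (hu : ∀ j ∈ D.simple, 0 ≤ D.co j (u • v)) : u • v = v := by
  obtain ⟨n, hn⟩ := D.exists_isWord u
  induction n generalizing u with
  | zero => rw [D.isWord_zero.1 hn, one_smul]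
  | succ n ih =>
    by_cases h1 : u = 1
    · rw [h1, one_smul]
    obtain ⟨j, hj, hneg⟩ := D.exists_neg h1
    obtain ⟨m, hm, hw⟩ := D.exchange hj hn hneg
    obtain ⟨σ, hσ⟩ := D.perm_smul u
    have hnp : ¬ D.pos (σ j) := by
      rw [D.pos_iff, ← hσ]
      exact not_lt.2 hneg.le
    have h0 : D.co j (u • v) = 0 := by
      apply le_antisymm _ (hu j hj)
      rw [hσ, D.co_sum]
      exact Finset.sum_nonpos fun l hl =>
        mul_nonpos_of_nonpos_of_nonneg (D.neg_om _ hnp l hl) (hv l hl)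
    have h2 : (D.refl j * u) • v = u • v := by
      rw [mul_smul, D.refl_smul, h0, zero_smul, sub_zero]
    obtain rfl : m = n := by omega
    rw [← h2]
    exact ih (by rw [h2]; exact hu) hw

/-! ### Small perturbations and the ℓ¹-norm of the coroots -/

theorem exists_small {κ : Type*} (s : Finset κ) (a b : κ → F) :
    ∃ d : F, 0 < d ∧ ∀ k ∈ s, 0 < a k → d * b k < a k := by
  classical
  induction s using Finset.induction_on with
  | empty => exact ⟨1, one_pos, by simp⟩
  | insert k s _ ih =>
    obtain ⟨d, hd, h⟩ := ih
    by_cases ha : 0 < a k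
    · refine ⟨min d (a k / (|b k| + 1)), lt_min hd (div_pos ha (by positivity)), ?_⟩
      have hle : ∀ l, 0 < a l → ∀ d', d * b l < a l → 0 < d' → d' ≤ d → d' * b l < a l := by
        intro l hl d' h1 h2 h3
        rcases le_or_gt (b l) 0 with hb | hb
        · exact lt_of_le_of_lt (mul_nonpos_of_nonneg_of_nonpos h2.le hb) hl
        · exact lt_of_le_of_lt (mul_le_mul_of_nonneg_right h3 hb.le) h1
      intro l hl hl0
      rcases Finset.mem_insert.1 hl with rfl | hl
      · have h1 : a l / (|b l| + 1) * b l < a l := by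
          rw [div_mul_eq_mul_div, div_lt_iff₀ (by positivity)]
          have := le_abs_self (b l)
          nlinarith
        have h2 : 0 < a l / (|b l| + 1) := div_pos ha (by positivity)
        rcases le_or_gt (b l) 0 with hb | hb
        · exact lt_of_le_of_lt (mul_nonpos_of_nonneg_of_nonpos (lt_min hd h2).le hb) hl0
        · exact lt_of_le_of_lt (mul_le_mul_of_nonneg_right (min_le_right _ _) hb.le) h1
      · exact hle l hl0 _ (h l hl hl0) (lt_min hd (div_pos ha (by positivity))) (min_le_left _ _)
    · refine ⟨d, hd, fun l hl hl0 => ?_⟩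
      rcases Finset.mem_insert.1 hl with rfl | hl
      · exact absurd hl0 ha
      · exact h l hl hl0

/-- The sum of the absolute values of all coroots. -/
def anorm (v : E) : F := ∑ k, |D.co k v|

open scoped Classical in
/-- The sign of the `k`-th coroot at points `v - x` with `x` small in the fundamental chamber. -/
noncomputable def sgn (v : E) (k : ι) : F :=
  if 0 < D.co k v then 1 else if D.co k v < 0 then -1 else if D.pos k then -1 else 1

theorem sgn_mul_eq_abs {v x : E} (hx : ∀ k, D.pos k → 0 ≤ D.co k x)
    (hx' : ∀ k, ¬ D.pos k → D.co k x ≤ 0)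
    (h1 : ∀ k, 0 < D.co k v → D.co k x < D.co k v) (h2 : ∀ k, D.co k v < 0 → D.co k v < D.co k x)
    (k : ι) : D.sgn v k * D.co k (v - x) = |D.co k (v - x)| := by
  rw [map_sub, sgn]
  split_ifs with ha hb hc
  · rw [one_mul, abs_of_pos (sub_pos.2 (h1 k ha))]
  · rw [abs_of_neg (sub_neg.2 (h2 k hb))]; ring
  · have := le_antisymm (not_lt.1 ha) (not_lt.1 hb)
    rw [this, zero_sub, abs_neg, abs_of_nonneg (hx k hc)]; ring
  · have := le_antisymm (not_lt.1 ha) (not_lt.1 hb)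
    rw [this, zero_sub, abs_neg, abs_of_nonpos (hx' k hc)]; ring

theorem abs_sgn (v : E) (k : ι) : |D.sgn v k| = 1 := by
  rw [sgn]; split_ifs <;> simp

theorem nonpos_of_dominant {x : E} (hx : ∀ j ∈ D.simple, 0 ≤ D.co j x) {k : ι} (hk : ¬ D.pos k) :
    D.co k x ≤ 0 := by
  rw [D.co_sum]
  exact Finset.sum_nonpos fun j hj => mul_nonpos_of_nonpos_of_nonneg (D.neg_om k hk j hj) (hx j hj)

theorem exists_small_smul (v x : E) : ∃ d : F, 0 < d ∧
    (∀ k, 0 < D.co k v → D.co k (d • x) < D.co k v) ∧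
    (∀ k, D.co k v < 0 → D.co k v < D.co k (d • x)) := by
  obtain ⟨d, hd, h⟩ := exists_small (Finset.univ : Finset ι) (fun k => |D.co k v|)
    (fun k => |D.co k x|)
  refine ⟨d, hd, fun k hk => ?_, fun k hk => ?_⟩
  · have := h k (Finset.mem_univ k) (abs_pos.2 hk.ne')
    rw [abs_of_pos hk] at this
    rw [map_smul, smul_eq_mul]
    exact lt_of_le_of_lt (mul_le_mul_of_nonneg_left (le_abs_self _) hd.le) this
  · have := h k (Finset.mem_univ k) (abs_pos.2 hk.ne)
    rw [abs_of_neg hk] at this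
    rw [map_smul, smul_eq_mul]
    have h3 := mul_le_mul_of_nonneg_left (neg_abs_le (D.co k x)) hd.le
    linarith

theorem exists_small_smul₂ (v v' x : E) : ∃ d : F, 0 < d ∧
    ((∀ k, 0 < D.co k v → D.co k (d • x) < D.co k v) ∧
    (∀ k, D.co k v < 0 → D.co k v < D.co k (d • x))) ∧
    ((∀ k, 0 < D.co k v' → D.co k (d • x) < D.co k v') ∧
    (∀ k, D.co k v' < 0 → D.co k v' < D.co k (d • x))) := by
  obtain ⟨d, hd, h1, h2⟩ := D.exists_small_smul v x
  obtain ⟨d', hd', h1', h2'⟩ := D.exists_small_smul v' x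
  have aux : ∀ (e e' : F) (k : ι) (y : F), 0 < e → 0 < y → e' ≤ e → 0 < e' →
      e * D.co k x < y → e' * D.co k x < y := by
    intro e e' k y he hy hle he' h
    rcases le_or_gt (D.co k x) 0 with hb | hb
    · exact lt_of_le_of_lt (mul_nonpos_of_nonneg_of_nonpos he'.le hb) hy
    · exact lt_of_le_of_lt (mul_le_mul_of_nonneg_right hle hb.le) h
  have aux2 : ∀ (e e' : F) (k : ι) (y : F), 0 < e → y < 0 → e' ≤ e → 0 < e' →
      y < e * D.co k x → y < e' * D.co k x := by
    intro e e' k y he hy hle he' h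
    rcases le_or_gt (D.co k x) 0 with hb | hb
    · exact lt_of_lt_of_le h (mul_le_mul_of_nonpos_right hle hb)
    · exact lt_of_lt_of_le hy (mul_nonneg he'.le hb.le)
  have hm := lt_min hd hd'
  simp only [map_smul, smul_eq_mul] at *
  refine ⟨min d d', hm, ⟨fun k hk => aux d _ k _ hd hk (min_le_left _ _) hm (h1 k hk),
    fun k hk => aux2 d _ k _ hd hk (min_le_left _ _) hm (h2 k hk)⟩,
    ⟨fun k hk => aux d' _ k _ hd' hk (min_le_right _ _) hm (h1' k hk),
    fun k hk => aux2 d' _ k _ hd' hk (min_le_right _ _) hm (h2' k hk)⟩⟩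

/-- A vector is determined, within its Weyl group orbit, by its distances to the points of the
fundamental chamber. -/
theorem eq_of_anorm_eq {v : E} {g : W}
    (h : ∀ x, (∀ j ∈ D.simple, 0 ≤ D.co j x) → D.anorm (v - x) = D.anorm (g • v - x)) :
    g • v = v := by
  set v' := g • v with hv'
  -- For a small positive multiple of `x` every term of the two norms keeps its sign, so both norms
  -- are affine there and their linear parts can be compared.
  have hlin : ∀ x, (∀ j ∈ D.simple, 0 ≤ D.co j x) →
      ∑ k, D.sgn v k * D.co k x = ∑ k, D.sgn v' k * D.co k x := by
    intro x hx
    obtain ⟨d, hd, ⟨h1, h2⟩, h3, h4⟩ := D.exists_small_smul₂ v v' x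
    have hdx : ∀ j ∈ D.simple, 0 ≤ D.co j (d • x) := fun j hj => by
      rw [map_smul]; exact mul_nonneg hd.le (hx j hj)
    have hz : ∀ j ∈ D.simple, 0 ≤ D.co j (0 : E) := fun j _ => by simp
    have e1 := h (d • x) hdx
    have e0 := h 0 hz
    simp only [anorm] at e1 e0
    simp_rw [← D.sgn_mul_eq_abs (v := v) (x := d • x) (fun k => D.co_nonneg hdx)
      (fun k => D.nonpos_of_dominant hdx) h1 h2,
      ← D.sgn_mul_eq_abs (v := v') (x := d • x) (fun k => D.co_nonneg hdx)
      (fun k => D.nonpos_of_dominant hdx) h3 h4] at e1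
    simp_rw [← D.sgn_mul_eq_abs (v := v) (x := 0) (fun k => D.co_nonneg hz)
      (fun k => D.nonpos_of_dominant hz) (by simp) (by simp),
      ← D.sgn_mul_eq_abs (v := v') (x := 0) (fun k => D.co_nonneg hz)
      (fun k => D.nonpos_of_dominant hz) (by simp) (by simp)] at e0
    simp only [map_sub, map_smul, mul_sub, Finset.sum_sub_distrib, smul_eq_mul,
      sub_zero] at e1 e0
    rw [e0] at e1
    have e2 := sub_right_injective e1
    have e3 : ∀ w : E, ∑ k, D.sgn w k * (d * D.co k x) = d * ∑ k, D.sgn w k * D.co k x := by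
      intro w
      rw [Finset.mul_sum]
      exact Finset.sum_congr rfl fun _ _ => by ring
    simp only [e3] at e2
    exact mul_left_cancel₀ hd.ne' e2
  have hom : ∀ j ∈ D.simple, 0 ≤ D.co j D.omega := fun j hj => (D.pos_omega (D.simple_pos hj)).le
  -- The chamber has `omega` in its interior, so two functionals agreeing on it agree everywhere.
  have hlin' : ∀ x, ∑ k, D.sgn v k * D.co k x = ∑ k, D.sgn v' k * D.co k x := by
    intro x
    obtain ⟨d, hd, h1, -⟩ := D.exists_small_smul D.omega (-x)
    have e1 := hlin (D.omega + d • x) (fun j hj => by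
      have := h1 j (D.pos_omega (D.simple_pos hj))
      rw [smul_neg, map_neg] at this
      rw [map_add]; linarith)
    have e2 := hlin D.omega hom
    simp only [map_add, map_smul, mul_add, Finset.sum_add_distrib, e2, smul_eq_mul] at e1
    have e3 : ∀ w : E, ∑ k, D.sgn w k * (d * D.co k x) = d * ∑ k, D.sgn w k * D.co k x := by
      intro w
      rw [Finset.mul_sum]
      exact Finset.sum_congr rfl fun _ _ => by ring
    simp only [e3] at e1
    exact mul_left_cancel₀ hd.ne' (add_left_cancel e1)
  obtain ⟨d, hd, ⟨h1, h2⟩, -⟩ := D.exists_small_smul₂ v v' D.omega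
  have hdo : ∀ j ∈ D.simple, 0 ≤ D.co j (d • D.omega) := fun j hj => by
    rw [map_smul]; exact mul_nonneg hd.le (hom j hj)
  -- The vector `y` is regular, and the signs of `v` attain the maximal value `∑ |co k y|`. By
  -- `hlin'` the signs of `v'` attain it as well, so `v` and `v'` both lie in the closed chamber of
  -- `y`; being in one orbit, they coincide.
  set y := v - d • D.omega with hy
  have hsy : ∀ k, D.sgn v k * D.co k y = |D.co k y| :=
    D.sgn_mul_eq_abs (fun k => D.co_nonneg hdo) (fun k => D.nonpos_of_dominant hdo) h1 h2
  have hy0 : ∀ k, D.co k y ≠ 0 := by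
    intro k h0
    rw [hy, map_sub] at h0
    rcases lt_trichotomy (D.co k v) 0 with hk | hk | hk
    · have := h2 k hk; linarith
    · rw [hk, map_smul, zero_sub, smul_eq_mul, neg_eq_zero] at h0
      rcases mul_eq_zero.1 h0 with h | h
      · exact hd.ne' h
      · by_cases hp : D.pos k
        · exact (D.pos_omega hp).ne' h
        · exact (D.neg_omega hp).ne h
    · have := h1 k hk; linarith
  have hsgn : ∀ k, D.sgn v' k * D.co k y = |D.co k y| := by
    have hle : ∀ k ∈ Finset.univ, D.sgn v' k * D.co k y ≤ D.sgn v k * D.co k y := by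
      intro k _
      rw [hsy]
      refine (le_abs_self _).trans ?_
      rw [abs_mul, D.abs_sgn, one_mul]
    have := (Finset.sum_eq_sum_iff_of_le hle).1 (hlin' y).symm
    intro k
    rw [this k (Finset.mem_univ k), hsy]
  have hnn : ∀ w : E, (∀ k, D.sgn w k * D.co k y = |D.co k y|) → ∀ k, 0 ≤ D.co k y →
      0 ≤ D.co k w := by
    intro w hw k hk
    by_contra! hlt
    have := hw k
    rw [sgn, if_neg (not_lt.2 hlt.le), if_pos hlt, abs_of_nonneg hk] at this
    exact hy0 k (by linarith)
  obtain ⟨u, hu⟩ := D.exists_dominant y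
  obtain ⟨σ, hσ⟩ := D.perm_smul u
  have hu1 : ∀ j ∈ D.simple, 0 ≤ D.co j (u • v) := fun j hj => by
    rw [hσ]; exact hnn v hsy _ (by rw [← hσ]; exact hu j hj)
  have hu2 : ∀ j ∈ D.simple, 0 ≤ D.co j (u • v') := fun j hj => by
    rw [hσ]; exact hnn v' hsgn _ (by rw [← hσ]; exact hu j hj)
  have := D.smul_eq_of_dominant (v := u • v) (u := u * g * u⁻¹) hu1
    (by rw [mul_smul, mul_smul, inv_smul_smul]; exact hu2)
  rw [mul_smul, mul_smul, inv_smul_smul] at this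
  exact smul_left_cancel u this

/-- In terms of lengths, `refl j` shortens `w` on the left and `refl i` lengthens it on the right.
Equality would give `co j (w • x) • al j = co i x • (w • al i)` for all `x`; the choices `omega` and
`w⁻¹ • omega` demand opposite signs of `co j (w • al i)`. -/
theorem refl_mul_ne {i j : ι} {w : W} (hi : i ∈ D.simple) (hj : j ∈ D.simple)
    (h1 : D.co j (w • D.omega) < 0) (h2 : 0 < D.co i (w⁻¹ • D.omega)) :
    D.refl j * w ≠ w * D.refl i := by
  intro h
  have key : ∀ x : E, D.co j (w • x) • D.al j = D.co i x • (w • D.al i) := by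
    intro x
    have := congrArg (fun u : W => u • x) h
    simp only [mul_smul, D.refl_smul, smul_sub, D.smul_comm'] at this
    exact sub_right_injective this
  have k1 := key D.omega
  have k2 := key (w⁻¹ • D.omega)
  rw [smul_inv_smul] at k2
  have e1 := congrArg (D.co j) k1
  have e2 := congrArg (D.co j) k2
  simp only [map_smul, D.co_al, smul_eq_mul] at e1 e2
  have p1 := D.pos_omega (D.simple_pos hi)
  have p2 := D.pos_omega (D.simple_pos hj)
  have p3 : 0 < D.co j (w • D.al i) := by
    by_contra! hn
    nlinarith
  nlinarith

/-- Otherwise `refl j` changes the sign of the coroot `w⁻¹` pulls `co i` back to, which is then a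
positive multiple of `co j`; this makes `co i omega` negative. -/
theorem pos_of_refl_mul {i j : ι} {w : W} (hi : i ∈ D.simple) (hj : j ∈ D.simple)
    (h1 : D.co j (w • D.omega) < 0) (h2 : 0 < D.co i (w⁻¹ • D.omega)) :
    0 < D.co i ((D.refl j * w)⁻¹ • D.omega) := by
  rw [mul_inv_rev, D.refl_inv, mul_smul]
  obtain ⟨σ, hσ⟩ := D.perm_smul w⁻¹
  by_contra! hn
  have hp : D.pos (σ i) := by rw [D.pos_iff, ← hσ]; exact h2
  have hnp : ¬ D.pos (D.perm j (σ i)) := by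
    rw [D.pos_iff, ← D.co_refl, ← hσ]; exact not_lt.2 hn
  obtain ⟨hc, hprop⟩ := D.prop_of_not_pos hj hp hnp
  have h3 := hσ i (w • D.omega)
  rw [inv_smul_smul, hprop] at h3
  have := D.pos_omega (D.simple_pos hi)
  nlinarith

end WeylData
-- The model apartment over `Λ`
/-- The model apartment `M` over `Λ` attached to a root system: coroots extend to `ev`, and `tm` is
the canonical map from pairs (vector, scalar). -/
structure WeylModel (ι F E W Λ M : Type*) [Fintype ι] [Field F] [LinearOrder F]
    [IsStrictOrderedRing F] [AddCommGroup E] [Module F E] [Group W] [DistribMulAction W E]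
    [AddCommGroup Λ] [LinearOrder Λ] [Module F Λ] [AddCommGroup M] [DistribMulAction W M]
    extends WeylData ι F E W where
  ev : ι → M →+ Λ
  tm : E →+ Λ →+ M
  ev_tm : ∀ k v s, ev k (tm v s) = co k v • s
  smul_tm : ∀ (u : W) v s, u • tm v s = tm (u • v) s
  ev_refl : ∀ i k x, ev k (refl i • x) = ev (perm i k) x
  ev_sum : ∀ k x, ev k x = ∑ j ∈ simple, co k (om j) • ev j x
  opp : Equiv.Perm ι
  co_opp : ∀ k v, co (opp k) v = - co k v
  decomp : ∀ x, x = ∑ j ∈ simple, tm (om j) (ev j x)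

namespace WeylModel

variable {ι F E W Λ M : Type*} [Fintype ι] [Field F] [LinearOrder F]
    [IsStrictOrderedRing F] [AddCommGroup E] [Module F E] [Group W] [DistribMulAction W E]
    [AddCommGroup Λ] [LinearOrder Λ] [IsOrderedAddMonoid Λ] [Module F Λ] [PosSMulStrictMono F Λ]
    [AddCommGroup M] [DistribMulAction W M]
    (D : WeylModel ι F E W Λ M)

theorem exists_perm (u : W) : ∃ σ : Equiv.Perm ι, (∀ k (v : E), D.co k (u • v) = D.co (σ k) v) ∧
    ∀ k (x : M), D.ev k (u • x) = D.ev (σ k) x := by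
  have hu : u ∈ Subgroup.closure (Set.range D.refl) := by rw [D.gen]; trivial
  induction hu using Subgroup.closure_induction with
  | mem x hx =>
    obtain ⟨i, rfl⟩ := hx
    exact ⟨D.perm i, D.co_refl i, D.ev_refl i⟩
  | one => exact ⟨1, by simp⟩
  | mul x y _ _ hx hy =>
    obtain ⟨σ, hσ, hσ'⟩ := hx
    obtain ⟨τ, hτ, hτ'⟩ := hy
    exact ⟨τ * σ, fun k v => by rw [mul_smul, hσ, hτ]; rfl,
      fun k v => by rw [mul_smul, hσ', hτ']; rfl⟩
  | inv x _ hx =>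
    obtain ⟨σ, hσ, hσ'⟩ := hx
    refine ⟨σ⁻¹, fun k v => ?_, fun k v => ?_⟩
    · have := hσ (σ⁻¹ k) (x⁻¹ • v)
      rw [smul_inv_smul] at this
      rw [this]; simp
    · have := hσ' (σ⁻¹ k) (x⁻¹ • v)
      rw [smul_inv_smul] at this
      rw [this]; simp

theorem ev_prop {k i : ι} {c : F} (h : ∀ v, D.co k v = c * D.co i v) (x : M) :
    D.ev k x = c • D.ev i x := by
  rw [D.ev_sum, D.ev_sum i, Finset.smul_sum]
  exact Finset.sum_congr rfl fun j _ => by rw [h, mul_smul]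

theorem smul_zero_left {v : E} {s : Λ} (h : ∀ k, D.co k v • s = 0) (hs : s ≠ 0) : v = 0 :=
  D.sep v fun k => (smul_eq_zero.1 (h k)).resolve_right hs

theorem tm_left_cancel {v v' : E} {s : Λ} (hs : s ≠ 0) (h : D.tm v s = D.tm v' s) : v = v' := by
  rw [← sub_eq_zero]
  apply D.smul_zero_left (s := s) _ hs
  intro k
  rw [map_sub, sub_smul, ← D.ev_tm, ← D.ev_tm, h, sub_self]

/-- The fundamental chamber of the model apartment. -/
def Dom (x : M) : Prop := ∀ k, D.pos k → 0 ≤ D.ev k x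

theorem dom_of_simple {x : M} (h : ∀ j ∈ D.simple, 0 ≤ D.ev j x) : D.Dom x := by
  intro k hk
  rw [D.ev_sum]
  exact Finset.sum_nonneg fun j hj => smul_nonneg (D.pos_om k hk j hj) (h j hj)

theorem Dom.nonpos {D : WeylModel ι F E W Λ M} {x : M} (h : D.Dom x) {k : ι} (hk : ¬ D.pos k) :
    D.ev k x ≤ 0 := by
  rw [D.ev_sum]
  exact Finset.sum_nonpos fun j hj =>
    smul_nonpos_of_nonpos_of_nonneg (D.neg_om k hk j hj) (h j (D.simple_pos hj))

theorem dom_zero : D.Dom 0 := fun k _ => by rw [map_zero]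

theorem Dom.add {D : WeylModel ι F E W Λ M} {x y : M} (hx : D.Dom x) (hy : D.Dom y) :
    D.Dom (x + y) := fun k hk => by
  rw [map_add]; exact add_nonneg (hx k hk) (hy k hk)

theorem dom_tm {v : E} (hv : ∀ k, D.pos k → 0 ≤ D.co k v) {s : Λ} (hs : 0 ≤ s) :
    D.Dom (D.tm v s) := fun k hk => by
  rw [D.ev_tm]; exact smul_nonneg (hv k hk) hs

/-- The line through the origin in the direction of the dominant regular vector. -/
def reg (s : Λ) : M := D.tm D.omega s

theorem reg_add (s t : Λ) : D.reg (s + t) = D.reg s + D.reg t := map_add _ _ _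

theorem reg_sub (s t : Λ) : D.reg (s - t) = D.reg s - D.reg t := map_sub _ _ _

theorem reg_zero : D.reg 0 = 0 := map_zero _

theorem ev_reg (k : ι) (s : Λ) : D.ev k (D.reg s) = D.co k D.omega • s := D.ev_tm _ _ _

theorem dom_reg {s : Λ} (hs : 0 ≤ s) : D.Dom (D.reg s) :=
  D.dom_tm (fun _ hk => (D.pos_omega hk).le) hs

theorem reg_cancel {u v : W} {s : Λ} (hs : s ≠ 0) (h : u • D.reg s = v • D.reg s) : u = v := by
  rw [reg, D.smul_tm, D.smul_tm] at h
  exact D.eq_of_smul_omega (D.tm_left_cancel hs h)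

theorem exists_reg (x : M) : ∃ s, 0 ≤ s ∧ D.Dom (D.reg s - x) := by
  refine ⟨∑ k, |(D.co k D.omega)⁻¹ • D.ev k x|, Finset.sum_nonneg fun _ _ => abs_nonneg _, ?_⟩
  intro k hk
  have h1 := D.pos_omega hk
  rw [map_sub, D.ev_reg, sub_nonneg]
  have h2 : (D.co k D.omega)⁻¹ • D.ev k x ≤ ∑ k, |(D.co k D.omega)⁻¹ • D.ev k x| :=
    (le_abs_self _).trans (Finset.single_le_sum (f := fun k => |(D.co k D.omega)⁻¹ • D.ev k x|)
      (fun _ _ => abs_nonneg _) (Finset.mem_univ k))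
  have := smul_le_smul_of_nonneg_left h2 h1.le
  rwa [smul_inv_smul₀ h1.ne'] at this

theorem exists_reg_ge (x : M) (s₀ : Λ) : ∃ s, s₀ ≤ s ∧ 0 ≤ s ∧ D.Dom (D.reg s - x) := by
  obtain ⟨s, hs, h⟩ := D.exists_reg x
  refine ⟨s + |s₀|, ?_, add_nonneg hs (abs_nonneg _), ?_⟩
  · exact (le_abs_self s₀).trans (le_add_of_nonneg_left hs)
  · rw [reg_add, add_sub_right_comm]
    exact h.add (D.dom_reg (abs_nonneg _))

theorem exists_common (a b : M) : ∃ c, D.Dom (c - a) ∧ D.Dom (c - b) := by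
  obtain ⟨s, hs, h⟩ := D.exists_reg (b - a)
  refine ⟨a + D.reg s, ?_, ?_⟩
  · rw [add_sub_cancel_left]; exact D.dom_reg hs
  · have : a + D.reg s - b = D.reg s - (b - a) := by abel
    rwa [this]

theorem exists_smul_dom (x : M) : ∃ u : W, D.Dom (u • x) := by
  obtain ⟨u, hu⟩ := D.exists_smul_nonneg (fun k (x : M) => D.ev k x) D.ev_refl D.ev_sum x
  exact ⟨u, D.dom_of_simple hu⟩

theorem dom_neg_w0 {x : M} (hx : D.Dom x) : D.Dom (-(D.w0 • x)) := by
  intro k hk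
  obtain ⟨σ, hσ, hσ'⟩ := D.exists_perm D.w0
  rw [map_neg, hσ', neg_nonneg]
  apply hx.nonpos
  rw [D.pos_iff, ← hσ]
  exact not_lt.2 (D.longest_neg (fun _ => D.w0_simple) hk).le

open scoped Classical in
/-- The distance from the origin. -/
noncomputable def nrm (x : M) : Λ := ∑ k with D.pos k, |D.ev k x|

theorem ev_opp (k : ι) (x : M) : D.ev (D.opp k) x = - D.ev k x := by
  rw [D.ev_prop (c := -1) (k := D.opp k) (i := k) (fun v => by rw [D.co_opp]; ring)]
  simp

theorem pos_opp (k : ι) : D.pos (D.opp k) ↔ ¬ D.pos k := by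
  constructor
  · intro h hk
    rw [D.pos_iff] at h hk
    rw [D.co_opp] at h
    linarith
  · intro h
    rw [D.pos_iff, D.co_opp]
    exact neg_pos.2 (D.neg_omega h)

/-- Summing over all roots makes the invariance under `W` visible; `opp` exchanges the positive and
the negative half of the sum. -/
theorem two_nrm (x : M) : 2 • D.nrm x = ∑ k, |D.ev k x| := by
  classical
  have h : ∑ k with D.pos k, |D.ev k x| = ∑ k with ¬ D.pos k, |D.ev k x| := by
    refine Finset.sum_equiv D.opp (fun k => ?_) (fun k _ => ?_)
    · simp [D.pos_opp]
    · rw [D.ev_opp, abs_neg]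
  rw [nrm, two_nsmul, ← Finset.sum_filter_add_sum_filter_not Finset.univ D.pos]
  congr 1

theorem two_nsmul_cancel {a b : Λ} (h : 2 • a = 2 • b) : a = b :=
  nsmul_right_injective two_ne_zero h

theorem nrm_smul (u : W) (x : M) : D.nrm (u • x) = D.nrm x := by
  apply two_nsmul_cancel
  obtain ⟨σ, -, hσ⟩ := D.exists_perm u
  simp only [two_nrm, hσ]
  exact Equiv.sum_comp σ (fun k => |D.ev k x|)

theorem nrm_neg (x : M) : D.nrm (-x) = D.nrm x := by
  simp only [nrm, map_neg, abs_neg]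

theorem nrm_nonneg (x : M) : 0 ≤ D.nrm x := Finset.sum_nonneg fun _ _ => abs_nonneg _

theorem nrm_zero : D.nrm 0 = 0 := by simp [nrm]

theorem nrm_add_le (x y : M) : D.nrm (x + y) ≤ D.nrm x + D.nrm y := by
  simp only [nrm, map_add, ← Finset.sum_add_distrib]
  exact Finset.sum_le_sum fun _ _ => abs_add_le _ _

theorem nrm_add_of_dom {x y : M} (hx : D.Dom x) (hy : D.Dom y) :
    D.nrm (x + y) = D.nrm x + D.nrm y := by
  simp only [nrm, map_add, ← Finset.sum_add_distrib]
  refine Finset.sum_congr rfl fun k hk => ?_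
  have hk : D.pos k := by classical exact (Finset.mem_filter.1 hk).2
  rw [abs_of_nonneg (hx k hk), abs_of_nonneg (hy k hk),
    abs_of_nonneg (add_nonneg (hx k hk) (hy k hk))]

theorem ev_le_nrm {k : ι} (x : M) : |D.ev k x| ≤ D.nrm x := by
  have key : ∀ k, D.pos k → |D.ev k x| ≤ D.nrm x := fun k hk => by
    classical
    exact Finset.single_le_sum (f := fun k => |D.ev k x|) (fun _ _ => abs_nonneg _)
      (Finset.mem_filter.2 ⟨Finset.mem_univ k, hk⟩)
  by_cases hk : D.pos k
  · exact key k hk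
  · have := key _ ((D.pos_opp k).2 hk)
    rwa [D.ev_opp, abs_neg] at this

theorem two_nrm_tm (v : E) {s : Λ} (hs : 0 ≤ s) : 2 • D.nrm (D.tm v s) = D.anorm v • s := by
  rw [two_nrm, WeylData.anorm, Finset.sum_smul]
  refine Finset.sum_congr rfl fun k _ => ?_
  rw [D.ev_tm]
  rcases le_total 0 (D.co k v) with h | h
  · rw [abs_of_nonneg h, abs_of_nonneg (smul_nonneg h hs)]
  · rw [abs_of_nonpos h, abs_of_nonpos (smul_nonpos_of_nonpos_of_nonneg h hs), neg_smul]

theorem nrm_tm_add (v : E) {s t : Λ} (hs : 0 ≤ s) (ht : 0 ≤ t) :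
    D.nrm (D.tm v (s + t)) = D.nrm (D.tm v s) + D.nrm (D.tm v t) := by
  apply two_nsmul_cancel
  rw [nsmul_add, D.two_nrm_tm v hs, D.two_nrm_tm v ht, D.two_nrm_tm v (add_nonneg hs ht), smul_add]

end WeylModel

/-! ### Atlases: transition maps and convexity of overlaps -/

/-- The properties of the atlas `𝒜` of a generalized affine building used below, in terms of the
underlying abstract model apartment. -/
structure Atlas {ι F E W Λ M X : Type*} [Fintype ι] [Field F] [LinearOrder F]
    [IsStrictOrderedRing F] [AddCommGroup E] [Module F E] [Group W] [DistribMulAction W E]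
    [AddCommGroup Λ] [LinearOrder Λ] [Module F Λ] [AddCommGroup M] [DistribMulAction W M]
    (D : WeylModel ι F E W Λ M) (𝒜 : Set (M → X)) (dX : X → X → Λ) : Prop where
  inj : ∀ f ∈ 𝒜, Function.Injective f
  tw_mem : ∀ f ∈ 𝒜, ∀ u : W, (fun x => f (u • x)) ∈ 𝒜
  trans : ∀ f ∈ 𝒜, ∀ g ∈ 𝒜, ∀ a b, f a = g b → ∃ (u : W) (t : M) (J : Finset (ι × Λ)),
    (∀ x, f x ∈ Set.range g → f x = g (u • x + t)) ∧
    ∀ x, f x ∈ Set.range g ↔ ∀ p ∈ J, p.2 ≤ D.ev p.1 x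
  join : ∀ x y, ∃ f ∈ 𝒜, x ∈ Set.range f ∧ y ∈ Set.range f
  ends : ∀ f ∈ 𝒜, ∀ g ∈ 𝒜, ∃ f₁ ∈ 𝒜, ∃ g₁ ∈ 𝒜, ∃ h ∈ 𝒜, ∃ a₁ b₁, ∀ e, D.Dom e →
    (∃ e', D.Dom e' ∧ f₁ (a₁ + e) = f e') ∧ (∃ e', D.Dom e' ∧ g₁ (b₁ + e) = g e') ∧
    f₁ (a₁ + e) ∈ Set.range h ∧ g₁ (b₁ + e) ∈ Set.range h
  dist_eq : ∀ f ∈ 𝒜, ∀ a b, dX (f a) (f b) = D.nrm (b - a)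
  triangle : ∀ x y z, dX x z ≤ dX x y + dX y z
  meet : ∀ f ∈ 𝒜, ∀ g ∈ 𝒜, ∀ h ∈ 𝒜,
    (∃ i k, ∀ x, f x ∈ Set.range g ↔ k ≤ D.ev i x) →
    (∃ i k, ∀ x, g x ∈ Set.range h ↔ k ≤ D.ev i x) →
    (∃ i k, ∀ x, f x ∈ Set.range h ↔ k ≤ D.ev i x) →
    ∃ x, f x ∈ Set.range g ∧ f x ∈ Set.range h

namespace Atlas

variable {ι F E W Λ M X : Type*} [Fintype ι] [Field F] [LinearOrder F]
    [IsStrictOrderedRing F] [AddCommGroup E] [Module F E] [Group W] [DistribMulAction W E]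
    [AddCommGroup Λ] [LinearOrder Λ] [IsOrderedAddMonoid Λ] [Module F Λ] [PosSMulStrictMono F Λ]
    [Nontrivial Λ] [AddCommGroup M] [DistribMulAction W M]
    {D : WeylModel ι F E W Λ M} {𝒜 : Set (M → X)} {dX : X → X → Λ} (H : Atlas D 𝒜 dX)
include H

theorem exists_pos : ∃ s : Λ, 0 < s := by
  obtain ⟨s, hs⟩ := exists_ne (0 : Λ)
  exact ⟨|s|, abs_pos.2 hs⟩

theorem dist_comm (x y : X) : dX x y = dX y x := by
  obtain ⟨f, hf, ⟨a, rfl⟩, b, rfl⟩ := H.join x y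
  rw [H.dist_eq f hf, H.dist_eq f hf, ← D.nrm_neg, neg_sub]

/-- The linear part of the transition fixes a nonzero regular vector, hence is `1`. One matching
regular segment therefore determines the transition on the whole overlap. -/
theorem trans_of_reg {f g : M → X} (hf : f ∈ 𝒜) (hg : g ∈ 𝒜) {a b : M} {s : Λ} (hs : s ≠ 0)
    (h0 : f a = g b) (h1 : f (a + D.reg s) = g (b + D.reg s)) {x : M}
    (hx : f x ∈ Set.range g) : f x = g (x - a + b) := by
  obtain ⟨u, t, J, h, -⟩ := H.trans f hf g hg a b h0
  have e0 := h a ⟨b, h0.symm⟩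
  have e1 := h _ ⟨_, h1.symm⟩
  rw [h0] at e0
  rw [h1] at e1
  have e0' := H.inj g hg e0
  have e1' := H.inj g hg e1
  rw [e0', smul_add] at e1'
  have hu : (1 : W) • D.reg s = u • D.reg s := by
    rw [one_smul]
    have : u • a + t + D.reg s = u • a + t + u • D.reg s := by rw [e1']; abel
    exact add_left_cancel this
  obtain rfl := D.reg_cancel hs hu
  rw [h x hx, e0']
  simp only [one_smul]
  congr 1
  abel

/-- On the box between `a` and `a + Y`, a positive root is smallest at `a` and a negative one at `a
+ Y`, so each half-apartment containing both corners contains the box. -/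
theorem range_box {f g : M → X} (hf : f ∈ 𝒜) (hg : g ∈ 𝒜) {a Y e : M}
    (h0 : f a ∈ Set.range g) (h1 : f (a + Y) ∈ Set.range g) (he : D.Dom e) (hY : D.Dom (Y - e)) :
    f (a + e) ∈ Set.range g := by
  obtain ⟨b, hb⟩ := h0
  obtain ⟨u, t, J, -, hJ⟩ := H.trans f hf g hg a b hb.symm
  rw [hJ] at h1 ⊢
  have h0 := (hJ a).1 ⟨b, hb⟩
  intro p hp
  have h2 := h0 p hp
  have h3 := h1 p hp
  rw [map_add] at h3 ⊢
  by_cases hk : D.pos p.1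
  · exact h2.trans (le_add_of_nonneg_right (he _ hk))
  · refine h3.trans (add_le_add_right ?_ _)
    have := hY.nonpos hk
    rw [map_sub, sub_nonpos] at this
    exact this

/-- A negative slope `c` is refuted at `s = (-c)⁻¹ • (|ev a - p.2| + e)`. The parameter ranges over
all of `Λ` and scalars of `F` can be inverted, so no Archimedean property is needed. -/
theorem bounded_below {p : ι × Λ} {u : W} {a : M}
    (h : ∀ s : Λ, 0 ≤ s → p.2 ≤ D.ev p.1 (a + u • D.reg s)) : 0 ≤ D.co p.1 (u • D.omega) := by
  by_contra! hlt
  set c := D.co p.1 (u • D.omega) with hc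
  have h1 : ∀ s : Λ, 0 ≤ s → (-c) • s ≤ D.ev p.1 a - p.2 := by
    intro s hs
    have := h s hs
    rw [map_add, WeylModel.reg, D.smul_tm, D.ev_tm, ← hc] at this
    rw [neg_smul]
    rw [le_sub_iff_add_le]
    rw [add_comm (-(c • s)), ← sub_eq_add_neg, sub_le_iff_le_add]
    exact this
  obtain ⟨e, he⟩ := H.exists_pos
  have hcp : 0 < -c := neg_pos.2 hlt
  have h2 := h1 ((-c)⁻¹ • (|D.ev p.1 a - p.2| + e))
    (smul_nonneg (inv_nonneg.2 hcp.le) (add_nonneg (abs_nonneg _) he.le))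
  rw [smul_inv_smul₀ hcp.ne'] at h2
  have h3 := le_abs_self (D.ev p.1 a - p.2)
  exact absurd (h2.trans h3) (not_le.2 (lt_add_of_pos_right _ he))

/-- Half-apartments containing a translate of the fundamental chamber belong to positive roots,
which do not decrease in dominant directions. -/
theorem range_cone {f g : M → X} (hf : f ∈ 𝒜) (hg : g ∈ 𝒜) {a b e : M}
    (h0 : f b ∈ Set.range g) (h1 : ∀ e, D.Dom e → f (a + e) ∈ Set.range g) (he : D.Dom e) :
    f (b + e) ∈ Set.range g := by
  obtain ⟨b', hb⟩ := h0
  obtain ⟨u, t, J, -, hJ⟩ := H.trans f hf g hg b b' hb.symm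
  have h0 := (hJ b).1 ⟨b', hb⟩
  rw [hJ]
  intro p hp
  have hk : D.pos p.1 := by
    apply D.pos_of_nonneg
    have := H.bounded_below (p := p) (u := 1) (a := a) (fun s hs => by
      rw [one_smul]
      exact (hJ _).1 (h1 _ (D.dom_reg hs)) p hp)
    rwa [one_smul] at this
  rw [map_add]
  exact (h0 p hp).trans (le_add_of_nonneg_right (he _ hk))

end Atlas
-- Spherical buildings and the Weyl distance
/-- A system of charts for a spherical building: each element of `Ch` stands for an apartment
together with a chamber of it, `tw` changes the chamber in the apartment, `eqv` is equality of the
underlying chambers and `adj i` is adjacency of type `i` or equality. -/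
structure ChamberSystem {ι F E W : Type*} [Fintype ι] [Field F] [LinearOrder F]
    [IsStrictOrderedRing F] [AddCommGroup E] [Module F E] [Group W] [DistribMulAction W E]
    (D : WeylData ι F E W) (Ch : Type*) where
  tw : Ch → W → Ch
  eqv : Ch → Ch → Prop
  adj : ι → Ch → Ch → Prop
  tw_one : ∀ c, tw c 1 = c
  tw_tw : ∀ c u v, tw (tw c u) v = tw c (u * v)
  eqv_refl : ∀ c, eqv c c
  eqv_symm : ∀ {c d}, eqv c d → eqv d c
  eqv_trans : ∀ {c d e}, eqv c d → eqv d e → eqv c e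
  adj_symm : ∀ {i c d}, adj i c d → adj i d c
  adj_trans : ∀ {i c d e}, adj i c d → adj i d e → adj i c e
  adj_of_eqv : ∀ {i c d}, i ∈ D.simple → eqv c d → adj i c d
  ends : ∀ c d, ∃ h w, eqv c h ∧ eqv d (tw h w)
  uniq : ∀ {h h' w w'}, eqv h h' → eqv (tw h w) (tw h' w') → w = w'
  adj_refl : ∀ {i} h, i ∈ D.simple → adj i h (tw h (D.refl i))
  adj_tw : ∀ {i h h' w w'}, i ∈ D.simple → eqv h h' → adj i (tw h w) (tw h' w') →
    w' = w ∨ w' = w * D.refl i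

namespace ChamberSystem

variable {ι F E W : Type*} [Fintype ι] [Field F] [LinearOrder F]
    [IsStrictOrderedRing F] [AddCommGroup E] [Module F E] [Group W] [DistribMulAction W E]
    {D : WeylData ι F E W} {Ch : Type*} (S : ChamberSystem D Ch)

/-- The Weyl distance. -/
def Delta (c d : Ch) (w : W) : Prop := ∃ h, S.eqv c h ∧ S.eqv d (S.tw h w)

variable {S}

theorem exists_delta (c d : Ch) : ∃ w, S.Delta c d w := by
  obtain ⟨h, w, h1, h2⟩ := S.ends c d
  exact ⟨w, h, h1, h2⟩

theorem delta_tw (c : Ch) (w : W) : S.Delta c (S.tw c w) w := ⟨c, S.eqv_refl _, S.eqv_refl _⟩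

theorem Delta.symm {c d : Ch} {w : W} (h : S.Delta c d w) : S.Delta d c w⁻¹ := by
  obtain ⟨k, h1, h2⟩ := h
  exact ⟨S.tw k w, h2, by rwa [S.tw_tw, mul_inv_cancel, S.tw_one]⟩

theorem Delta.unique {c d : Ch} {w w' : W} (h : S.Delta c d w) (h' : S.Delta c d w') : w = w' := by
  obtain ⟨k, h1, h2⟩ := h
  obtain ⟨k', h1', h2'⟩ := h'
  exact S.uniq (S.eqv_trans (S.eqv_symm h1) h1') (S.eqv_trans (S.eqv_symm h2) h2')

theorem Delta.left {c c' d : Ch} {w : W} (h : S.Delta c d w) (hc : S.eqv c c') :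
    S.Delta c' d w := by
  obtain ⟨k, h1, h2⟩ := h
  exact ⟨k, S.eqv_trans (S.eqv_symm hc) h1, h2⟩

theorem delta_one {c d : Ch} : S.Delta c d 1 ↔ S.eqv c d := by
  constructor
  · rintro ⟨k, h1, h2⟩
    rw [S.tw_one] at h2
    exact S.eqv_trans h1 (S.eqv_symm h2)
  · intro h
    exact ⟨d, h, by rw [S.tw_one]; exact S.eqv_refl _⟩

theorem Delta.adj {c d d' : Ch} {w : W} {i : ι} (hi : i ∈ D.simple) (h : S.Delta c d w)
    (hd : S.adj i d d') : S.Delta c d' w ∨ S.Delta c d' (w * D.refl i) := by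
  obtain ⟨k, h1, h2⟩ := h
  obtain ⟨k', w', h1', h2'⟩ := S.ends c d'
  have hadj : S.adj i (S.tw k w) (S.tw k' w') :=
    S.adj_trans (S.adj_symm (S.adj_of_eqv hi h2)) (S.adj_trans hd (S.adj_of_eqv hi h2'))
  rcases S.adj_tw hi (S.eqv_trans (S.eqv_symm h1) h1') hadj with rfl | rfl
  · exact Or.inl ⟨k', h1', h2'⟩
  · exact Or.inr ⟨k', h1', h2'⟩

/-- The alternative in `Delta.adj` is decided when `refl i` lengthens `w`. Induction on the length:
if `c'` also had distance `w`, a left descent `j` of `w` would give `j`-neighbours of `c₀` on the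
way to `c` and to `c'`, and comparing their distances to `c` and `c'` leads to a contradiction. -/
theorem delta_mul_refl_aux {n : ℕ} : ∀ {w : W}, D.IsWord n w → ∀ {i : ι} {c₀ c c' : Ch},
    i ∈ D.simple → S.Delta c₀ c w → S.adj i c c' → ¬ S.eqv c c' →
    0 < D.co i (w⁻¹ • D.omega) → S.Delta c₀ c' (w * D.refl i) := by
  induction n with
  | zero =>
    intro w hw i c₀ c c' hi hd hadj hne hpos
    rw [D.isWord_zero] at hw
    subst hw
    refine (hd.adj hi hadj).resolve_left fun h => hne ?_
    rw [delta_one] at h hd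
    exact S.eqv_trans (S.eqv_symm hd) h
  | succ n ih =>
    intro w hw i c₀ c c' hi hd hadj hne hpos
    refine (hd.adj hi hadj).resolve_left fun hd' => ?_
    have hw1 : w ≠ 1 := by
      rintro rfl
      rw [delta_one] at hd hd'
      exact hne (S.eqv_trans (S.eqv_symm hd) hd')
    obtain ⟨j, hj, hneg⟩ := D.exists_neg hw1
    obtain ⟨m, hm, hword⟩ := D.exchange hj hw hneg
    obtain rfl : n = m := by omega
    obtain ⟨k, h1, h2⟩ := hd
    obtain ⟨k', h1', h2'⟩ := hd'
    have hjj : ∀ x : W, D.refl j * (D.refl j * x) = x := fun x => by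
      rw [← mul_assoc, D.refl_mul_self, one_mul]
    -- In each of the two apartments, the `j`-neighbour of `c₀` is one step closer to `c`,
    -- respectively to `c'`.
    have hc1 : S.Delta (S.tw k (D.refl j)) c (D.refl j * w) :=
      ⟨_, S.eqv_refl _, by rwa [S.tw_tw, hjj]⟩
    have hd1 : S.Delta (S.tw k' (D.refl j)) c' (D.refl j * w) :=
      ⟨_, S.eqv_refl _, by rwa [S.tw_tw, hjj]⟩
    have hR := ih hword hi hc1 hadj hne (D.pos_of_refl_mul hi hj hneg hpos)
    by_cases heq : S.eqv (S.tw k (D.refl j)) (S.tw k' (D.refl j))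
    · have := (hR.left heq).unique hd1
      exact D.refl_ne_one i (mul_eq_left.1 this)
    · have hadj' : S.adj j (S.tw k (D.refl j)) (S.tw k' (D.refl j)) :=
        S.adj_trans (S.adj_symm (S.adj_refl k hj)) (S.adj_trans
          (S.adj_of_eqv hj (S.eqv_trans (S.eqv_symm h1) h1')) (S.adj_refl k' hj))
      -- The induction hypothesis for the inverse distance puts the second neighbour at distance `w`
      -- from `c`. Its distance to `c'` is then `w` or `w * refl i`, but it is also `refl j * w`,
      -- which differs from both.
      have h3 := ih hword.inv hj hc1.symm hadj' heq (by
        rw [inv_inv, mul_smul, D.co_refl_self]; linarith)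
      have h4 := h3.symm
      rw [mul_inv_rev, inv_inv, D.refl_inv, hjj] at h4
      rcases h4.adj hi hadj with h5 | h5
      · have := h5.unique hd1
        exact D.refl_ne_one j (mul_eq_right.1 this.symm)
      · exact D.refl_mul_ne hi hj hneg hpos (hd1.unique h5)

theorem Delta.mul_refl {w : W} {i : ι} {c₀ c c' : Ch} (hd : S.Delta c₀ c w) (hi : i ∈ D.simple)
    (hadj : S.adj i c c') (hne : ¬ S.eqv c c') (hpos : 0 < D.co i (w⁻¹ • D.omega)) :
    S.Delta c₀ c' (w * D.refl i) := by
  obtain ⟨n, hn⟩ := D.exists_isWord w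
  exact delta_mul_refl_aux hn hi hd hadj hne hpos

theorem not_eqv_refl (c : Ch) (i : ι) : ¬ S.eqv c (S.tw c (D.refl i)) := fun h =>
  D.refl_ne_one i ((delta_one.2 h).unique (delta_tw c _)).symm

/-- Every apartment contains a chamber opposite to a given one. -/
theorem exists_opposite (c d : Ch) : ∃ u, S.Delta c (S.tw d u) D.w0 := by
  classical
  obtain ⟨w, hw⟩ := exists_delta (S := S) c d
  -- The count is that of the positive roots with `co k (w⁻¹ • omega) > 0`; it measures how far `w`
  -- is from the longest element.
  generalize hn : (Finset.univ.filter fun k => D.pos k ∧ D.co k (-(w⁻¹ • D.omega)) < 0).card = n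
  induction n using Nat.strong_induction_on generalizing w d with
  | _ n ih =>
    by_cases h : ∃ i ∈ D.simple, 0 < D.co i (w⁻¹ • D.omega)
    · obtain ⟨i, hi, hpos⟩ := h
      have h1 := hw.mul_refl hi (S.adj_refl d hi) (not_eqv_refl d i) hpos
      have hlt := D.card_neg_lt (fun k v => D.co k v) D.co_refl D.co_sum
        (y := -(w⁻¹ • D.omega)) hi (by rw [map_neg]; linarith)
      rw [hn, smul_neg, ← mul_smul] at hlt
      obtain ⟨u, hu⟩ := ih _ hlt _ _ h1 (by rw [mul_inv_rev, D.refl_inv])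
      exact ⟨D.refl i * u, by rwa [S.tw_tw] at hu⟩
    · push Not at h
      have := D.eq_w0 (u := w⁻¹) fun j hj => lt_of_le_of_ne (h j hj) (D.co_smul_omega_ne _ j)
      rw [inv_eq_iff_eq_inv, D.w0_inv] at this
      exact ⟨1, by rwa [S.tw_one, ← this]⟩

end ChamberSystem
end LambdaBuilding

/-! ### The spherical building at infinity -/

namespace LambdaBuilding
namespace Atlas

variable {ι F E W Λ M X : Type*} [Fintype ι] [Field F] [LinearOrder F]
    [IsStrictOrderedRing F] [AddCommGroup E] [Module F E] [Group W] [DistribMulAction W E]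
    [AddCommGroup Λ] [LinearOrder Λ] [IsOrderedAddMonoid Λ] [Module F Λ] [PosSMulStrictMono F Λ]
    [Nontrivial Λ] [AddCommGroup M] [DistribMulAction W M]
    {D : WeylModel ι F E W Λ M} {𝒜 : Set (M → X)} {dX : X → X → Λ} (H : Atlas D 𝒜 dX)

/-- The chart `f` precomposed with an element of the Weyl group. -/
def tw (f : M → X) (u : W) : M → X := fun x => f (u • x)

theorem tw_one (f : M → X) : tw f (1 : W) = f := by
  funext x; simp [tw]

theorem tw_tw (f : M → X) (u v : W) : tw (tw f u) v = tw f (u * v) := by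
  funext x; simp [tw, mul_smul]

theorem range_tw (f : M → X) (u : W) : Set.range (tw f u) = Set.range f := by
  ext y
  constructor
  · rintro ⟨x, rfl⟩; exact ⟨_, rfl⟩
  · rintro ⟨x, rfl⟩; exact ⟨u⁻¹ • x, by simp [tw]⟩

variable (D) in
/-- The charts `f` and `g` map sub-chambers of the fundamental chamber to the same subset. -/
def AsEq (f g : M → X) : Prop := ∃ a b, ∀ e, D.Dom e → f (a + e) = g (b + e)

theorem AsEq.refl (f : M → X) : AsEq D f f := ⟨0, 0, fun _ _ => rfl⟩

theorem AsEq.symm {f g : M → X} (h : AsEq D f g) : AsEq D g f := by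
  obtain ⟨a, b, h⟩ := h
  exact ⟨b, a, fun e he => (h e he).symm⟩

theorem AsEq.trans {f g k : M → X} (h : AsEq D f g) (h' : AsEq D g k) : AsEq D f k := by
  obtain ⟨a, b, h⟩ := h
  obtain ⟨b', c, h'⟩ := h'
  obtain ⟨m, h1, h2⟩ := D.exists_common b b'
  refine ⟨a + (m - b), c + (m - b'), fun e he => ?_⟩
  rw [add_assoc, add_assoc, h _ (h1.add he), ← h' _ (h2.add he)]
  congr 1; abel

include H

theorem tw_mem' {f : M → X} (hf : f ∈ 𝒜) (u : W) : tw f u ∈ 𝒜 := H.tw_mem f hf u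

theorem AsEq.spec {f g : M → X} (hf : f ∈ 𝒜) (hg : g ∈ 𝒜) (h : AsEq D f g) :
    ∃ a b, (∀ e, D.Dom e → f (a + e) = g (b + e)) ∧
      ∀ x, f x ∈ Set.range g → f x = g (x - a + b) := by
  obtain ⟨a, b, h⟩ := h
  obtain ⟨s, hs⟩ := H.exists_pos
  refine ⟨a, b, h, fun x hx => H.trans_of_reg hf hg hs.ne' ?_ (h _ (D.dom_reg hs.le)) hx⟩
  simpa using h 0 D.dom_zero

theorem AsEq.range {f g : M → X} (hf : f ∈ 𝒜) (hg : g ∈ 𝒜) (h : AsEq D f g) {b e : M}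
    (hb : f b ∈ Set.range g) (he : D.Dom e) : f (b + e) ∈ Set.range g := by
  obtain ⟨a, b', h⟩ := h
  exact H.range_cone hf hg hb (fun e he => ⟨_, (h e he).symm⟩) he

theorem AsEq.dist {f g : M → X} (hf : f ∈ 𝒜) (hg : g ∈ 𝒜) (h : AsEq D f g) :
    ∃ n, ∀ x, D.Dom x → dX (f x) (g x) ≤ n := by
  obtain ⟨a, b, h⟩ := h
  refine ⟨D.nrm a + D.nrm b, fun x hx => ?_⟩
  refine (H.triangle _ (f (a + x)) _).trans (add_le_add ?_ ?_)
  · rw [H.dist_eq f hf]; simp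
  · rw [h x hx, H.dist_eq g hg, ← D.nrm_neg]; simp

theorem exists_asEq_tw {f h : M → X} (hf : f ∈ 𝒜) (hh : h ∈ 𝒜) {a : M}
    (hr : ∀ e, D.Dom e → f (a + e) ∈ Set.range h) : ∃ u : W, AsEq D f (tw h u) := by
  obtain ⟨b, hb⟩ := hr 0 D.dom_zero
  rw [add_zero] at hb
  obtain ⟨u, t, J, hu, -⟩ := H.trans f hf h hh a b hb.symm
  refine ⟨u, a, a + u⁻¹ • t, fun e he => ?_⟩
  rw [hu _ (hr e he), tw]
  simp only [smul_add, smul_inv_smul]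
  congr 1; abel

/-- The transition carries a translate of the fundamental chamber into another one, so its linear
part keeps `omega` dominant and is `1`. -/
theorem exists_sub {f f₁ : M → X} (hf : f ∈ 𝒜) (hf₁ : f₁ ∈ 𝒜) {a₁ c : M}
    (h : ∀ e, D.Dom e → ∃ e', D.Dom e' ∧ f₁ (a₁ + e) = f (c + e')) :
    ∃ a, D.Dom (a - c) ∧ ∀ e, D.Dom e → f₁ (a₁ + e) = f (a + e) := by
  obtain ⟨e₀, he₀, h0⟩ := h 0 D.dom_zero
  rw [add_zero] at h0
  obtain ⟨u, t, J, hu, -⟩ := H.trans f₁ hf₁ f hf _ _ h0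
  have key : ∀ e, D.Dom e → D.Dom (u • (a₁ + e) + t - c) := by
    intro e he
    obtain ⟨e', he', h'⟩ := h e he
    have := hu _ ⟨_, h'.symm⟩
    rw [h'] at this
    rw [← H.inj f hf this]
    simpa using he'
  have hu1 : u = 1 := by
    apply D.eq_one_of_nonneg
    intro i hi
    apply H.bounded_below (p := (i, 0)) (a := u • a₁ + t - c)
    intro s hs
    have := key _ (D.dom_reg hs) i (D.simple_pos hi)
    have e : u • (a₁ + D.reg s) + t - c = u • a₁ + t - c + u • D.reg s := by
      rw [smul_add]; abel
    rwa [e] at this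
  subst hu1
  refine ⟨a₁ + t, ?_, fun e he => ?_⟩
  · simpa using key 0 D.dom_zero
  · obtain ⟨e', he', h'⟩ := h e he
    rw [hu _ ⟨_, h'.symm⟩, one_smul]
    congr 1; abel

theorem exists_common_apartment {f g : M → X} (hf : f ∈ 𝒜) (hg : g ∈ 𝒜) :
    ∃ h ∈ 𝒜, ∃ w : W, AsEq D f h ∧ AsEq D g (tw h w) := by
  obtain ⟨f₁, hf₁, g₁, hg₁, h, hh, a₁, b₁, hall⟩ := H.ends f hf g hg
  obtain ⟨a, -, ha⟩ := H.exists_sub (c := 0) hf hf₁ (a₁ := a₁) (fun e he => by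
    simpa using (hall e he).1)
  obtain ⟨b, -, hb⟩ := H.exists_sub (c := 0) hg hg₁ (a₁ := b₁) (fun e he => by
    simpa using (hall e he).2.1)
  obtain ⟨u, hu⟩ := H.exists_asEq_tw hf hh (a := a) (fun e he => by
    rw [← ha e he]; exact (hall e he).2.2.1)
  obtain ⟨v, hv⟩ := H.exists_asEq_tw hg hh (a := b) (fun e he => by
    rw [← hb e he]; exact (hall e he).2.2.2)
  exact ⟨tw h u, H.tw_mem' hh u, u⁻¹ * v, hu, by rwa [tw_tw, mul_inv_cancel_left]⟩

theorem AsEq.unique {h h' : M → X} (hh : h ∈ 𝒜) (hh' : h' ∈ 𝒜) {w w' : W} (h0 : AsEq D h h')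
    (h1 : AsEq D (tw h w) (tw h' w')) : w = w' := by
  obtain ⟨a, b, -, hx⟩ := AsEq.spec H hh hh' h0
  obtain ⟨c, d, hcd⟩ := h1
  obtain ⟨s, hs⟩ := H.exists_pos
  have key : ∀ e, D.Dom e → w • (c + e) - a + b = w' • (d + e) := by
    intro e he
    have h2 := hcd e he
    apply H.inj h' hh'
    rw [← hx]
    · exact h2
    · exact ⟨_, h2.symm⟩
  have k0 := key 0 D.dom_zero
  have k1 := key _ (D.dom_reg hs.le)
  apply D.reg_cancel hs.ne'
  rw [add_zero, add_zero] at k0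
  rw [smul_add, smul_add, ← k0] at k1
  have : w • c - a + b + w • D.reg s = w • c - a + b + w' • D.reg s := by
    rw [← k1]; abel
  exact add_left_cancel this

theorem le_of_bounded {a b : F} {n : Λ} (h : ∀ s : Λ, 0 ≤ s → a • s ≤ b • s + n) : a ≤ b := by
  by_contra! hlt
  obtain ⟨e, he⟩ := H.exists_pos
  have hc := sub_pos.2 hlt
  have h1 := h ((a - b)⁻¹ • (|n| + e))
    (smul_nonneg (inv_nonneg.2 hc.le) (add_nonneg (abs_nonneg _) he.le))
  rw [← sub_le_iff_le_add', ← sub_smul, smul_inv_smul₀ hc.ne'] at h1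
  exact absurd (h1.trans (le_abs_self n)) (not_le.2 (lt_add_of_pos_right _ he))

omit H in
variable (D dX) in
/-- The panels of type `i` of the fundamental chambers in the charts `f` and `g` are parallel. -/
def AdjInf (i : ι) (f g : M → X) : Prop :=
  ∃ n, ∀ s : Λ, 0 ≤ s → dX (f (D.tm (D.eta i) s)) (g (D.tm (D.eta i) s)) ≤ n

/-- The distance between the rays in directions `x` and `v` grows in `s` at the rate given by `anorm
(v - x)`, and bounded changes do not affect growth rates. -/
theorem anorm_le_of_parallel {h h' : M → X} (hh : h ∈ 𝒜) (hh' : h' ∈ 𝒜) (h0 : AsEq D h h')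
    {v v' x : E} (hx : ∀ j ∈ D.simple, 0 ≤ D.co j x)
    (h1 : ∃ n, ∀ s : Λ, 0 ≤ s → dX (h (D.tm v s)) (h' (D.tm v' s)) ≤ n) :
    D.anorm (v - x) ≤ D.anorm (v' - x) := by
  obtain ⟨n, hn⟩ := h1
  obtain ⟨n', hn'⟩ := AsEq.dist H hh hh' h0
  apply H.le_of_bounded (n := 2 • (n + n'))
  intro s hs
  rw [← D.two_nrm_tm _ hs, ← D.two_nrm_tm _ hs, ← nsmul_add]
  apply nsmul_le_nsmul_right
  have e1 : D.nrm (D.tm (v - x) s) = dX (h (D.tm x s)) (h (D.tm v s)) := by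
    rw [H.dist_eq h hh, map_sub]; rfl
  have e2 : D.nrm (D.tm (v' - x) s) = dX (h' (D.tm x s)) (h' (D.tm v' s)) := by
    rw [H.dist_eq h' hh', map_sub]; rfl
  rw [e1, e2]
  have hd : D.Dom (D.tm x s) := D.dom_tm (fun k => D.co_nonneg hx) hs
  have t1 := H.triangle (h (D.tm x s)) (h' (D.tm x s)) (h (D.tm v s))
  have t2 := H.triangle (h' (D.tm x s)) (h' (D.tm v' s)) (h (D.tm v s))
  have t3 := hn s hs
  rw [H.dist_comm] at t3
  have t4 := hn' _ hd
  calc dX (h (D.tm x s)) (h (D.tm v s)) ≤ _ := t1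
    _ ≤ n' + (dX (h' (D.tm x s)) (h' (D.tm v' s)) + n) :=
      add_le_add t4 (t2.trans (add_le_add_right t3 _))
    _ = _ := by abel

/-- The chambers at infinity form a spherical building. -/
def infinity : ChamberSystem D.toWeylData 𝒜 where
  tw c u := ⟨tw c.1 u, H.tw_mem' c.2 u⟩
  eqv c d := AsEq D c.1 d.1
  adj i c d := AdjInf D dX i c.1 d.1
  tw_one c := Subtype.ext (tw_one _)
  tw_tw c u v := Subtype.ext (tw_tw _ _ _)
  eqv_refl c := AsEq.refl _
  eqv_symm h := h.symm
  eqv_trans h h' := h.trans h'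
  adj_symm := by
    rintro i c d ⟨n, hn⟩
    exact ⟨n, fun s hs => by rw [H.dist_comm]; exact hn s hs⟩
  adj_trans := by
    rintro i c d e ⟨n, hn⟩ ⟨m, hm⟩
    exact ⟨n + m, fun s hs => (H.triangle _ _ _).trans (add_le_add (hn s hs) (hm s hs))⟩
  adj_of_eqv := by
    intro i c d hi h
    obtain ⟨n, hn⟩ := AsEq.dist H c.2 d.2 h
    exact ⟨n, fun s hs => hn _ (D.dom_tm (fun k hk => D.eta_nonneg hi hk) hs)⟩
  ends c d := by
    obtain ⟨h, hh, w, h1, h2⟩ := H.exists_common_apartment c.2 d.2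
    exact ⟨⟨h, hh⟩, w, h1, h2⟩
  uniq := by
    intro h h' w w' h0 h1
    exact AsEq.unique H h.2 h'.2 h0 h1
  adj_refl := by
    intro i h hi
    refine ⟨0, fun s _ => ?_⟩
    simp only [tw, D.smul_tm, D.refl_eta hi]
    rw [H.dist_eq _ h.2, sub_self, D.nrm_zero]
  adj_tw := by
    intro i h h' w w' hi h0 h1
    have h2 : ∃ n, ∀ s : Λ, 0 ≤ s →
        dX (h.1 (D.tm (w • D.eta i) s)) (h'.1 (D.tm (w' • D.eta i) s)) ≤ n := by
      obtain ⟨n, hn⟩ := h1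
      exact ⟨n, fun s hs => by simpa only [tw, D.smul_tm] using hn s hs⟩
    have h3 : ∃ n, ∀ s : Λ, 0 ≤ s →
        dX (h'.1 (D.tm (w' • D.eta i) s)) (h.1 (D.tm (w • D.eta i) s)) ≤ n := by
      obtain ⟨n, hn⟩ := h2
      exact ⟨n, fun s hs => by rw [H.dist_comm]; exact hn s hs⟩
    -- Parallel panel rays have the same growth rate of distance to every dominant ray. This
    -- determines the vector within its orbit, and the stabilizer of `eta i` leaves two chambers.
    have h4 := D.eq_of_anorm_eq (v := w • D.eta i) (g := w' * w⁻¹) (fun x hx => by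
      rw [mul_smul, inv_smul_smul]
      exact le_antisymm (H.anorm_le_of_parallel h.2 h'.2 h0 hx h2)
        (H.anorm_le_of_parallel h'.2 h.2 h0.symm hx h3))
    rw [mul_smul, inv_smul_smul] at h4
    exact D.smul_eta_eq hi h4.symm

end Atlas
-- Finite subdivisions of intervals of `Λ`
/-- The interval from `s` to `t` has a finite subdivision into intervals satisfying `Q`. -/
inductive Subdiv {Λ : Type*} [LinearOrder Λ] (Q : Λ → Λ → Prop) : Λ → Λ → Prop
  | base {s t : Λ} : s ≤ t → Q s t → Subdiv Q s t
  | trans {s t u : Λ} : Subdiv Q s t → Subdiv Q t u → Subdiv Q s u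

namespace Subdiv

variable {Λ : Type*} [LinearOrder Λ] {Q Q' : Λ → Λ → Prop}

theorem le {s t : Λ} (h : Subdiv Q s t) : s ≤ t := by
  induction h with
  | base h _ => exact h
  | trans _ _ h1 h2 => exact h1.trans h2

theorem bind {s t : Λ} (h : Subdiv Q s t) (hQ : ∀ a b, a ≤ b → Q a b → Subdiv Q' a b) :
    Subdiv Q' s t := by
  induction h with
  | base h1 h2 => exact hQ _ _ h1 h2
  | trans _ _ h1 h2 => exact h1.trans h2

/-- Subdivision at the points where an affine function takes a given value. -/
theorem of_affine {F : Type*} [Field F] [LinearOrder F] [IsStrictOrderedRing F]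
    [AddCommGroup Λ] [IsOrderedAddMonoid Λ] [Module F Λ] [PosSMulStrictMono F Λ] {p κ : Λ} {q : F}
    {s t : Λ} (hst : s ≤ t)
    (h1 : ∀ a b, s ≤ a → a ≤ b → b ≤ t → (∀ r, a ≤ r → r ≤ b → κ ≤ p + q • r) → Subdiv Q a b)
    (h2 : ∀ a b, s ≤ a → a ≤ b → b ≤ t → (∀ r, a ≤ r → r ≤ b → p + q • r ≤ κ) → Subdiv Q a b) :
    Subdiv Q s t := by
  have main : ∀ (q : F) (p κ : Λ), 0 ≤ q →
      (∀ a b, s ≤ a → a ≤ b → b ≤ t → (∀ r, a ≤ r → r ≤ b → κ ≤ p + q • r) → Subdiv Q a b) →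
      (∀ a b, s ≤ a → a ≤ b → b ≤ t → (∀ r, a ≤ r → r ≤ b → p + q • r ≤ κ) → Subdiv Q a b) →
      Subdiv Q s t := by
    intro q p κ hq h1 h2
    have mono : ∀ r r' : Λ, r ≤ r' → p + q • r ≤ p + q • r' := fun r r' h =>
      add_le_add_right (smul_le_smul_of_nonneg_left h hq) _
    rcases le_total κ (p + q • s) with hs | hs
    · exact h1 s t le_rfl hst le_rfl fun r hr _ => hs.trans (mono _ _ hr)
    rcases le_total (p + q • t) κ with ht | ht
    · exact h2 s t le_rfl hst le_rfl fun r _ hr => (mono _ _ hr).trans ht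
    rcases hq.eq_or_lt with rfl | hq
    · refine h1 s t le_rfl hst le_rfl fun r _ _ => ?_
      simpa using ht
    · have h0 : p + q • (q⁻¹ • (κ - p)) = κ := by
        rw [smul_inv_smul₀ hq.ne']; abel
      -- The parameter at which the affine function takes the value `κ`.
      set m := q⁻¹ • (κ - p) with hm
      have hle : ∀ a b : Λ, p + q • a ≤ p + q • b → a ≤ b := fun a b h => by
        by_contra! hlt
        exact absurd (add_lt_add_right (smul_lt_smul_of_pos_left hlt hq) p) (not_lt.2 h)
      have hsm : s ≤ m := hle _ _ (by rw [h0]; exact hs)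
      have hmt : m ≤ t := hle _ _ (by rw [h0]; exact ht)
      exact (h2 s m le_rfl hsm hmt fun r _ hr => (mono _ _ hr).trans h0.le).trans
        (h1 m t hsm hmt le_rfl fun r hr _ => h0.ge.trans (mono _ _ hr))
  rcases le_total 0 q with hq | hq
  · exact main q p κ hq h1 h2
  · refine main (-q) (-p) (-κ) (neg_nonneg.2 hq) (fun a b ha hab hb hr => ?_)
      (fun a b ha hab hb hr => ?_)
    · refine h2 a b ha hab hb fun r h3 h4 => ?_
      have := hr r h3 h4
      rw [neg_smul, ← neg_add, neg_le_neg_iff] at this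
      exact this
    · refine h1 a b ha hab hb fun r h3 h4 => ?_
      have := hr r h3 h4
      rw [neg_smul, ← neg_add, neg_le_neg_iff] at this
      exact this

end Subdiv

/-! ### Sundial configurations, and apartments through a point with a given chamber at infinity -/

namespace Atlas

variable {ι F E W Λ M X : Type*} [Fintype ι] [Field F] [LinearOrder F]
    [IsStrictOrderedRing F] [AddCommGroup E] [Module F E] [Group W] [DistribMulAction W E]
    [AddCommGroup Λ] [LinearOrder Λ] [IsOrderedAddMonoid Λ] [Module F Λ] [PosSMulStrictMono F Λ]
    [Nontrivial Λ] [AddCommGroup M] [DistribMulAction W M]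
    {D : WeylModel ι F E W Λ M} {𝒜 : Set (M → X)} {dX : X → X → Λ} (H : Atlas D 𝒜 dX)

variable (D) in
/-- The chamber at infinity of the chart `c` belongs to the apartment of the chart `f`. -/
def AtInf (c f : M → X) : Prop := ∃ u : W, AsEq D (tw f u) c

theorem AtInf.of_tw {c f : M → X} {u : W} (h : AtInf D c (tw f u)) : AtInf D c f := by
  obtain ⟨v, hv⟩ := h
  exact ⟨u * v, by rwa [tw_tw] at hv⟩

include H

/-- A half-apartment bounding the overlap contains a translate of the fundamental chamber, so its
root is positive. It also contains one of the chamber `refl i * w0`, so `refl i` makes this root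
non-positive. Only multiples of the root `i` remain. -/
theorem half_or_all {f g : M → X} (hf : f ∈ 𝒜) (hg : g ∈ 𝒜) {i : ι} (hi : i ∈ D.simple)
    (h0 : AsEq D f g) (h1 : AsEq D (tw f (D.refl i * D.w0)) (tw g (D.refl i * D.w0))) :
    (∀ x, f x ∈ Set.range g) ∨ ∃ k, ∀ x, f x ∈ Set.range g ↔ k ≤ D.ev i x := by
  obtain ⟨a, b, hab⟩ := h0
  obtain ⟨a', b', hab'⟩ := h1
  obtain ⟨u, t, J, -, hJ⟩ := H.trans f hf g hg a b (by simpa using hab 0 D.dom_zero)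
  have hp : ∀ p ∈ J, 0 < D.co p.1 (D.om i) ∧ ∀ v, D.co p.1 v = D.co p.1 (D.om i) * D.co i v := by
    intro p hp
    have hpos : D.pos p.1 := by
      apply D.pos_of_nonneg
      have := H.bounded_below (p := p) (u := 1) (a := a) (fun s hs => by
        rw [one_smul]
        exact (hJ _).1 ⟨_, (hab _ (D.dom_reg hs)).symm⟩ p hp)
      rwa [one_smul] at this
    have h2 := H.bounded_below (p := p) (u := D.refl i * D.w0) (a := (D.refl i * D.w0) • a')
      (fun s hs => by
        rw [← smul_add]
        refine (hJ _).1 ⟨(D.refl i * D.w0) • (b' + D.reg s), ?_⟩ p hp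
        exact (hab' _ (D.dom_reg hs)).symm)
    apply D.prop_of_not_pos hi hpos
    intro hpos'
    rw [mul_smul, D.co_refl] at h2
    exact absurd (D.longest_neg (fun _ => D.w0_simple) hpos') (not_lt.2 h2)
  have hiff : ∀ p ∈ J, ∀ x, p.2 ≤ D.ev p.1 x ↔ (D.co p.1 (D.om i))⁻¹ • p.2 ≤ D.ev i x := by
    intro p hpJ x
    obtain ⟨hc, hprop⟩ := hp p hpJ
    rw [D.ev_prop hprop]
    constructor
    · intro h
      have := smul_le_smul_of_nonneg_left h (inv_nonneg.2 hc.le)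
      rwa [inv_smul_smul₀ hc.ne'] at this
    · intro h
      have := smul_le_smul_of_nonneg_left h hc.le
      rwa [smul_inv_smul₀ hc.ne'] at this
  rcases J.eq_empty_or_nonempty with rfl | hne
  · left
    intro x
    rw [hJ]; simp
  · right
    refine ⟨J.sup' hne fun p => (D.co p.1 (D.om i))⁻¹ • p.2, fun x => ?_⟩
    rw [hJ, Finset.sup'_le_iff]
    exact forall₂_congr fun p hpJ => hiff p hpJ x

theorem asEq_tw_of_range {f h : M → X} (hf : f ∈ 𝒜) (hh : h ∈ 𝒜) (h0 : AsEq D f h)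
    (hall : ∀ x, f x ∈ Set.range h) (u : W) : AsEq D (tw f u) (tw h u) := by
  obtain ⟨a, b, -, hx⟩ := AsEq.spec H hf hh h0
  refine ⟨0, u⁻¹ • (-a + b), fun e _ => ?_⟩
  simp only [tw]
  rw [hx _ (hall _), smul_add, smul_add, smul_inv_smul, smul_zero]
  congr 1; abel

/-- The chamber `e` in position `refl i * w0` of `f` is opposite to `f'`, and together they span an
apartment. Its chamber adjacent to `f'` across the panel is that of `f`, so it shares with `f` the
two chambers needed in `half_or_all`. It cannot contain all of `f`, as `f'` would then lie at
infinity of `f`. -/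
theorem exists_half_apartment {f f' : M → X} (hf : f ∈ 𝒜) (hf' : f' ∈ 𝒜) {i : ι}
    (hi : i ∈ D.simple) (hadj : AdjInf D dX i f f') (hne : ¬ AtInf D f' f) :
    ∃ h ∈ 𝒜, AsEq D h f ∧ AsEq D (tw h (D.refl i)) f' ∧
      AsEq D (tw h (D.refl i * D.w0)) (tw f (D.refl i * D.w0)) ∧
      ∃ k, ∀ x, f x ∈ Set.range h ↔ k ≤ D.ev i x := by
  let S := H.infinity
  let cf : 𝒜 := ⟨f, hf⟩
  let cf' : 𝒜 := ⟨f', hf'⟩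
  let e : 𝒜 := S.tw cf (D.refl i * D.w0)
  have hd : S.Delta e cf (D.w0 * D.refl i) := by
    have := (ChamberSystem.delta_tw (S := S) cf (D.refl i * D.w0)).symm
    rwa [mul_inv_rev, D.w0_inv, D.refl_inv] at this
  have hpos : 0 < D.co i ((D.w0 * D.refl i)⁻¹ • D.omega) := by
    rw [mul_inv_rev, D.w0_inv, D.refl_inv, mul_smul, D.co_refl_self, neg_pos]
    exact D.w0_simple hi
  have hss : D.w0 * D.refl i * D.refl i = D.w0 := by
    rw [mul_assoc, D.refl_mul_self, mul_one]
  -- Crossing the panel lengthens `w0 * refl i` to `w0`, so `f'` is opposite to `e`.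
  have hd' := hd.mul_refl (c' := cf') hi hadj
    (fun h => hne ⟨1, by rw [tw_one]; exact h⟩) hpos
  rw [hss] at hd'
  obtain ⟨k, hk1, hk2⟩ := hd'
  have e1 : tw (tw k.1 (D.w0 * D.refl i)) (D.refl i) = tw k.1 D.w0 := by
    rw [tw_tw, hss]
  have e2 : tw (tw k.1 (D.w0 * D.refl i)) (D.refl i * D.w0) = k.1 := by
    rw [tw_tw, ← mul_assoc, hss, D.w0_mul_self, tw_one]
  have hadj2 : S.adj i cf (S.tw k (D.w0 * D.refl i)) :=
    S.adj_trans (show S.adj i cf cf' from hadj) (S.adj_trans (S.adj_of_eqv hi hk2) (by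
      have := S.adj_refl (S.tw k D.w0) hi
      rwa [S.tw_tw] at this))
  -- Every chamber of the panel other than that of `f` is at distance `w0` from `e`, whereas this
  -- one is at distance `w0 * refl i`.
  have hEq : S.eqv cf (S.tw k (D.w0 * D.refl i)) := by
    by_contra hn
    have h3 := hd.mul_refl hi hadj2 hn hpos
    rw [hss] at h3
    have h4 : S.Delta e (S.tw k (D.w0 * D.refl i)) (D.w0 * D.refl i) := ⟨k, hk1, S.eqv_refl _⟩
    exact D.refl_ne_one i (mul_eq_left.1 (h3.unique h4).symm)
  have hh := H.tw_mem' k.2 (D.w0 * D.refl i)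
  have g2 : AsEq D (tw (tw k.1 (D.w0 * D.refl i)) (D.refl i)) f' := by
    rw [e1]; exact AsEq.symm hk2
  have g3 : AsEq D (tw (tw k.1 (D.w0 * D.refl i)) (D.refl i * D.w0))
      (tw f (D.refl i * D.w0)) := by
    rw [e2]; exact AsEq.symm hk1
  have g1 : AsEq D f (tw k.1 (D.w0 * D.refl i)) := hEq
  refine ⟨tw k.1 (D.w0 * D.refl i), hh, g1.symm, g2, g3, ?_⟩
  refine (H.half_or_all hf hh hi g1 g3.symm).resolve_left fun hall => hne ⟨D.refl i, ?_⟩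
  exact (H.asEq_tw_of_range hf hh g1 hall _).trans g2

/-- Sundial configurations: an apartment having at infinity a chamber adjacent to `f'` is covered by
at most two half-apartments each of which lies in an apartment having `f'` at infinity. -/
theorem sundial {f f' : M → X} (hf : f ∈ 𝒜) (hf' : f' ∈ 𝒜) {i : ι}
    (hi : i ∈ D.simple) (hadj : AdjInf D dX i f f') :
    AtInf D f' f ∨ ∃ k, ∃ h₁ ∈ 𝒜, ∃ h₂ ∈ 𝒜, AtInf D f' h₁ ∧ AtInf D f' h₂ ∧
      (∀ x, k ≤ D.ev i x → f x ∈ Set.range h₁) ∧ (∀ x, D.ev i x ≤ k → f x ∈ Set.range h₂) := by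
  by_cases hne : AtInf D f' f
  · exact Or.inl hne
  right
  let S := H.infinity
  let cf' : 𝒜 := ⟨f', hf'⟩
  obtain ⟨h₁, hh₁, a1, b1, c1, k₁, hk₁⟩ := H.exists_half_apartment hf hf' hi hadj hne
  have hadj' : AdjInf D dX i (tw f (D.refl i)) f' :=
    S.adj_trans (S.adj_symm (S.adj_refl ⟨f, hf⟩ hi)) (show S.adj i ⟨f, hf⟩ cf' from hadj)
  obtain ⟨h₂, hh₂, a2, b2, c2, k₂, hk₂⟩ := H.exists_half_apartment (H.tw_mem' hf (D.refl i)) hf' hi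
    hadj' (fun h => hne h.of_tw)
  let d₁ : 𝒜 := ⟨h₁, hh₁⟩
  let d₂ : 𝒜 := ⟨h₂, hh₂⟩
  have hk₂' : ∀ x, f x ∈ Set.range h₂ ↔ k₂ ≤ - D.ev i x := by
    intro x
    have h3 : D.ev i (D.refl i • x) = - D.ev i x := by
      rw [D.ev_refl, D.ev_prop (c := -1) (k := D.perm i i) (i := i)
        (fun v => by rw [D.co_perm_self]; ring)]
      simp
    have := hk₂ (D.refl i • x)
    rwa [tw, ← mul_smul, D.refl_mul_self, one_smul, h3] at this
  obtain ⟨j, hj, hij⟩ := D.exists_refl_mul_w0 hi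
  have hss : D.refl i * (D.refl i * D.w0) = D.w0 := by
    rw [← mul_assoc, D.refl_mul_self, one_mul]
  have hδ : ∀ d : 𝒜, AsEq D (tw d.1 (D.refl i)) f' →
      S.Delta cf' (S.tw d D.w0) (D.refl i * D.w0) := by
    intro d hd
    refine ⟨S.tw d (D.refl i), hd.symm, ?_⟩
    rw [S.tw_tw, hss]
    exact S.eqv_refl _
  have hadj3 : S.adj j (S.tw d₁ D.w0) (S.tw d₂ D.w0) := by
    have t1 := S.adj_refl (S.tw d₁ D.w0) hj
    rw [S.tw_tw, ← hij] at t1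
    have t2 : S.adj j (S.tw d₁ (D.refl i * D.w0)) (S.tw ⟨f, hf⟩ (D.refl i * D.w0)) :=
      S.adj_of_eqv hj c1
    have t3 := S.adj_refl (S.tw ⟨f, hf⟩ D.w0) hj
    rw [S.tw_tw, ← hij] at t3
    have t4 : S.adj j (S.tw ⟨f, hf⟩ D.w0) (S.tw d₂ (D.refl i * D.w0)) := by
      apply S.adj_of_eqv hj
      have := c2.symm
      rw [tw_tw, hss] at this
      exact this
    have t5 := S.adj_refl (S.tw d₂ D.w0) hj
    rw [S.tw_tw, ← hij] at t5
    exact S.adj_trans t1 (S.adj_trans t2 (S.adj_trans (S.adj_symm t3)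
      (S.adj_trans t4 (S.adj_symm t5))))
  -- Both chambers are at distance `refl i * w0` from `f'`. Were they distinct, passing from one to
  -- the other across their `j`-panel would lengthen this distance.
  have hEq : AsEq D (tw h₁ D.w0) (tw h₂ D.w0) := by
    by_contra hn
    have h3 := (hδ d₁ b1).mul_refl hj hadj3 hn (by
      rw [hij, mul_inv_rev, D.w0_inv, D.refl_inv, mul_smul, D.co_refl_self, neg_pos]
      exact D.w0_simple hj)
    exact D.refl_ne_one j (mul_eq_left.1 (h3.unique (hδ d₂ b2)))
  have hr : ∀ h : M → X, Set.range (tw h (D.refl i)) = Set.range h := fun h => range_tw h _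
  have hhalf := H.half_or_all (H.tw_mem' hh₁ (D.refl i)) (H.tw_mem' hh₂ (D.refl i)) hi
    (b1.trans b2.symm) (by rwa [tw_tw, tw_tw, hss])
  -- If `h₂` contained `h₁`, it would contain points of `f` arbitrarily deep inside `f ∩ h₁`, which
  -- it does not. So the three apartments meet pairwise in half-apartments, and the common point
  -- from (A6) satisfies `k₁ ≤ ev i x ≤ -k₂`.
  have hk : k₁ ≤ - k₂ := by
    rcases hhalf with hall | hhalf
    · exfalso
      have hall' : ∀ x, h₁ x ∈ Set.range h₂ := by
        intro x
        have := hall ((D.refl i)⁻¹ • x)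
        rwa [hr, tw, smul_inv_smul] at this
      obtain ⟨e, he⟩ := H.exists_pos
      have hci := D.pos_omega (D.simple_pos hi)
      set m := |k₁| + |k₂| + e with hm
      have hev : D.ev i (D.reg ((D.co i D.omega)⁻¹ • m)) = m := by
        rw [D.ev_reg, smul_inv_smul₀ hci.ne']
      have m1 : k₁ ≤ m := (le_abs_self k₁).trans (by
        rw [hm, add_assoc]; exact le_add_of_nonneg_right (add_nonneg (abs_nonneg _) he.le))
      have m2 : -k₂ < m := lt_of_le_of_lt (neg_le_abs k₂) (by
        rw [hm, add_comm |k₁|, add_assoc]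
        exact lt_add_of_pos_right _ (add_pos_of_nonneg_of_pos (abs_nonneg _) he))
      obtain ⟨y, hy⟩ := (hk₁ (D.reg ((D.co i D.omega)⁻¹ • m))).2 (by rw [hev]; exact m1)
      have h5 := hall' y
      rw [hy, hk₂', hev] at h5
      exact absurd (le_neg.1 h5) (not_le.2 m2)
    · obtain ⟨k, hk⟩ := hhalf
      obtain ⟨x, hx1, hx2⟩ := H.meet f hf (tw h₁ (D.refl i)) (H.tw_mem' hh₁ _)
        (tw h₂ (D.refl i)) (H.tw_mem' hh₂ _) ⟨i, k₁, fun x => by rw [hr]; exact hk₁ x⟩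
        ⟨i, k, hk⟩ ⟨D.opp i, k₂, fun x => by rw [hr, hk₂', D.ev_opp]⟩
      rw [hr, hk₁] at hx1
      rw [hr, hk₂'] at hx2
      exact hx1.trans (le_neg.1 hx2)
  exact ⟨k₁, h₁, hh₁, h₂, hh₂, ⟨_, b1⟩, ⟨_, b2⟩, fun x hx => (hk₁ x).2 hx,
    fun x hx => (hk₂' x).2 (le_neg.1 (hx.trans hk))⟩

omit H in
variable (D 𝒜) in
/-- The image under `f` of the part from `s` to `t` of the line `r ↦ a + v ⊗ r` lies in an apartment
that has `c` at infinity. -/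
def LineInf (c f : M → X) (a : M) (v : E) (s t : Λ) : Prop :=
  ∃ h ∈ 𝒜, AtInf D c h ∧ ∀ r, s ≤ r → r ≤ t → f (a + D.tm v r) ∈ Set.range h

/-- Lines are covered by finitely many apartments having a given chamber at infinity. -/
theorem subdiv_lineInf {c f : M → X} (hc : c ∈ 𝒜) (hf : f ∈ 𝒜) (a : M) (v : E) {s t : Λ}
    (hst : s ≤ t) : Subdiv (LineInf D 𝒜 c f a v) s t := by
  obtain ⟨h, hh, w, h0, h1⟩ := H.exists_common_apartment hf hc
  obtain ⟨n, hn⟩ := D.exists_isWord w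
  induction n generalizing c w with
  | zero =>
    rw [D.isWord_zero] at hn
    subst hn
    rw [tw_one] at h1
    exact .base hst ⟨f, hf, ⟨1, by rw [tw_one]; exact h0.trans h1.symm⟩, fun r _ _ => ⟨_, rfl⟩⟩
  | succ n ih =>
    obtain ⟨w', j, hj, hw', rfl⟩ := D.isWord_succ.1 hn
    -- The line is first subdivided for the previous chamber of the gallery; each piece is then
    -- refined by the sundial configuration of its apartment.
    refine (ih (H.tw_mem' hh w') w' (AsEq.refl _) hw').bind ?_
    rintro s t hst ⟨g, hg, ⟨u, hu⟩, hr⟩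
    have hg' := H.tw_mem' hg u
    let S := H.infinity
    have hadj : AdjInf D dX j (tw g u) c := by
      have t1 : S.adj j ⟨_, hg'⟩ (S.tw ⟨h, hh⟩ w') := S.adj_of_eqv hj hu
      have t2 := S.adj_refl (S.tw ⟨h, hh⟩ w') hj
      rw [S.tw_tw] at t2
      have t3 : S.adj j (S.tw ⟨h, hh⟩ (w' * D.refl j)) ⟨c, hc⟩ := S.adj_of_eqv hj h1.symm
      exact S.adj_trans t1 (S.adj_trans t2 t3)
    rcases H.sundial hg' hc hj hadj with hin | ⟨k, g₁, hg₁, g₂, hg₂, i1, i2, k1, k2⟩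
    · exact .base hst ⟨_, hg', hin, by simpa only [range_tw] using hr⟩
    have hr' : ∀ r, s ≤ r → r ≤ t → f (a + D.tm v r) ∈ Set.range (tw g u) := by
      simpa only [range_tw] using hr
    obtain ⟨b, hb⟩ := hr' s le_rfl hst
    obtain ⟨u', t', J, hu', -⟩ := H.trans f hf _ hg' _ _ hb.symm
    obtain ⟨σ, hσ, hσ'⟩ := D.exists_perm u'
    have hval : ∀ r, D.ev j (u' • (a + D.tm v r) + t') =
        (D.ev j (u' • a) + D.ev j t') + D.co (σ j) v • r := by
      intro r
      rw [smul_add, map_add, map_add, hσ' j (D.tm v r), D.ev_tm]; abel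
    -- In the coordinates of `tw g u` the piece is still a line, along which `ev j` is affine; it is
    -- cut at the common boundary of the two half-apartments.
    refine Subdiv.of_affine (p := D.ev j (u' • a) + D.ev j t') (κ := k) (q := D.co (σ j) v) hst ?_ ?_
    · intro x y hx hxy hy hxyr
      refine .base hxy ⟨g₁, hg₁, i1, fun r h3 h4 => ?_⟩
      rw [hu' _ (hr' r (hx.trans h3) (h4.trans hy))]
      exact k1 _ (by rw [hval]; exact hxyr r h3 h4)
    · intro x y hx hxy hy hxyr
      refine .base hxy ⟨g₂, hg₂, i2, fun r h3 h4 => ?_⟩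
      rw [hu' _ (hr' r (hx.trans h3) (h4.trans hy))]
      exact k2 _ (by rw [hval]; exact hxyr r h3 h4)

/-- This is the case of a constant line over a degenerate interval. -/
theorem exists_apartment_of_point {c : M → X} (hc : c ∈ 𝒜) (y : X) :
    ∃ g ∈ 𝒜, AsEq D g c ∧ y ∈ Set.range g := by
  obtain ⟨f, hf, ⟨a, rfl⟩, -⟩ := H.join y y
  have hsub := H.subdiv_lineInf hc hf a 0 (le_refl 0)
  have key : ∀ s t : Λ, Subdiv (LineInf D 𝒜 c f a 0) s t → ∃ g ∈ 𝒜, AsEq D g c ∧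
      f a ∈ Set.range g := by
    intro s t h
    induction h with
    | base hst hQ =>
      obtain ⟨h, hh, ⟨u, hu⟩, hr⟩ := hQ
      refine ⟨tw h u, H.tw_mem' hh u, hu, ?_⟩
      rw [range_tw]
      simpa using hr _ le_rfl hst
    | trans _ _ h1 _ => exact h1
  exact key _ _ hsub

end Atlas
-- Subdivisions subordinate to a finite cover
namespace Subdiv

variable {Λ : Type*} [LinearOrder Λ] {Q Q' : Λ → Λ → Prop}

theorem exists_first {s t : Λ} (h : Subdiv Q s t) (hst : s < t) : ∃ t', s < t' ∧ Q s t' := by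
  induction h with
  | base _ hQ => exact ⟨_, hst, hQ⟩
  | @trans s t u h1 h2 ih1 ih2 =>
    rcases h1.le.eq_or_lt with rfl | hlt
    · exact ih2 hst
    · exact ih1 hlt

variable {F : Type*} [Field F] [LinearOrder F] [IsStrictOrderedRing F]
    [AddCommGroup Λ] [IsOrderedAddMonoid Λ] [Module F Λ] [PosSMulStrictMono F Λ]

theorem of_finset (K : Finset (F × Λ)) {s t : Λ} (hst : s ≤ t) :
    Subdiv (fun a b => ∀ c ∈ K, (∀ r, a ≤ r → r ≤ b → c.2 ≤ c.1 • r) ∨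
      (∀ r, a ≤ r → r ≤ b → c.1 • r ≤ c.2)) s t := by
  classical
  induction K using Finset.induction_on with
  | empty => exact .base hst (by simp)
  | insert c K _ ih =>
    refine ih.bind fun a b hab hQ => ?_
    refine of_affine (p := 0) (κ := c.2) (q := c.1) hab ?_ ?_
    · intro a' b' ha hab' hb hr
      refine .base hab' fun d hd => ?_
      rcases Finset.mem_insert.1 hd with rfl | hd
      · exact Or.inl fun r h1 h2 => by simpa using hr r h1 h2
      · exact (hQ d hd).imp (fun h r h1 h2 => h r (ha.trans h1) (h2.trans hb))
          (fun h r h1 h2 => h r (ha.trans h1) (h2.trans hb))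
    · intro a' b' ha hab' hb hr
      refine .base hab' fun d hd => ?_
      rcases Finset.mem_insert.1 hd with rfl | hd
      · exact Or.inr fun r h1 h2 => by simpa using hr r h1 h2
      · exact (hQ d hd).imp (fun h r h1 h2 => h r (ha.trans h1) (h2.trans hb))
          (fun h r h1 h2 => h r (ha.trans h1) (h2.trans hb))

/-- An interval covered by finitely many sets, each given by finitely many linear inequalities, has
a subdivision into intervals contained in one of these sets. -/
theorem of_cover {κ : Type*} [Finite κ] (K : κ → Finset (F × Λ)) {s t : Λ} (hst : s ≤ t)
    (hcov : ∀ r, s ≤ r → r ≤ t → ∃ u, ∀ c ∈ K u, c.2 ≤ c.1 • r) :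
    Subdiv (fun a b => ∃ u, ∀ r, a ≤ r → r ≤ b → ∀ c ∈ K u, c.2 ≤ c.1 • r) s t := by
  classical
  have := Fintype.ofFinite κ
  have key : ∀ a b : Λ, Subdiv (fun a b => ∀ c ∈ Finset.univ.biUnion K,
      (∀ r, a ≤ r → r ≤ b → c.2 ≤ c.1 • r) ∨ (∀ r, a ≤ r → r ≤ b → c.1 • r ≤ c.2)) a b →
      s ≤ a → b ≤ t →
      Subdiv (fun a b => ∃ u, ∀ r, a ≤ r → r ≤ b → ∀ c ∈ K u, c.2 ≤ c.1 • r) a b := by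
    intro a b h
    induction h with
    | trans h1 h2 ih1 ih2 =>
      intro hs ht
      exact (ih1 hs (h2.le.trans ht)).trans (ih2 (hs.trans h1.le) ht)
    | @base a b hab hQ =>
      intro hs ht
      have h2 : (0 : F) < 2⁻¹ := by positivity
      -- On this piece no inequality changes sign. The set containing the midpoint works for the
      -- whole piece: an inequality pointing the wrong way is an equality at the midpoint, hence, by
      -- reflection in the midpoint, everywhere.
      set m := (2⁻¹ : F) • (a + b) with hm
      have hmm : m + m = a + b := by
        rw [hm, ← add_smul, ← two_mul, mul_inv_cancel₀ two_ne_zero, one_smul]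
      have ha : a ≤ m := by
        by_contra! hlt
        have := add_lt_add_of_lt_of_le hlt (hlt.le.trans hab)
        rw [hmm] at this
        exact lt_irrefl _ this
      have hb : m ≤ b := by
        by_contra! hlt
        have := add_lt_add_of_le_of_lt (hab.trans hlt.le) hlt
        rw [hmm] at this
        exact lt_irrefl _ this
      obtain ⟨u, hu⟩ := hcov m (hs.trans ha) (hb.trans ht)
      refine .base hab ⟨u, fun r hr1 hr2 c hc => ?_⟩
      rcases hQ c (Finset.mem_biUnion.2 ⟨u, Finset.mem_univ u, hc⟩) with h | h
      · exact h r hr1 hr2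
      · have h3 := hu c hc
        have h4 := h (a + b - r) (by
          rw [add_sub_assoc]; exact le_add_of_nonneg_right (sub_nonneg.2 hr2)) (by
          rw [add_comm, add_sub_assoc]
          exact add_le_of_nonpos_right (sub_nonpos.2 hr1))
        have h5 : c.1 • r + c.1 • (a + b - r) = c.1 • m + c.1 • m := by
          rw [← smul_add, ← smul_add, hmm]; congr 1; abel
        by_contra! hlt
        have := add_lt_add_of_lt_of_le hlt h4
        rw [h5] at this
        exact absurd (add_le_add h3 h3) (not_le.2 this)
  exact key s t (of_finset _ hst) le_rfl le_rfl

end Subdiv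

/-! ### The spherical building of germs at a point -/

namespace Atlas

variable {ι F E W Λ M X : Type*} [Fintype ι] [Field F] [LinearOrder F]
    [IsStrictOrderedRing F] [AddCommGroup E] [Module F E] [Group W] [DistribMulAction W E]
    [AddCommGroup Λ] [LinearOrder Λ] [IsOrderedAddMonoid Λ] [Module F Λ] [PosSMulStrictMono F Λ]
    [Nontrivial Λ] [AddCommGroup M] [DistribMulAction W M]
    {D : WeylModel ι F E W Λ M} {𝒜 : Set (M → X)} {dX : X → X → Λ} (H : Atlas D 𝒜 dX)

variable (D) in
/-- The fundamental chambers translated to `a` in the chart `f` and to `b` in the chart `g` have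
the same base point and the same germ. -/
def GEq (f : M → X) (a : M) (g : M → X) (b : M) : Prop :=
  f a = g b ∧ ∃ s : Λ, 0 < s ∧ f (a + D.reg s) = g (b + D.reg s)

theorem GEq.symm {f g : M → X} {a b : M} (h : GEq D f a g b) : GEq D g b f a := by
  obtain ⟨h0, s, hs, h1⟩ := h
  exact ⟨h0.symm, s, hs, h1.symm⟩

include H

theorem GEq.refl (f : M → X) (a : M) : GEq D f a f a := by
  obtain ⟨s, hs⟩ := H.exists_pos
  exact ⟨rfl, s, hs, rfl⟩

/-- The linear part of the transition fixes `tm v s`; as `s ≠ 0` it fixes `v`, hence every `tm v r`.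
-/
theorem seg_shrink {f g : M → X} (hf : f ∈ 𝒜) (hg : g ∈ 𝒜) {a b : M} {v : E}
    (hv : ∀ k, D.pos k → 0 ≤ D.co k v) {r s : Λ} (hr : 0 ≤ r) (hrs : r ≤ s)
    (h0 : f a = g b) (h1 : f (a + D.tm v s) = g (b + D.tm v s)) :
    f (a + D.tm v r) = g (b + D.tm v r) := by
  rcases hr.eq_or_lt with rfl | hr0
  · simpa using h0
  have hmem : f (a + D.tm v r) ∈ Set.range g :=
    H.range_box hf hg ⟨b, h0.symm⟩ ⟨_, h1.symm⟩ (D.dom_tm hv hr) (by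
      rw [← map_sub]; exact D.dom_tm hv (sub_nonneg.2 hrs))
  obtain ⟨u, t, J, hu, -⟩ := H.trans f hf g hg a b h0
  have e0 := H.inj g hg (h0.symm.trans (hu a ⟨b, h0.symm⟩))
  have e1 := H.inj g hg (h1.symm.trans (hu _ ⟨_, h1.symm⟩))
  have e2 : D.tm v s = D.tm (u • v) s := by
    rw [← D.smul_tm]
    rw [e0, smul_add] at e1
    have : u • a + t + D.tm v s = u • a + t + u • D.tm v s := by rw [e1]; abel
    exact add_left_cancel this
  have e3 := D.tm_left_cancel (hr0.trans_le hrs).ne' e2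
  rw [hu _ hmem, smul_add, D.smul_tm, ← e3, e0]
  congr 1; abel

theorem GEq.spec {f g : M → X} (hf : f ∈ 𝒜) (hg : g ∈ 𝒜) {a b : M} (h : GEq D f a g b) {x : M}
    (hx : f x ∈ Set.range g) : f x = g (x - a + b) := by
  obtain ⟨h0, s, hs, h1⟩ := h
  exact H.trans_of_reg hf hg hs.ne' h0 h1 hx

theorem GEq.trans {f g k : M → X} (hf : f ∈ 𝒜) (hg : g ∈ 𝒜) (hk : k ∈ 𝒜) {a b c : M}
    (h : GEq D f a g b) (h' : GEq D g b k c) : GEq D f a k c := by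
  obtain ⟨h0, s, hs, h1⟩ := h
  obtain ⟨h0', s', hs', h1'⟩ := h'
  have hω : ∀ k, D.pos k → 0 ≤ D.co k D.omega := fun k hk => (D.pos_omega hk).le
  refine ⟨h0.trans h0', min s s', lt_min hs hs', ?_⟩
  have hm := (lt_min hs hs').le
  exact (H.seg_shrink hf hg hω hm (min_le_left _ _) h0 h1).trans
    (H.seg_shrink hg hk hω hm (min_le_right _ _) h0' h1')

theorem AsEq.cone_eq {f g : M → X} (hf : f ∈ 𝒜) (hg : g ∈ 𝒜) (h : AsEq D f g) {b b' : M}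
    (hb : f b = g b') {e : M} (he : D.Dom e) : f (b + e) = g (b' + e) := by
  obtain ⟨a, c, -, hx⟩ := AsEq.spec H hf hg h
  rw [hx _ (AsEq.range H hf hg h ⟨b', hb.symm⟩ he)]
  have := H.inj g hg (hb.symm.trans (hx b ⟨b', hb.symm⟩))
  rw [this]
  congr 1; abel

/-- The first piece of the regular segment of `f` at `a` lies in an apartment having the chamber of
`g` at infinity. It contains the base point as well, so it contains the whole Weyl chamber of `g`
there, together with the germ of `f`. -/
theorem exists_apartment_of_germs {f g : M → X} (hf : f ∈ 𝒜) (hg : g ∈ 𝒜) {a b : M}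
    (hab : f a = g b) : ∃ h ∈ 𝒜, ∃ b', (∀ e, D.Dom e → g (b + e) = h (b' + e)) ∧
      ∃ u : W, GEq D f a (tw h u) (u⁻¹ • b') := by
  obtain ⟨s, hs⟩ := H.exists_pos
  obtain ⟨t, ht, k, hk, ⟨v, hv⟩, hr⟩ :=
    (H.subdiv_lineInf hg hf a D.omega hs.le).exists_first hs
  have hh := H.tw_mem' hk v
  have hr' : ∀ r, 0 ≤ r → r ≤ t → f (a + D.reg r) ∈ Set.range (tw k v) :=
    fun r h1 h2 => by rw [range_tw]; exact hr r h1 h2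
  obtain ⟨b', hb'⟩ := hr' 0 le_rfl ht.le
  rw [D.reg_zero, add_zero] at hb'
  refine ⟨tw k v, hh, b', fun e he =>
    AsEq.cone_eq H hg hh hv.symm (hab.symm.trans hb'.symm) he, ?_⟩
  obtain ⟨u, w, J, hu, -⟩ := H.trans f hf _ hh a b' hb'.symm
  refine ⟨u, ?_, t, ht, ?_⟩
  · rw [tw, smul_inv_smul, hb']
  · have e0 := H.inj _ hh (hb'.trans (hu a ⟨b', hb'⟩))
    rw [hu _ (hr' t ht.le le_rfl)]
    conv_rhs => rw [tw]
    simp only [smul_add, smul_inv_smul]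
    rw [e0]
    congr 1; abel

/-- The germs of Weyl chambers at a point form a spherical building. -/
def residue (x : X) : ChamberSystem D.toWeylData {p : 𝒜 × M // p.1.1 p.2 = x} where
  tw c u := ⟨(⟨tw c.1.1.1 u, H.tw_mem' c.1.1.2 u⟩, u⁻¹ • c.1.2), by
    change c.1.1.1 (u • u⁻¹ • c.1.2) = x
    rw [smul_inv_smul]; exact c.2⟩
  eqv c d := GEq D c.1.1.1 c.1.2 d.1.1.1 d.1.2
  -- The guard is needed because `adj_trans` is required for every `i`, while shrinking a segment
  -- uses that `eta i` is dominant, which is known for simple `i`.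
  adj i c d := i ∈ D.simple → ∃ s : Λ, 0 < s ∧
    c.1.1.1 (c.1.2 + D.tm (D.eta i) s) = d.1.1.1 (d.1.2 + D.tm (D.eta i) s)
  tw_one c := by
    apply Subtype.ext
    apply Prod.ext
    · exact Subtype.ext (tw_one _)
    · change (1 : W)⁻¹ • c.1.2 = c.1.2
      simp
  tw_tw c u v := by
    apply Subtype.ext
    apply Prod.ext
    · exact Subtype.ext (tw_tw _ _ _)
    · change v⁻¹ • u⁻¹ • c.1.2 = (u * v)⁻¹ • c.1.2
      rw [mul_inv_rev, mul_smul]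
  eqv_refl c := GEq.refl H _ _
  eqv_symm h := h.symm
  eqv_trans {c d e} h h' := GEq.trans H c.1.1.2 d.1.1.2 e.1.1.2 h h'
  adj_symm := by
    intro i c d h hi
    obtain ⟨s, hs, h⟩ := h hi
    exact ⟨s, hs, h.symm⟩
  adj_trans := by
    intro i c d e h h' hi
    obtain ⟨s, hs, h⟩ := h hi
    obtain ⟨s', hs', h'⟩ := h' hi
    have hcd : c.1.1.1 c.1.2 = d.1.1.1 d.1.2 := c.2.trans d.2.symm
    have hde : d.1.1.1 d.1.2 = e.1.1.1 e.1.2 := d.2.trans e.2.symm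
    have hη : ∀ k, D.pos k → 0 ≤ D.co k (D.eta i) := fun k hk => D.eta_nonneg hi hk
    have hm := (lt_min hs hs').le
    exact ⟨min s s', lt_min hs hs',
      (H.seg_shrink c.1.1.2 d.1.1.2 hη hm (min_le_left _ _) hcd h).trans
        (H.seg_shrink d.1.1.2 e.1.1.2 hη hm (min_le_right _ _) hde h')⟩
  adj_of_eqv := by
    rintro i c d hi ⟨h0, s, hs, h1⟩ -
    have hη : ∀ k, D.pos k → 0 ≤ D.co k (D.eta i) := fun k hk => D.eta_nonneg hi hk
    refine ⟨s, hs, ?_⟩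
    have hmem := H.range_box c.1.1.2 d.1.1.2 (e := D.tm (D.eta i) s) ⟨_, h0.symm⟩ ⟨_, h1.symm⟩
      (D.dom_tm hη hs.le) (by
        have : D.reg s - D.tm (D.eta i) s = D.tm (D.om i) s := by
          rw [WeylModel.reg, ← AddMonoidHom.sub_apply, ← map_sub, WeylData.eta, sub_sub_cancel]
        rw [this]
        exact D.dom_tm (fun k hk => D.pos_om k hk i hi) hs.le)
    rw [GEq.spec H c.1.1.2 d.1.1.2 ⟨h0, s, hs, h1⟩ hmem,
      add_sub_cancel_left, add_comm]
  ends c d := by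
    obtain ⟨h, hh, b', h1, u, h2⟩ := H.exists_apartment_of_germs d.1.1.2 c.1.1.2
      (d.2.trans c.2.symm)
    have hb : c.1.1.1 c.1.2 = h b' := by simpa using h1 0 D.dom_zero
    refine ⟨⟨(⟨h, hh⟩, b'), hb.symm.trans c.2⟩, u, ?_, h2⟩
    obtain ⟨s, hs⟩ := H.exists_pos
    exact ⟨hb, s, hs, h1 _ (D.dom_reg hs.le)⟩
  uniq := by
    rintro h h' w w' h0 ⟨h1, s, hs, h2⟩
    change h.1.1.1 (w • (w⁻¹ • h.1.2 + D.reg s)) = h'.1.1.1 (w' • (w'⁻¹ • h'.1.2 + D.reg s)) at h2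
    rw [smul_add, smul_inv_smul, smul_add, smul_inv_smul] at h2
    rw [GEq.spec H h.1.1.2 h'.1.1.2 h0 ⟨_, h2.symm⟩, add_sub_cancel_left, add_comm] at h2
    exact D.reg_cancel hs.ne' (add_left_cancel (H.inj _ h'.1.1.2 h2))
  adj_refl := by
    intro i h hi _
    obtain ⟨s, hs⟩ := H.exists_pos
    refine ⟨s, hs, ?_⟩
    change _ = h.1.1.1 (D.refl i • ((D.refl i)⁻¹ • h.1.2 + D.tm (D.eta i) s))
    rw [smul_add, smul_inv_smul, D.smul_tm, D.refl_eta hi]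
  adj_tw := by
    intro i h h' w w' hi h0 h2
    obtain ⟨s, hs, h2⟩ := h2 hi
    change h.1.1.1 (w • (w⁻¹ • h.1.2 + D.tm _ s)) =
      h'.1.1.1 (w' • (w'⁻¹ • h'.1.2 + D.tm _ s)) at h2
    rw [smul_add, smul_inv_smul, smul_add, smul_inv_smul, D.smul_tm, D.smul_tm] at h2
    rw [GEq.spec H h.1.1.2 h'.1.1.2 h0 ⟨_, h2.symm⟩, add_sub_cancel_left, add_comm] at h2
    exact D.smul_eta_eq hi
      (D.tm_left_cancel hs.ne' (add_left_cancel (H.inj _ h'.1.1.2 h2)))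

/-- A germ opposite to a germ of a chamber determines an apartment containing that chamber and the
opposite segment. -/
theorem exists_apartment_of_opposite {f h : M → X} (hf : f ∈ 𝒜) (hh : h ∈ 𝒜) {a b : M}
    (hg : GEq D f a h b) (s : Λ) : ∃ k ∈ 𝒜, ∃ b₂, (∀ e, D.Dom e → k (b₂ - e) = h (b - e)) ∧
      ∀ r, 0 ≤ r → r ≤ s → f (a + D.reg r) = k (b₂ + D.reg r) := by
  obtain ⟨h0, t₀, ht₀, h1⟩ := hg
  have hω : ∀ k, D.pos k → 0 ≤ D.co k D.omega := fun k hk => (D.pos_omega hk).le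
  -- The Weyl chamber of `h` pointing away from the segment and the segment up to `t` lie in one
  -- apartment, in straight position.
  let P : Λ → Prop := fun t => ∃ k ∈ 𝒜, ∃ b₂, (∀ e, D.Dom e → k (b₂ - e) = h (b - e)) ∧
      ∀ r, 0 ≤ r → r ≤ t → f (a + D.reg r) = k (b₂ + D.reg r)
  have hbase : P t₀ := ⟨h, hh, b, fun _ _ => rfl, fun r hr hrt =>
    H.seg_shrink hf hh hω hr hrt h0 h1⟩
  have hc := H.tw_mem' hh D.w0
  -- The apartment of the next piece contains the point at parameter `t` and has the class of the
  -- chamber at infinity. So it contains the whole Weyl chamber based at that point, which covers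
  -- both the old chamber and the segment up to `t`. As `t > 0`, this overlap keeps the extended
  -- segment straight.
  have step : ∀ t t', Subdiv (LineInf D 𝒜 (tw h D.w0) f a D.omega) t t' → 0 < t → P t → P t' := by
    intro t t' hsub
    induction hsub with
    | trans hs1 _ ih1 ih2 => exact fun ht hP => ih2 (ht.trans_le hs1.le) (ih1 ht hP)
    | @base t t' htt hQ =>
      rintro ht ⟨k, hk, b₂, hk1, hk2⟩
      obtain ⟨k₀, hk₀, ⟨u, hu⟩, hr⟩ := hQ
      have hk' := H.tw_mem' hk₀ (u * D.w0)
      set k' := tw k₀ (u * D.w0) with hk'def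
      have hu' : AsEq D (tw k' D.w0) (tw h D.w0) := by
        rwa [hk'def, tw_tw, mul_assoc, D.w0_mul_self, mul_one]
      have hr' : ∀ r, t ≤ r → r ≤ t' → f (a + D.reg r) ∈ Set.range k' :=
        fun r h1 h2 => by rw [hk'def, range_tw]; exact hr r h1 h2
      obtain ⟨c₃, hc₃⟩ := hr' t le_rfl htt
      have hkh : AsEq D (tw k D.w0) (tw h D.w0) := by
        refine ⟨D.w0 • b₂, D.w0 • b, fun e he => ?_⟩
        have := hk1 _ (D.dom_neg_w0 he)
        simp only [tw, smul_add, ← mul_smul, D.w0_mul_self, one_smul]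
        simpa only [sub_neg_eq_add] using this
      have hcone : ∀ e, D.Dom e → k (b₂ + D.reg t - e) = k' (c₃ - e) := by
        intro e he
        have := AsEq.cone_eq H (H.tw_mem' hk D.w0) (H.tw_mem' hk' D.w0) (hkh.trans hu'.symm)
          (b := D.w0 • (b₂ + D.reg t)) (b' := D.w0 • c₃) (by
            simp only [tw, ← mul_smul, D.w0_mul_self, one_smul]
            rw [← hk2 t ht.le le_rfl, hc₃]) (D.dom_neg_w0 he)
        simp only [tw, ← smul_neg, ← smul_add, ← mul_smul, D.w0_mul_self, one_smul] at this
        simpa only [sub_eq_add_neg] using this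
      have hlow : ∀ r, 0 ≤ r → r ≤ t → f (a + D.reg r) = k' (c₃ - D.reg t + D.reg r) := by
        intro r h3 h4
        have := hcone _ (D.dom_reg (sub_nonneg.2 h4))
        rw [D.reg_sub] at this
        rw [hk2 r h3 h4]
        convert this using 2 <;> abel
      refine ⟨k', hk', c₃ - D.reg t, fun e he => ?_, fun r h3 h4 => ?_⟩
      · rw [← hk1 e he]
        have := hcone _ ((D.dom_reg ht.le).add he)
        convert this.symm using 2 <;> abel
      · rcases le_total r t with h5 | h5
        · exact hlow r h3 h5
        · have e0 := hlow 0 le_rfl ht.le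
          rw [D.reg_zero, add_zero, add_zero] at e0
          rw [H.trans_of_reg hf hk' ht.ne' e0 (hlow t ht.le le_rfl) (hr' r h5 h4)]
          congr 1; abel
  obtain ⟨k, hk, b₂, hk1, hk2⟩ := step t₀ (max s t₀)
    (H.subdiv_lineInf hc hf a D.omega (le_max_right _ _)) ht₀ hbase
  exact ⟨k, hk, b₂, hk1, fun r hr hrs => hk2 r hr (hrs.trans (le_max_left _ _))⟩

/-- A germ at a point and a segment starting at that point lie in a common apartment. -/
theorem exists_apartment_of_germ {f g : M → X} (hf : f ∈ 𝒜) (hg : g ∈ 𝒜) {a b : M}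
    (hab : f a = g b) {s : Λ} (hs : 0 ≤ s) : ∃ k ∈ 𝒜, f a ∈ Set.range k ∧
      f (a + D.reg s) ∈ Set.range k ∧ ∃ b', GEq D k b' g b := by
  obtain ⟨h, hh, b', h1, u, hG⟩ := H.exists_apartment_of_germs hf hg hab
  have hh₁ := H.tw_mem' hh u
  obtain ⟨t, ht⟩ := H.exists_pos
  obtain ⟨k, hk, b₂, hk1, hk2⟩ := H.exists_apartment_of_opposite hf hh₁ hG (s + t)
  have hst : 0 < s + t := add_pos_of_nonneg_of_pos hs ht
  obtain ⟨h0, r₁, hr₁, h01⟩ := hG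
  have hω : ∀ k, D.pos k → 0 ≤ D.co k D.omega := fun k hk => (D.pos_omega hk).le
  have hf0 : f a = k b₂ := by simpa [D.reg_zero] using hk2 0 le_rfl hst.le
  set r₀ := min r₁ (s + t) with hr₀
  have hr₀pos : 0 < r₀ := lt_min hr₁ hst
  have hkr : tw h u (u⁻¹ • b' + D.reg r₀) = k (b₂ + D.reg r₀) := by
    rw [← hk2 r₀ hr₀pos.le (min_le_right _ _)]
    exact (H.seg_shrink hf hh₁ hω hr₀pos.le (min_le_left _ _) h0 h01).symm
  obtain ⟨d, hd, hsmall⟩ := WeylData.exists_small (F := F) Finset.univ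
    (fun i => |D.co i D.omega|) (fun i => |D.co i (u⁻¹ • D.omega)|)
  -- The apartment `k` contains points on both sides of the base point along the regular line of `tw
  -- h u`. Every half-apartment bounding the overlap then leaves room in all directions, in
  -- particular in that of `u⁻¹ • omega`, the direction of the germ of `g`.
  have hmem : tw h u (u⁻¹ • b' + u⁻¹ • D.reg (d • r₀)) ∈ Set.range k := by
    obtain ⟨v, w, J, -, hJ⟩ := H.trans _ hh₁ k hk _ _ (h0.symm.trans hf0)
    rw [hJ]
    intro p hp
    have e1 := (hJ _).1 ⟨_, hkr.symm⟩ p hp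
    have e2 := (hJ _).1 ⟨_, hk1 _ (D.dom_reg hr₀pos.le)⟩ p hp
    rw [map_add, D.ev_reg] at e1
    rw [map_sub, D.ev_reg] at e2
    rw [map_add, WeylModel.reg, D.smul_tm, D.ev_tm, smul_smul]
    have h2 : (|D.co p.1 (u⁻¹ • D.omega)| * d) • r₀ ≤ |D.co p.1 D.omega| • r₀ := by
      refine smul_le_smul_of_nonneg_right ?_ hr₀pos.le
      rw [mul_comm]
      exact (hsmall p.1 (Finset.mem_univ _) (abs_pos.2 (by
        by_cases h : D.pos p.1
        · exact (D.pos_omega h).ne'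
        · exact (D.neg_omega h).ne))).le
    have h3 : -((|D.co p.1 (u⁻¹ • D.omega)| * d) • r₀) ≤ (D.co p.1 (u⁻¹ • D.omega) * d) • r₀ := by
      rw [← neg_smul, ← neg_mul]
      exact smul_le_smul_of_nonneg_right
        (mul_le_mul_of_nonneg_right (neg_abs_le _) hd.le) hr₀pos.le
    have h4 : p.2 ≤ D.ev p.1 (u⁻¹ • b') - |D.co p.1 D.omega| • r₀ := by
      rcases abs_choice (D.co p.1 D.omega) with h | h <;> rw [h]
      · exact e2
      · rw [neg_smul, sub_neg_eq_add]; exact e1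
    refine h4.trans ?_
    rw [sub_eq_add_neg]
    exact add_le_add_right ((neg_le_neg h2).trans h3) _
  have hpos : 0 < d • r₀ := smul_pos hd hr₀pos
  refine ⟨tw k u⁻¹, H.tw_mem' hk _, ?_, ?_, u • b₂, ?_, d • r₀, hpos, ?_⟩
  · rw [range_tw]; exact ⟨b₂, hf0.symm⟩
  · rw [range_tw]; exact ⟨_, (hk2 s hs (le_add_of_nonneg_right ht.le)).symm⟩
  · rw [tw, inv_smul_smul, ← hf0, hab]
  · rw [h1 _ (D.dom_reg hpos.le), tw, smul_add, inv_smul_smul]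
    have := H.trans_of_reg hh₁ hk hr₀pos.ne' (h0.symm.trans hf0) hkr hmem
    rw [tw, smul_add, smul_inv_smul, smul_inv_smul] at this
    rw [this]
    congr 1; abel

end Atlas
-- Centres of retractions and the distance estimate
namespace Atlas

variable {ι F E W Λ M X : Type*} [Fintype ι] [Field F] [LinearOrder F]
    [IsStrictOrderedRing F] [AddCommGroup E] [Module F E] [Group W] [DistribMulAction W E]
    [AddCommGroup Λ] [LinearOrder Λ] [IsOrderedAddMonoid Λ] [Module F Λ] [PosSMulStrictMono F Λ]
    [Nontrivial Λ] [AddCommGroup M] [DistribMulAction W M]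
    {D : WeylModel ι F E W Λ M} {𝒜 : Set (M → X)} {dX : X → X → Λ} (H : Atlas D 𝒜 dX)

include H

/-- A point of an apartment and an arbitrary point lie in an apartment which contains, up to
asymptoticity, a chamber of the first apartment in which the first point is seen in direction of
the chamber. -/
theorem exists_opposite_apartment {f : M → X} (hf : f ∈ 𝒜) (a : M) (x : X) :
    ∃ u : W, ∃ k ∈ 𝒜, AsEq D k (tw f u) ∧ ∃ c e, D.Dom e ∧ k c = x ∧ k (c + e) = f a := by
  obtain ⟨g₀, hg₀, ⟨p₀, hp₀⟩, q₀, hq₀⟩ := H.join (f a) x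
  obtain ⟨v, hv⟩ := D.exists_smul_dom (q₀ - p₀)
  set y₀ := v • (q₀ - p₀) with hy₀
  have hg₁ := H.tw_mem' hg₀ v⁻¹
  set g₁ := tw g₀ v⁻¹ with hg₁def
  have hb₁ : g₁ (v • p₀) = f a := by rw [hg₁def, tw, inv_smul_smul, hp₀]
  have hx : g₁ (v • p₀ + y₀) = x := by
    rw [hg₁def, tw, hy₀, ← smul_add, inv_smul_smul, add_sub_cancel, hq₀]
  set b₁ := v • p₀
  let c : {p : 𝒜 × M // p.1.1 p.2 = f a} := ⟨(⟨g₁, hg₁⟩, b₁), hb₁⟩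
  let d : {p : 𝒜 × M // p.1.1 p.2 = f a} := ⟨(⟨f, hf⟩, a), rfl⟩
  -- A chamber of `f` at `f a` opposite to the germ of the Weyl chamber of `g₁` that contains `x`.
  obtain ⟨u, hu⟩ := ChamberSystem.exists_opposite (S := H.residue (f a)) c d
  have hu' := hu.symm
  rw [D.w0_inv] at hu'
  have hfu := H.tw_mem' hf u
  have hfa : tw f u (u⁻¹ • a) = f a := by rw [tw, smul_inv_smul]
  obtain ⟨h, hh, b', h1, u', h2⟩ := H.exists_apartment_of_germs hg₁ hfu (hb₁.trans hfa.symm)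
  have hb' : tw f u (u⁻¹ • a) = h b' := by simpa using h1 0 D.dom_zero
  obtain ⟨s₀, hs₀⟩ := H.exists_pos
  have huw : u' = D.w0 := by
    refine ChamberSystem.Delta.unique (S := H.residue (f a)) (c := (H.residue (f a)).tw d u)
      (d := c) ⟨⟨(⟨h, hh⟩, b'), hb'.symm.trans hfa⟩, ?_, h2⟩ hu'
    exact ⟨hb', s₀, hs₀, h1 _ (D.dom_reg hs₀.le)⟩
  subst huw
  -- With `s` this large, `y₀` lies in the box spanned by `reg s`, so an apartment containing the
  -- regular segment contains `x`.
  obtain ⟨s, hs, -, hsy⟩ := D.exists_reg_ge y₀ s₀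
  have hspos := hs₀.trans_le hs
  obtain ⟨k, hk, b₂, hk1, hk2⟩ := H.exists_apartment_of_opposite hg₁ (H.tw_mem' hh D.w0) h2 s
  have hk0 : g₁ b₁ = k b₂ := by simpa [D.reg_zero] using hk2 0 le_rfl hspos.le
  have hks := hk2 s hspos.le le_rfl
  have hxk := H.range_box hg₁ hk ⟨b₂, hk0.symm⟩ ⟨_, hks.symm⟩ hv hsy
  have hxk' := H.trans_of_reg hg₁ hk hspos.ne' hk0 hks hxk
  rw [add_sub_cancel_left] at hxk'
  have hww : ∀ z : M, D.w0 • D.w0 • z = z := fun z => by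
    rw [← mul_smul, D.w0_mul_self, one_smul]
  refine ⟨u, tw k D.w0, H.tw_mem' hk _, ⟨D.w0 • b₂, u⁻¹ • a, fun e he => ?_⟩,
    D.w0 • b₂ + D.w0 • y₀, -(D.w0 • y₀), D.dom_neg_w0 hv, ?_, ?_⟩
  · have := hk1 _ (D.dom_neg_w0 he)
    rw [sub_neg_eq_add, sub_neg_eq_add, tw, smul_add, smul_inv_smul, hww] at this
    rw [h1 e he, ← this, tw, smul_add, hww]
  · rw [tw, smul_add, hww, hww, add_comm, ← hxk', hx]
  · rw [add_neg_cancel_right, tw, hww, ← hk0, hb₁]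

omit H in
theorem _root_.LambdaBuilding.WeylData.finite (D : WeylData ι F E W) : Finite W := by
  choose σ hσ using D.perm_smul
  refine Finite.of_injective σ fun u v huv => ?_
  have h : ∀ x : E, u • x = v • x := fun x => sub_eq_zero.1 (D.sep _ fun k => by
    rw [map_sub, hσ, hσ, huv, sub_self])
  exact inv_mul_eq_one.1 (D.faithful _ fun x => by rw [mul_smul, ← h, inv_smul_smul])

/-- A segment is subdivided into pieces whose end points lie in a chamber with given base point. -/
theorem subdiv_cone {f : M → X} (hf : f ∈ 𝒜) (a : M) (v : E) (x : X) {s t : Λ} (hst : s ≤ t) :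
    Subdiv (fun s t => ∃ h ∈ 𝒜, ∃ c e₁ e₂, D.Dom e₁ ∧ D.Dom e₂ ∧ h c = x ∧
      h (c + e₁) = f (a + D.tm v s) ∧ h (c + e₂) = f (a + D.tm v t)) s t := by
  classical
  have := D.toWeylData.finite
  -- For each of the finitely many chambers of `f` at infinity, an apartment through `x` having it
  -- at infinity.
  have hpt : ∀ u : W, ∃ h ∈ 𝒜, AsEq D h (tw f u) ∧ x ∈ Set.range h :=
    fun u => H.exists_apartment_of_point (H.tw_mem' hf u) x
  choose h hh hA p hp using hpt
  have htr : ∀ u : W, ∃ (w : W) (t : M) (J : Finset (ι × Λ)),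
      (∀ y, f y ∈ Set.range (h u) → f y = h u (w • y + t)) ∧
      ∀ y, f y ∈ Set.range (h u) ↔ ∀ p ∈ J, p.2 ≤ D.ev p.1 y := by
    intro u
    obtain ⟨α, β, hαβ⟩ := hA u
    refine H.trans f hf (h u) (hh u) (u • β) α ?_
    simpa [tw] using (hαβ 0 D.dom_zero).symm
  choose w τ J hw hJ using htr
  -- The linear inequalities in `r` for the point to lie in the apartment of `h u`, and then in its
  -- Weyl chamber based at `x`.
  let K : W → Finset (F × Λ) := fun u =>
    (J u).image (fun p => (D.co p.1 v, p.2 - D.ev p.1 a)) ∪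
    (Finset.univ.filter D.pos).image
      (fun k => (D.co k (w u • v), -D.ev k (w u • a + τ u - p u)))
  have hK : ∀ u r, (∀ c ∈ K u, c.2 ≤ c.1 • r) ↔
      ∃ e, D.Dom e ∧ h u (p u + e) = f (a + D.tm v r) := by
    intro u r
    have h1 : (∀ c ∈ K u, c.2 ≤ c.1 • r) ↔ f (a + D.tm v r) ∈ Set.range (h u) ∧
        D.Dom (w u • (a + D.tm v r) + τ u - p u) := by
      have e1 : ∀ k, D.ev k (w u • (a + D.tm v r) + τ u - p u) =
          D.co k (w u • v) • r - -D.ev k (w u • a + τ u - p u) := by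
        intro k
        rw [sub_neg_eq_add, ← D.ev_tm, ← D.smul_tm, ← map_add, smul_add]
        congr 1; abel
      simp only [K, Finset.mem_union, Finset.mem_image, Finset.mem_filter, Finset.mem_univ,
        true_and, or_imp, forall_and, forall_exists_index, and_imp, forall_apply_eq_imp_iff₂, hJ,
        map_add, D.ev_tm, sub_le_iff_le_add', WeylModel.Dom, e1, sub_nonneg]
    rw [h1]
    constructor
    · rintro ⟨h2, h3⟩
      refine ⟨_, h3, ?_⟩
      rw [hw u _ h2, add_sub_cancel]
    · rintro ⟨e, he, h2⟩
      have h3 := hw u _ ⟨_, h2⟩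
      refine ⟨⟨_, h2⟩, ?_⟩
      rw [← h2] at h3
      rw [← H.inj _ (hh u) h3, add_sub_cancel_left]
      exact he
  refine (Subdiv.of_cover K hst fun r _ _ => ?_).bind fun s' t' hst' hQ => .base hst' ?_
  -- The apartment `k` may differ from that of `h u`, but both contain `x` and are asymptotic, so
  -- they share the Weyl chamber at `x`.
  · obtain ⟨u, k, hk, hku, c, e, he, hc, hce⟩ := H.exists_opposite_apartment hf (a + D.tm v r) x
    refine ⟨u, (hK u r).2 ⟨e, he, ?_⟩⟩
    rw [← hce]
    exact AsEq.cone_eq H (hh u) hk ((hA u).trans hku.symm) ((hp u).trans hc.symm) he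
  · obtain ⟨u, hu⟩ := hQ
    obtain ⟨e₁, he₁, h1⟩ := (hK u s').1 (hu s' le_rfl hst')
    obtain ⟨e₂, he₂, h2⟩ := (hK u t').1 (hu t' hst' le_rfl)
    exact ⟨h u, hh u, p u, e₁, e₂, he₁, he₂, hp u, h1, h2⟩

omit H in
variable (D 𝒜) in
/-- A centre of a retraction: a coherent family of pointed charts, such that segments can be
subdivided into pieces with end points in a chart of the family. -/
structure IsCentre (𝒢 : (M → X) → M → Prop) : Prop where
  mem : ∀ {g b}, 𝒢 g b → g ∈ 𝒜
  coh : ∀ {g b g' b'}, 𝒢 g b → 𝒢 g' b' → ∃ x s, 0 < s ∧ g x = g' (x - b + b') ∧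
    g (x + D.reg s) = g' (x - b + b' + D.reg s)
  subdiv : ∀ f ∈ 𝒜, ∀ (a : M) (v : E) (s t : Λ), s ≤ t →
    Subdiv (fun s t => ∃ g b, 𝒢 g b ∧ f (a + D.tm v s) ∈ Set.range g ∧
      f (a + D.tm v t) ∈ Set.range g) s t

theorem isCentre_germ {g : M → X} (hg : g ∈ 𝒜) (b : M) :
    IsCentre D 𝒜 (fun g' b' => g' ∈ 𝒜 ∧ GEq D g' b' g b) where
  mem h := h.1
  coh := by
    rintro g₁ b₁ g₂ b₂ ⟨h1, h1'⟩ ⟨h2, h2'⟩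
    obtain ⟨h3, s, hs, h4⟩ := GEq.trans H h1 hg h2 h1' h2'.symm
    exact ⟨b₁, s, hs, by simpa using h3, by simpa using h4⟩
  subdiv f hf a v s t hst := by
    refine (H.subdiv_cone hf a v (g b) hst).bind fun s' t' hst' hQ => .base hst' ?_
    obtain ⟨h, hh, c, e₁, e₂, he₁, he₂, hc, h1, h2⟩ := hQ
    -- Both end points lie in the box from `c` to `c + reg (s₁ + s₂)`, so an apartment with the germ
    -- and the diagonal of this box suffices.
    obtain ⟨s₁, hs₁, hd₁⟩ := D.exists_reg e₁
    obtain ⟨s₂, hs₂, hd₂⟩ := D.exists_reg e₂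
    obtain ⟨k, hk, hk0, hk1, b', hb'⟩ :=
      H.exists_apartment_of_germ hh hg hc (add_nonneg hs₁ hs₂)
    refine ⟨k, b', ⟨hk, hb'⟩, ?_, ?_⟩
    · rw [← h1]
      refine H.range_box hh hk hk0 hk1 he₁ ?_
      rw [D.reg_add, add_sub_right_comm]
      exact hd₁.add (D.dom_reg hs₂)
    · rw [← h2]
      refine H.range_box hh hk hk0 hk1 he₂ ?_
      rw [D.reg_add, add_sub_assoc]
      exact (D.dom_reg hs₁).add hd₂

/-- The offset `b` records the translation between `c` and `g` near infinity. Two charts of the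
family are compared on a common subchamber of their chambers. -/
theorem isCentre_infinity {c : M → X} (hc : c ∈ 𝒜) :
    IsCentre D 𝒜 (fun g b => g ∈ 𝒜 ∧ ∃ m, ∀ e, D.Dom e → c (m + e) = g (m + b + e)) where
  mem h := h.1
  coh := by
    rintro g₁ b₁ g₂ b₂ ⟨-, m₁, h1⟩ ⟨-, m₂, h2⟩
    obtain ⟨m, hm₁, hm₂⟩ := D.exists_common m₁ m₂
    obtain ⟨s, hs⟩ := H.exists_pos
    have key : ∀ e, D.Dom e → g₁ (m + b₁ + e) = g₂ (m + b₂ + e) := by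
      intro e he
      have e1 := h1 _ (hm₁.add he)
      have e2 := h2 _ (hm₂.add he)
      have h3 : m₁ + (m - m₁ + e) = m₂ + (m - m₂ + e) := by abel
      rw [h3, e2] at e1
      convert e1.symm using 2 <;> abel
    refine ⟨m + b₁, s, hs, ?_, ?_⟩
    · simpa using key 0 D.dom_zero
    · simpa using key _ (D.dom_reg hs.le)
  subdiv f hf a v s t hst := by
    refine (H.subdiv_lineInf hc hf a v hst).bind fun s' t' hst' hQ => .base hst' ?_
    obtain ⟨h, hh, ⟨u, α, β, hu⟩, hr⟩ := hQ
    refine ⟨tw h u, α - β, ⟨H.tw_mem' hh u, β, fun e he => ?_⟩, ?_, ?_⟩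
    · rw [add_sub_cancel, hu e he]
    · rw [range_tw]; exact hr _ le_rfl hst'
    · rw [range_tw]; exact hr _ hst' le_rfl

namespace IsCentre

variable {𝒢 : (M → X) → M → Prop} (hG : IsCentre D 𝒜 𝒢)
include hG

theorem eq {g g' : M → X} {b b' : M} (h : 𝒢 g b) (h' : 𝒢 g' b') {q : M}
    (hq : g q ∈ Set.range g') : g q = g' (q - b + b') := by
  obtain ⟨x, s, hs, h1, h2⟩ := hG.coh h h'
  rw [H.trans_of_reg (hG.mem h) (hG.mem h') hs.ne' h1 h2 hq]
  congr 1; abel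

theorem exists_chart (y : X) : ∃ g b, 𝒢 g b ∧ y ∈ Set.range g := by
  obtain ⟨f, hf, ⟨a, rfl⟩, -⟩ := H.join y y
  have hsub := hG.subdiv f hf a 0 0 0 le_rfl
  have key : ∀ s t : Λ, Subdiv (fun s t => ∃ g b, 𝒢 g b ∧ f (a + D.tm 0 s) ∈ Set.range g ∧
      f (a + D.tm 0 t) ∈ Set.range g) s t → ∃ g b, 𝒢 g b ∧ f a ∈ Set.range g := by
    intro s t h
    induction h with
    | base hst hQ =>
      obtain ⟨g, b, h, h1, -⟩ := hQ
      exact ⟨g, b, h, by simpa using h1⟩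
    | trans _ _ h1 _ => exact h1
  exact key _ _ hsub

theorem unique {f g g' : M → X} {b b' β q q' : M} (h : 𝒢 g b) (h' : 𝒢 g' b') (hq : g q = g' q') :
    f (q - b + β) = f (q' - b' + β) := by
  have := hG.eq H h h' ⟨q', hq.symm⟩
  rw [hq] at this
  rw [H.inj _ (hG.mem h') this]
  congr 1; abel

/-- Each piece of a subdivided line is mapped isometrically, and the lengths of the pieces of a line
add up. The distance of two points is realized by a path of such lines. -/
theorem dist_le {f : M → X} {β : M} (hf : 𝒢 f β) {ρ : X → X}
    (hρ : ∀ g b q, 𝒢 g b → ρ (g q) = f (q - b + β)) (y z : X) : dX (ρ y) (ρ z) ≤ dX y z := by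
  have leg : ∀ k ∈ 𝒜, ∀ (a : M) (v : E) (s t : Λ), s ≤ t →
      dX (ρ (k (a + D.tm v s))) (ρ (k (a + D.tm v t))) ≤ D.nrm (D.tm v (t - s)) := by
    intro k hk a v s t hst
    have hsub := hG.subdiv k hk a v s t hst
    induction hsub with
    | @base s t hst hQ =>
      obtain ⟨g, b, hg, ⟨p, hp⟩, q, hq⟩ := hQ
      rw [← hp, ← hq, hρ g b p hg, hρ g b q hg, H.dist_eq f (hG.mem hf)]
      have e1 : q - b + β - (p - b + β) = q - p := by abel
      rw [e1, ← H.dist_eq g (hG.mem hg), hp, hq, H.dist_eq k hk, map_sub]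
      apply le_of_eq; congr 1; abel
    | @trans s t r h1 h2 ih1 ih2 =>
      refine (H.triangle _ _ _).trans ((add_le_add (ih1 h1.le) (ih2 h2.le)).trans ?_)
      rw [← D.nrm_tm_add v (sub_nonneg.2 h1.le) (sub_nonneg.2 h2.le)]
      apply le_of_eq; congr 2; abel
  obtain ⟨k, hk, ⟨p, rfl⟩, q, rfl⟩ := H.join y z
  obtain ⟨u, hu⟩ := D.exists_smul_dom (q - p)
  have hk' := H.tw_mem' hk u⁻¹
  -- The path runs along the directions `om j` one after the other. After the twist by `u` all its
  -- steps are dominant, so their norms add up to that of `q - p`.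
  have key : ∀ S ⊆ D.simple, dX (ρ (tw k u⁻¹ (u • p)))
      (ρ (tw k u⁻¹ (u • p + ∑ j ∈ S, D.tm (D.om j) (D.ev j (u • (q - p)))))) ≤
      D.nrm (∑ j ∈ S, D.tm (D.om j) (D.ev j (u • (q - p)))) ∧
      D.Dom (∑ j ∈ S, D.tm (D.om j) (D.ev j (u • (q - p)))) := by
    classical
    intro S
    induction S using Finset.induction_on with
    | empty =>
      intro _
      refine ⟨?_, by simpa using D.dom_zero⟩
      obtain ⟨g, b, hg, x, hx⟩ := hG.exists_chart H (tw k u⁻¹ (u • p))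
      simp only [Finset.sum_empty, add_zero, D.nrm_zero]
      rw [← hx, hρ g b x hg, H.dist_eq f (hG.mem hf), sub_self, D.nrm_zero]
    | insert j S hj ih =>
      intro hS
      obtain ⟨ih1, ih2⟩ := ih ((Finset.subset_insert _ _).trans hS)
      have hjs := hS (Finset.mem_insert_self _ _)
      have h0 : 0 ≤ D.ev j (u • (q - p)) := hu j (D.simple_pos hjs)
      have hd : D.Dom (D.tm (D.om j) (D.ev j (u • (q - p)))) :=
        D.dom_tm (fun k hk => D.pos_om k hk j hjs) h0
      rw [Finset.sum_insert hj, add_comm (D.tm _ _)]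
      refine ⟨?_, ih2.add hd⟩
      rw [D.nrm_add_of_dom ih2 hd]
      refine (H.triangle _ _ _).trans (add_le_add ih1 ?_)
      have := leg _ hk' (u • p + ∑ j ∈ S, D.tm (D.om j) (D.ev j (u • (q - p)))) (D.om j) 0 _ h0
      rwa [map_zero, add_zero, sub_zero, add_assoc] at this
  obtain ⟨h1, -⟩ := key _ subset_rfl
  rw [← D.decomp, ← smul_add, add_sub_cancel] at h1
  rw [tw, tw, inv_smul_smul, inv_smul_smul, D.nrm_smul] at h1
  rwa [H.dist_eq k hk]

end IsCentre

end Atlas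
-- Real root systems: coroots of a basis
section RealForm

variable {ι V N : Type*} [Fintype ι] [AddCommGroup V] [Module ℝ V] [AddCommGroup N] [Module ℝ N]
    (P : RootPairing ι ℝ V N)

theorem rootForm_root_pos (i : ι) : 0 < P.RootForm (P.root i) (P.root i) := by
  rw [P.rootForm_root_self]
  refine Finset.sum_pos' (fun j _ => mul_self_nonneg _) ⟨i, Finset.mem_univ i, ?_⟩
  simp

theorem eq_zero_of_coroot'_eq_zero [P.IsRootSystem] {x : V} (h : ∀ k, P.coroot' k x = 0) :
    x = 0 := by
  have h1 : P.toLinearMap x = 0 := by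
    apply LinearMap.ext_on (s := Set.range P.coroot)
      (RootPairing.IsRootSystem.span_coroot_eq_top (P := P))
    rintro _ ⟨k, rfl⟩
    simpa using! h k
  exact P.toPerfPair.injective (by simpa using! h1)

theorem polarization_injective [P.IsRootSystem] : Function.Injective P.Polarization := by
  rw [injective_iff_map_eq_zero]
  intro x hx
  refine eq_zero_of_coroot'_eq_zero P fun k => ?_
  have h1 : P.RootForm x x = 0 := by
    rw [(P.polarization_apply_eq_zero_iff x).1 hx, LinearMap.zero_apply]
  rw [P.rootForm_apply_apply] at h1
  have := (Finset.sum_eq_zero_iff_of_nonneg fun i _ => mul_self_nonneg _).1 h1 k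
    (Finset.mem_univ k)
  exact mul_self_eq_zero.1 this

theorem coroot_eq (i : ι) :
    P.coroot i = (2 / P.RootForm (P.root i) (P.root i)) • P.Polarization (P.root i) := by
  have h := P.rootForm_self_smul_coroot i
  have h0 := (rootForm_root_pos P i).ne'
  rw [div_eq_inv_mul, mul_smul, ofNat_smul_eq_nsmul, ← h, smul_smul, inv_mul_cancel₀ h0, one_smul]

variable {P}

/-- By `coroot_eq` the coroots are nonzero multiples of the images of the roots under the injective
polarization. -/
theorem RootBasis.coroot_linearIndepOn [P.IsRootSystem] (B : RootBasis P) :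
    LinearIndepOn ℝ P.coroot (B.support : Set ι) := by
  have h1 : LinearIndepOn ℝ (P.Polarization ∘ P.root) (B.support : Set ι) :=
    B.linearIndepOn.map' P.Polarization (LinearMap.ker_eq_bot.2 (polarization_injective P))
  have h2 := LinearIndependent.units_smul h1 (fun i : (B.support : Set ι) =>
    Units.mk0 (2 / P.RootForm (P.root i) (P.root i))
      (div_ne_zero two_ne_zero (rootForm_root_pos P i).ne'))
  have h3 : (fun i : (B.support : Set ι) => P.coroot i) = _ := funext fun i => coroot_eq P i
  rw [LinearIndepOn, h3]
  exact h2

theorem RootBasis.coroot_of_isPos (B : RootBasis P) {k : ι} (hk : B.IsPos k) :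
    ∃ n : ι → ℝ, (∀ j, 0 ≤ n j) ∧ P.coroot k = ∑ j ∈ B.support, n j • P.coroot j := by
  obtain ⟨c, hc, h⟩ := hk
  have hQ := rootForm_root_pos P
  refine ⟨fun j => c j * P.RootForm (P.root j) (P.root j) / P.RootForm (P.root k) (P.root k),
    fun j => div_nonneg (mul_nonneg (hc j) (hQ j).le) (hQ k).le, ?_⟩
  have h1 : P.Polarization (P.root k) = ∑ j ∈ B.support, c j • P.Polarization (P.root j) := by
    rw [h, map_sum]; simp only [map_smul]
  rw [coroot_eq P k, h1, Finset.smul_sum]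
  refine Finset.sum_congr rfl fun j _ => ?_
  rw [coroot_eq P j, smul_smul, smul_smul]
  congr 1
  field_simp [(hQ j).ne', (hQ k).ne']

theorem RootBasis.isPos_or (B : RootBasis P) (k : ι) : B.IsPos k ∨ B.IsPos (P.reflectionPerm k k) := by
  obtain ⟨c, hc, h | h⟩ := B.pos_or_neg k
  · exact Or.inl ⟨c, hc, h⟩
  · exact Or.inr ⟨c, hc, by rw [P.root_reflectionPerm, P.reflection_apply_self, h]⟩

end RealForm

/-! ### The model apartment of a root system -/

noncomputable section Instance

variable {ι V N : Type*} [Fintype ι] [AddCommGroup V] [Module ℝ V] [AddCommGroup N] [Module ℝ N]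
    {P : RootPairing ι ℝ V N} [P.IsRootSystem] (B : RootBasis P) (F : Subfield ℝ) [P.IsValuedIn F]

instance : Module F (P.rootSpan F) := Submodule.module _

instance : SMul F (P.rootSpan F) := (Module.toDistribMulAction (R := F)).toSMul

theorem coe_coroot'In (i : ι) (x : P.rootSpan F) : (P.coroot'In F i x : ℝ) = P.coroot' i x :=
  P.algebraMap_coroot'In_apply F i x

theorem coe_rootReflection (i : ι) (x : P.rootSpan F) :
    (rootReflection P F i x : V) = P.reflection i x := by
  rw [rootReflection, Module.reflection_apply, P.reflection_apply, ← coe_coroot'In]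
  rfl

-- Independence of the simple coroots over `ℝ` gives independence over `F` of their restrictions to
-- the `F`-span of the roots. These are therefore jointly surjective, which yields dual vectors with
-- no scalars outside `F`.
open scoped Classical in
theorem RootBasis.exists_dual : ∃ om : ι → P.rootSpan F, ∀ i ∈ B.support, ∀ j ∈ B.support,
    P.coroot'In F i (om j) = if i = j then 1 else 0 := by
  have hind : LinearIndependent F (fun i : B.support => P.coroot'In F (i : ι)) := by
    rw [Fintype.linearIndependent_iff]
    intro a ha
    have h1 := Fintype.linearIndependent_iff.1 B.coroot_linearIndepOn (fun i => ((a i : F) : ℝ)) ?_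
    · exact fun i => Subtype.ext (h1 i)
    · apply P.flip.toPerfPair.injective
      rw [map_zero]
      apply LinearMap.ext_on (s := Set.range P.root)
        (RootPairing.IsRootSystem.span_root_eq_top (P := P))
      rintro _ ⟨k, rfl⟩
      have h2 := congrArg (fun y => ((y (P.rootSpanMem F k) : F) : ℝ)) ha
      simp only [LinearMap.sum_apply, LinearMap.smul_apply, smul_eq_mul, LinearMap.zero_apply] at h2
      push_cast at h2
      simp only [coe_coroot'In] at h2
      simpa using! h2
  have hsurj : Function.Surjective
      (LinearMap.pi (fun i : B.support => P.coroot'In F (i : ι))) := by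
    rw [← LinearMap.range_eq_top]
    by_contra hne
    obtain ⟨φ, hφ, hle⟩ := Submodule.exists_le_ker_of_lt_top _ (lt_top_iff_ne_top.2 hne)
    refine hφ (LinearMap.pi_ext' fun i => LinearMap.ext_ring ?_)
    refine Fintype.linearIndependent_iff.1 hind (fun i => φ (Pi.single i 1)) ?_ i
    ext1 v
    have h1 : φ (LinearMap.pi (fun i : B.support => P.coroot'In F (i : ι)) v) = 0 :=
      hle (LinearMap.mem_range_self _ v)
    rw [LinearMap.pi_apply_eq_sum_univ φ] at h1
    rw [LinearMap.sum_apply, LinearMap.zero_apply, ← h1]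
    refine Finset.sum_congr rfl fun j _ => ?_
    rw [LinearMap.smul_apply, LinearMap.pi_apply, smul_eq_mul, smul_eq_mul, mul_comm]
    congr 2
    ext l
    simp [Pi.single_apply, eq_comm]
  have h : ∀ j, ∃ v : P.rootSpan F, ∀ i ∈ B.support, P.coroot'In F i v = if i = j then 1 else 0 := by
    intro j
    obtain ⟨v, hv⟩ := hsurj fun i => if (i : ι) = j then 1 else 0
    exact ⟨v, fun i hi => congrFun hv ⟨i, hi⟩⟩
  choose om hom using h
  exact ⟨om, fun i hi j _ => hom j i hi⟩

variable (P) in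
/-- The spherical Weyl group, acting on the `F`-span of the roots. -/
def RootWeylGroup : Type _ := ↥(Subgroup.closure (Set.range (rootReflection P F)))

instance : Group (RootWeylGroup P F) :=
  inferInstanceAs (Group ↥(Subgroup.closure (Set.range (rootReflection P F))))

variable {F} in
/-- The linear automorphism given by an element of the spherical Weyl group. -/
def RootWeylGroup.toLinearEquiv (u : RootWeylGroup P F) : P.rootSpan F ≃ₗ[F] P.rootSpan F := u.1

instance : SMul (RootWeylGroup P F) (P.rootSpan F) where
  smul u v := u.toLinearEquiv v

instance : DistribMulAction (RootWeylGroup P F) (P.rootSpan F) where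
  one_smul _ := rfl
  mul_smul _ _ _ := rfl
  smul_zero u := map_zero u.toLinearEquiv
  smul_add u := map_add u.toLinearEquiv

variable (P) in
/-- The reflections in the spherical Weyl group. -/
def rootRefl (i : ι) : RootWeylGroup P F :=
  ⟨rootReflection P F i, Subgroup.subset_closure (Set.mem_range_self i)⟩

theorem closure_rootRefl : Subgroup.closure (Set.range (rootRefl P F)) = ⊤ := by
  refine Eq.trans ?_ (Subgroup.closure_closure_coe_preimage (k := Set.range (rootReflection P F)))
  refine congrArg (Subgroup.closure (G := RootWeylGroup P F)) ?_
  refine Set.ext fun u => ⟨?_, ?_⟩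
  · rintro ⟨i, rfl⟩; exact ⟨i, rfl⟩
  · rintro ⟨i, hi⟩; exact ⟨i, Subtype.ext hi⟩

theorem eq_zero_of_coroot'In_eq_zero {v : P.rootSpan F} (h : ∀ k, P.coroot'In F k v = 0) :
    v = 0 := by
  refine Subtype.ext (eq_zero_of_coroot'_eq_zero P fun k => ?_)
  rw [← coe_coroot'In, h k]
  rfl

theorem coroot'In_rootReflection (i k : ι) (v : P.rootSpan F) :
    P.coroot'In F k (rootReflection P F i v) = P.coroot'In F (P.reflectionPerm i k) v := by
  apply Subtype.ext
  rw [coe_coroot'In, coe_coroot'In, coe_rootReflection, P.coroot'_reflection]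

theorem coroot'In_reflectionPerm_self (k : ι) (v : P.rootSpan F) :
    P.coroot'In F (P.reflectionPerm k k) v = -P.coroot'In F k v := by
  apply Subtype.ext
  rw [coe_coroot'In]
  push_cast
  rw [coe_coroot'In]
  simp [RootPairing.coroot']

variable {F} in
theorem RootBasis.coroot'In_of_isPos {k : ι} (hk : B.IsPos k) : ∃ n : ι → ℝ, (∀ j, 0 ≤ n j) ∧
    ∀ v : P.rootSpan F, (P.coroot'In F k v : ℝ) = ∑ j ∈ B.support, n j * P.coroot'In F j v := by
  obtain ⟨n, hn, h⟩ := B.coroot_of_isPos hk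
  refine ⟨n, hn, fun v => ?_⟩
  simp only [coe_coroot'In, RootPairing.coroot', h]
  simp

open scoped Classical in
theorem RootBasis.coroot'In_om {om : ι → P.rootSpan F} {n : ι → ℝ} {k : ι}
    (hom : ∀ i ∈ B.support, ∀ j ∈ B.support, P.coroot'In F i (om j) = if i = j then 1 else 0)
    (h : ∀ v : P.rootSpan F, (P.coroot'In F k v : ℝ) = ∑ j ∈ B.support, n j * P.coroot'In F j v)
    {j : ι} (hj : j ∈ B.support) : (P.coroot'In F k (om j) : ℝ) = n j := by
  rw [h, Finset.sum_eq_single j]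
  · rw [hom j hj j hj, if_pos rfl]; simp
  · intro i hi hij
    rw [hom i hi j hj, if_neg hij]; simp
  · exact fun h => absurd hj h

/-- The spherical data of a root system with a basis. -/
def RootBasis.weylData : WeylData ι F (P.rootSpan F) (RootWeylGroup P F) where
  co := P.coroot'In F
  al := P.rootSpanMem F
  refl := rootRefl P F
  perm := P.reflectionPerm
  pos := B.IsPos
  simple := B.support
  om := (B.exists_dual F).choose
  refl_smul i v := by
    change rootReflection P F i v = _
    rw [rootReflection, Module.reflection_apply]
  co_al i := by simp
  co_refl i k v := coroot'In_rootReflection F i k v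
  faithful u hu := Subtype.ext (LinearEquiv.ext hu)
  gen := closure_rootRefl F
  sep v h := eq_zero_of_coroot'In_eq_zero F h
  co_om_self i hi := by rw [(B.exists_dual F).choose_spec i hi i hi, if_pos rfl]
  co_om_ne i hi j hj hij := by rw [(B.exists_dual F).choose_spec i hi j hj, if_neg hij]
  co_sum k v := by
    have key : ∀ k, B.IsPos k → ∀ v, P.coroot'In F k v =
        ∑ j ∈ B.support, P.coroot'In F k ((B.exists_dual F).choose j) * P.coroot'In F j v := by
      intro k hk v
      obtain ⟨n, -, hn⟩ := B.coroot'In_of_isPos (F := F) hk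
      apply Subtype.ext
      rw [hn v]
      push_cast
      exact Finset.sum_congr rfl fun j hj => by
        rw [B.coroot'In_om F (B.exists_dual F).choose_spec hn hj]
    rcases B.isPos_or k with hk | hk
    · exact key k hk v
    · have := key _ hk v
      simp only [coroot'In_reflectionPerm_self, neg_mul, Finset.sum_neg_distrib] at this
      exact neg_injective this
  pos_om k hk j hj := by
    obtain ⟨n, h0, hn⟩ := B.coroot'In_of_isPos (F := F) hk
    have := h0 j
    rw [← B.coroot'In_om F (B.exists_dual F).choose_spec hn hj] at this
    exact this
  neg_om k hk j hj := by
    obtain ⟨n, h0, hn⟩ := B.coroot'In_of_isPos (F := F) ((B.isPos_or k).resolve_left hk)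
    have := h0 j
    rw [← B.coroot'In_om F (B.exists_dual F).choose_spec hn hj, coroot'In_reflectionPerm_self]
      at this
    exact neg_nonneg.1 this
  exists_simple k hk := by
    obtain ⟨c, hc, h⟩ := hk
    by_contra! hle
    -- The value `2` of a coroot on its own root is a non-negative combination of its values on the
    -- simple roots, so one of these is positive.
    have h1 : P.coroot' k (P.root k) = ∑ j ∈ B.support, c j * P.coroot' k (P.root j) := by
      conv_lhs => rw [h]
      simp
    have h2 : P.coroot' k (P.root k) = 2 := by simp
    have h3 : ∑ j ∈ B.support, c j * P.coroot' k (P.root j) ≤ 0 := by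
      refine Finset.sum_nonpos fun j hj => mul_nonpos_of_nonneg_of_nonpos (hc j) ?_
      have h4 : ((P.coroot'In F k (P.rootSpanMem F j) : F) : ℝ) ≤ 0 := hle j hj
      rwa [coe_coroot'In] at h4
    linarith

variable (Λ : Type*) [AddCommGroup Λ] [LinearOrder Λ] [Module F Λ]

@[simp]
theorem eval_tmul (k : ι) (v : P.rootSpan F) (s : Λ) :
    eval P F Λ k (v ⊗ₜ[F] s) = P.coroot'In F k v • s := by
  simp [eval]

instance : SMul (RootWeylGroup P F) (ModelSpace P F Λ) where
  smul u x := u.toLinearEquiv.toLinearMap.rTensor Λ x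

instance : DistribMulAction (RootWeylGroup P F) (ModelSpace P F Λ) where
  one_smul x := by
    change (LinearMap.id : P.rootSpan F →ₗ[F] P.rootSpan F).rTensor Λ x = x
    rw [LinearMap.rTensor_id, LinearMap.id_apply]
  mul_smul u v x := by
    change (u.toLinearEquiv.toLinearMap ∘ₗ v.toLinearEquiv.toLinearMap).rTensor Λ x = _
    rw [LinearMap.rTensor_comp]
    rfl
  smul_zero u := map_zero (u.toLinearEquiv.toLinearMap.rTensor Λ)
  smul_add u := map_add (u.toLinearEquiv.toLinearMap.rTensor Λ)

instance : MulAction (RootWeylGroup P F) (ModelSpace P F Λ) := DistribMulAction.toMulAction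

instance : SemigroupAction (RootWeylGroup P F) (ModelSpace P F Λ) := MulAction.toSemigroupAction

theorem eval_rootRefl (i k : ι) (x : ModelSpace P F Λ) :
    eval P F Λ k (rootRefl P F i • x) = eval P F Λ (P.reflectionPerm i k) x := by
  have h : eval P F Λ k ∘ₗ (rootRefl P F i).toLinearEquiv.toLinearMap.rTensor Λ =
      eval P F Λ (P.reflectionPerm i k) := by
    refine TensorProduct.ext' fun v s => ?_
    rw [LinearMap.comp_apply, LinearMap.rTensor_tmul, eval_tmul, eval_tmul]
    exact congrArg (· • s) (coroot'In_rootReflection F i k v)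
  exact LinearMap.congr_fun h x

theorem RootBasis.eval_eq_sum (k : ι) (x : ModelSpace P F Λ) : eval P F Λ k x =
    ∑ j ∈ B.support, (B.weylData F).co k ((B.weylData F).om j) • eval P F Λ j x := by
  induction x using TensorProduct.induction_on with
  | zero => simp
  | tmul v s =>
    simp only [eval_tmul]
    rw [show P.coroot'In F k v = _ from (B.weylData F).co_sum k v, Finset.sum_smul]
    exact Finset.sum_congr rfl fun j _ => mul_smul _ _ _
  | add x y hx hy => simp only [map_add, hx, hy, smul_add, Finset.sum_add_distrib]

theorem RootBasis.eq_sum_om (v : P.rootSpan F) :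
    v = ∑ j ∈ B.support, P.coroot'In F j v • (B.weylData F).om j := by
  refine sub_eq_zero.1 ((B.weylData F).sep _ fun k => ?_)
  rw [map_sub, map_sum, (B.weylData F).co_sum k v, sub_eq_zero]
  refine Finset.sum_congr rfl fun j _ => ?_
  rw [map_smul, smul_eq_mul, mul_comm]
  rfl

theorem RootBasis.eq_sum_tmul (x : ModelSpace P F Λ) :
    x = ∑ j ∈ B.support, (B.weylData F).om j ⊗ₜ[F] eval P F Λ j x := by
  induction x using TensorProduct.induction_on with
  | zero => simp
  | tmul v s =>
    simp only [eval_tmul, ← TensorProduct.smul_tmul, ← TensorProduct.sum_tmul]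
    rw [← B.eq_sum_om]
  | add x y hx hy =>
    simp only [map_add, TensorProduct.tmul_add, Finset.sum_add_distrib]
    rw [← hx, ← hy]

variable (P) in
/-- The involution sending the index of a root to the index of the opposite root. -/
def oppositeRoot : Equiv.Perm ι where
  toFun k := P.reflectionPerm k k
  invFun k := P.reflectionPerm k k
  left_inv k := P.root.injective (by
    rw [P.root_reflectionPerm, P.reflection_apply_self, P.root_reflectionPerm,
      P.reflection_apply_self, neg_neg])
  right_inv k := P.root.injective (by
    rw [P.root_reflectionPerm, P.reflection_apply_self, P.root_reflectionPerm,
      P.reflection_apply_self, neg_neg])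

/-- The model apartment of a generalized affine building. -/
def RootBasis.weylModel : WeylModel ι F (P.rootSpan F) (RootWeylGroup P F) Λ (ModelSpace P F Λ) where
  toWeylData := B.weylData F
  ev k := (eval P F Λ k).toAddMonoidHom
  tm := AddMonoidHom.mk' (fun v => (TensorProduct.mk F (P.rootSpan F) Λ v).toAddMonoidHom)
    fun v w => by ext s; exact TensorProduct.add_tmul v w s
  ev_tm k v s := eval_tmul F Λ k v s
  smul_tm u v s := rfl
  ev_refl := eval_rootRefl F Λ
  ev_sum := B.eval_eq_sum F Λ
  opp := oppositeRoot P
  co_opp k v := coroot'In_reflectionPerm_self F k v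
  decomp := B.eq_sum_tmul F Λ

variable {F Λ}

theorem exists_weyl_smul {u : ModelSpace P F Λ ≃ₗ[F] ModelSpace P F Λ}
    (hu : u ∈ sphericalWeylGroup P F Λ) : ∃ w : RootWeylGroup P F, ∀ x, u x = w • x := by
  induction hu using Subgroup.closure_induction with
  | mem u hu =>
    obtain ⟨i, rfl⟩ := hu
    exact ⟨rootRefl P F i, fun x => rfl⟩
  | one => exact ⟨1, fun x => (one_smul _ x).symm⟩
  | mul u v _ _ hu hv =>
    obtain ⟨a, ha⟩ := hu
    obtain ⟨b, hb⟩ := hv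
    exact ⟨a * b, fun x => by rw [LinearEquiv.mul_apply, hb, ha, mul_smul]⟩
  | inv u _ hu =>
    obtain ⟨a, ha⟩ := hu
    refine ⟨a⁻¹, fun x => ?_⟩
    rw [eq_inv_smul_iff, ← ha]
    exact u.apply_symm_apply x

theorem exists_spherical (w : RootWeylGroup P F) :
    ∃ u ∈ sphericalWeylGroup P F Λ, ∀ x, u x = w • x := by
  have hw : w ∈ Subgroup.closure (Set.range (rootRefl P F)) := by
    rw [closure_rootRefl]; trivial
  induction hw using Subgroup.closure_induction with
  | mem u hu =>
    obtain ⟨i, rfl⟩ := hu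
    exact ⟨modelReflection P F Λ i, Subgroup.subset_closure ⟨i, rfl⟩, fun x => rfl⟩
  | one => exact ⟨1, one_mem _, fun x => (one_smul _ x).symm⟩
  | mul u v _ _ hu hv =>
    obtain ⟨a, ha, ha'⟩ := hu
    obtain ⟨b, hb, hb'⟩ := hv
    exact ⟨a * b, mul_mem ha hb, fun x => by rw [LinearEquiv.mul_apply, hb', ha', mul_smul]⟩
  | inv u _ hu =>
    obtain ⟨a, ha, ha'⟩ := hu
    refine ⟨a⁻¹, inv_mem ha, fun x => ?_⟩
    rw [eq_inv_smul_iff, ← ha']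
    exact a.apply_symm_apply x

end Instance

open Atlas

/-! ### From the building axioms to an atlas -/

section Abstract

variable {ι F E W Λ M X : Type*} [Fintype ι] [Field F] [LinearOrder F]
    [IsStrictOrderedRing F] [AddCommGroup E] [Module F E] [Group W] [DistribMulAction W E]
    [AddCommGroup Λ] [LinearOrder Λ] [IsOrderedAddMonoid Λ] [Module F Λ] [PosSMulStrictMono F Λ]
    [AddCommGroup M] [DistribMulAction W M]
    (D : WeylModel ι F E W Λ M) {𝒜 : Set (M → X)} {dX : X → X → Λ}

/-- The Weyl chamber with base point `f a` in the direction of the fundamental chamber of the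
chart `f`. -/
def cone (f : M → X) (a : M) : Set X := {x | ∃ e, D.Dom e ∧ f (a + e) = x}

theorem cone_tw (f : M → X) (u : W) (a : M) :
    f '' ((fun x => u • x + a) '' {x | D.Dom x}) = cone D (tw f u) (u⁻¹ • a) := by
  ext x
  constructor
  · rintro ⟨_, ⟨e, he, rfl⟩, rfl⟩
    exact ⟨e, he, by rw [tw, smul_add, smul_inv_smul, add_comm]⟩
  · rintro ⟨e, he, rfl⟩
    exact ⟨_, ⟨e, he, rfl⟩, by rw [tw, smul_add, smul_inv_smul, add_comm]⟩

variable {D}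

/-- Two facts are derived here: the distance does not depend on the chart, since transitions
preserve `nrm`, and the triangle inequality for `x, y, z` follows by retracting onto an apartment
through `x` and `z`. -/
theorem Atlas.of_axioms (inj : ∀ f ∈ 𝒜, Function.Injective f)
    (tw_mem : ∀ f ∈ 𝒜, ∀ u : W, tw f u ∈ 𝒜)
    (trans : ∀ f ∈ 𝒜, ∀ g ∈ 𝒜, (Set.range f ∩ Set.range g).Nonempty →
      ∃ (u : W) (t : M) (J : Finset (ι × Λ)), (∀ x, f x ∈ Set.range g → f x = g (u • x + t)) ∧
      ∀ x, f x ∈ Set.range g ↔ ∀ p ∈ J, p.2 ≤ D.ev p.1 x)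
    (join : ∀ x y, ∃ f ∈ 𝒜, x ∈ Set.range f ∧ y ∈ Set.range f)
    (ends : ∀ f ∈ 𝒜, ∀ g ∈ 𝒜, ∃ f₁ ∈ 𝒜, ∃ g₁ ∈ 𝒜, ∃ a₁ b₁, cone D f₁ a₁ ⊆ cone D f 0 ∧
      cone D g₁ b₁ ⊆ cone D g 0 ∧ ∃ h ∈ 𝒜, cone D f₁ a₁ ∪ cone D g₁ b₁ ⊆ Set.range h)
    (dist : ∀ f ∈ 𝒜, ∀ a b, ∃ g ∈ 𝒜, ∃ c d, g c = f a ∧ g d = f b ∧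
      dX (f a) (f b) = D.nrm (d - c))
    (retr : ∀ f ∈ 𝒜, ∀ x ∈ Set.range f, ∃ r : X → X, (∀ y, r y ∈ Set.range f) ∧
      (∀ y ∈ Set.range f, r y = y) ∧ (∀ y z, dX (r y) (r z) ≤ dX y z))
    (meet : ∀ f ∈ 𝒜, ∀ g ∈ 𝒜, ∀ h ∈ 𝒜,
      (∃ i k, Set.range f ∩ Set.range g = f '' {x | k ≤ D.ev i x}) →
      (∃ i k, Set.range g ∩ Set.range h = g '' {x | k ≤ D.ev i x}) →
      (∃ i k, Set.range f ∩ Set.range h = f '' {x | k ≤ D.ev i x}) →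
      (Set.range f ∩ Set.range g ∩ Set.range h).Nonempty) : Atlas D 𝒜 dX := by
  have dist_eq : ∀ f ∈ 𝒜, ∀ a b, dX (f a) (f b) = D.nrm (b - a) := by
    intro f hf a b
    obtain ⟨g, hg, c, d, hc, hd, h⟩ := dist f hf a b
    obtain ⟨u, t, -, hu, -⟩ := trans f hf g hg ⟨f a, ⟨a, rfl⟩, ⟨c, hc⟩⟩
    rw [h, inj g hg (hc.trans (hu a ⟨c, hc⟩)), inj g hg (hd.trans (hu b ⟨d, hd⟩)),
      add_sub_add_right_eq_sub, ← smul_sub, D.nrm_smul]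
  have half : ∀ f g : M → X, f ∈ 𝒜 → (∃ i k, ∀ x, f x ∈ Set.range g ↔ k ≤ D.ev i x) →
      ∃ i k, Set.range f ∩ Set.range g = f '' {x | k ≤ D.ev i x} := by
    rintro f g hf ⟨i, k, h⟩
    refine ⟨i, k, ?_⟩
    ext y
    constructor
    · rintro ⟨⟨x, rfl⟩, hx⟩
      exact ⟨x, (h x).1 hx, rfl⟩
    · rintro ⟨x, hx, rfl⟩
      exact ⟨⟨x, rfl⟩, (h x).2 hx⟩
  refine ⟨inj, tw_mem, fun f hf g hg a b hab => trans f hf g hg ⟨f a, ⟨a, rfl⟩, ⟨b, hab.symm⟩⟩,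
    join, ?_, dist_eq, ?_, ?_⟩
  · intro f hf g hg
    obtain ⟨f₁, hf₁, g₁, hg₁, a₁, b₁, h1, h2, h, hh, h3⟩ := ends f hf g hg
    refine ⟨f₁, hf₁, g₁, hg₁, h, hh, a₁, b₁, fun e he => ⟨?_, ?_, ?_, ?_⟩⟩
    · obtain ⟨e', he', h'⟩ := h1 ⟨e, he, rfl⟩
      exact ⟨e', he', by rw [← h', zero_add]⟩
    · obtain ⟨e', he', h'⟩ := h2 ⟨e, he, rfl⟩
      exact ⟨e', he', by rw [← h', zero_add]⟩
    · exact h3 (Or.inl ⟨e, he, rfl⟩)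
    · exact h3 (Or.inr ⟨e, he, rfl⟩)
  · intro x y z
    obtain ⟨f, hf, hx, hz⟩ := join x z
    obtain ⟨r, hr, hr', hd⟩ := retr f hf x hx
    have h1 := hd x y
    have h2 := hd y z
    rw [hr' x hx] at h1
    rw [hr' z hz] at h2
    refine le_trans ?_ (add_le_add h1 h2)
    obtain ⟨a, rfl⟩ := hx
    obtain ⟨b, rfl⟩ := hz
    obtain ⟨c, hc⟩ := hr y
    rw [← hc, dist_eq f hf, dist_eq f hf, dist_eq f hf]
    refine le_of_eq_of_le ?_ (D.nrm_add_le (c - a) (b - c))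
    congr 1; abel
  · intro f hf g hg h hh h1 h2 h3
    obtain ⟨_, ⟨⟨x, rfl⟩, hx⟩, hx'⟩ := meet f hf g hg h hh (half f g hf h1) (half g h hg h2)
      (half f h hf h3)
    exact ⟨x, hx, hx'⟩

end Abstract

noncomputable section Concrete

variable {ι V N Λ X : Type*} [Fintype ι] [AddCommGroup V] [Module ℝ V] [AddCommGroup N]
    [Module ℝ N] {P : RootPairing ι ℝ V N} [P.IsRootSystem] {B : RootBasis P} {F : Subfield ℝ}
    [P.IsValuedIn F] [AddCommGroup Λ] [LinearOrder Λ] [IsOrderedAddMonoid Λ] [Module F Λ]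
    [PosSMulStrictMono F Λ] {T : AddSubgroup (ModelSpace P F Λ)} {𝒜 : Set (ModelSpace P F Λ → X)}

theorem mem_affineWeylGroup_iff {w : ModelSpace P F Λ → ModelSpace P F Λ} :
    w ∈ affineWeylGroup T ↔ ∃ u : RootWeylGroup P F, ∃ t ∈ T, w = fun x => u • x + t := by
  constructor
  · rintro ⟨u, hu, t, ht, h⟩
    obtain ⟨v, hv⟩ := exists_weyl_smul hu
    exact ⟨v, t, ht, funext fun x => by rw [h, hv]⟩
  · rintro ⟨v, t, ht, rfl⟩
    obtain ⟨u, hu, h⟩ := exists_spherical (Λ := Λ) v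
    exact ⟨u, hu, t, ht, fun x => by rw [h]⟩

theorem mem_affineWeylGroup_top_iff {w : ModelSpace P F Λ → ModelSpace P F Λ} :
    w ∈ affineWeylGroup (⊤ : AddSubgroup (ModelSpace P F Λ)) ↔
      ∃ (u : RootWeylGroup P F) (t : ModelSpace P F Λ), w = fun x => u • x + t := by
  rw [mem_affineWeylGroup_iff]
  exact ⟨fun ⟨u, t, _, h⟩ => ⟨u, t, h⟩, fun ⟨u, t, h⟩ => ⟨u, t, trivial, h⟩⟩

theorem modelDist_eq (x y : ModelSpace P F Λ) :
    modelDist B x y = (B.weylModel F Λ).nrm (y - x) := by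
  unfold modelDist WeylModel.nrm
  rfl

theorem IsWeylConvex.exists_finset {Y : Set (ModelSpace P F Λ)} (h : IsWeylConvex T Y) :
    ∃ J : Finset (ι × Λ), ∀ x, x ∈ Y ↔ ∀ p ∈ J, p.2 ≤ (B.weylModel F Λ).ev p.1 x := by
  classical
  obtain ⟨𝓗, hfin, hsp, rfl⟩ := h
  have := hfin.to_subtype
  have := Fintype.ofFinite 𝓗
  choose i k _ hik using fun H : 𝓗 => hsp H.1 H.2
  refine ⟨Finset.univ.image fun H => (i H, k H), fun x => ?_⟩
  simp only [Set.mem_sInter, Finset.mem_image, Finset.mem_univ, true_and, forall_exists_index,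
    forall_apply_eq_imp_iff]
  constructor
  · intro h H
    have := h H.1 H.2
    rw [hik H] at this
    exact this
  · intro h H hH
    have := hik ⟨H, hH⟩
    change H = _ at this
    rw [this]
    exact h ⟨H, hH⟩

theorem isWeylChamberAt_iff (htw : ∀ f ∈ 𝒜, ∀ u : RootWeylGroup P F, tw f u ∈ 𝒜) {p : X}
    {S : Set X} : IsWeylChamberAt B 𝒜 p S ↔
      ∃ f ∈ 𝒜, ∃ a, f a = p ∧ S = cone (B.weylModel F Λ) f a := by
  constructor
  · rintro ⟨f, hf, w, hw, rfl, rfl⟩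
    obtain ⟨u, a, rfl⟩ := mem_affineWeylGroup_top_iff.1 hw
    refine ⟨tw f u, htw f hf u, u⁻¹ • a, ?_, cone_tw (B.weylModel F Λ) f u a⟩
    exact congrArg f (by beta_reduce; rw [smul_inv_smul, smul_zero, zero_add])
  · rintro ⟨f, hf, a, rfl, rfl⟩
    refine ⟨f, hf, fun x => (1 : RootWeylGroup P F) • x + a,
      mem_affineWeylGroup_top_iff.2 ⟨1, a, rfl⟩, ?_, ?_⟩
    · exact congrArg f (by beta_reduce; rw [one_smul, zero_add])
    · have := cone_tw (B.weylModel F Λ) f 1 a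
      rw [tw_one, inv_one, one_smul] at this
      exact this.symm

theorem isWeylChamber_iff (htw : ∀ f ∈ 𝒜, ∀ u : RootWeylGroup P F, tw f u ∈ 𝒜) {S : Set X} :
    IsWeylChamber B 𝒜 S ↔ ∃ f ∈ 𝒜, ∃ a, S = cone (B.weylModel F Λ) f a := by
  constructor
  · rintro ⟨p, h⟩
    obtain ⟨f, hf, a, -, h⟩ := (isWeylChamberAt_iff htw).1 h
    exact ⟨f, hf, a, h⟩
  · rintro ⟨f, hf, a, h⟩
    exact ⟨f a, (isWeylChamberAt_iff htw).2 ⟨f, hf, a, rfl, h⟩⟩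

namespace IsAffineBuilding

variable (h𝒜 : IsAffineBuilding B 𝒜 T)
include h𝒜

theorem tw_mem : ∀ f ∈ 𝒜, ∀ u : RootWeylGroup P F, tw f u ∈ 𝒜 := by
  intro f hf u
  have := h𝒜.A1 f hf _ (mem_affineWeylGroup_iff.2 ⟨u, 0, T.zero_mem, rfl⟩)
  convert this using 1
  ext x
  simp [tw]

theorem atlas : Atlas (B.weylModel F Λ) 𝒜 (buildingDist B 𝒜) := by
  refine Atlas.of_axioms h𝒜.injective h𝒜.tw_mem ?_ h𝒜.A3 ?_ ?_ ?_ ?_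
  · intro f hf g hg hne
    obtain ⟨hconv, w, hw, hfg⟩ := h𝒜.A2 f hf g hg hne
    obtain ⟨u, t, -, rfl⟩ := mem_affineWeylGroup_iff.1 hw
    obtain ⟨J, hJ⟩ := hconv.exists_finset (B := B)
    exact ⟨u, t, J, hfg, hJ⟩
  · intro f hf g hg
    obtain ⟨S₁, S₂, hS₁, hS₂, h1, h2, h, hh, h3⟩ := h𝒜.A4 _ _
      ((isWeylChamber_iff h𝒜.tw_mem).2 ⟨f, hf, 0, rfl⟩)
      ((isWeylChamber_iff h𝒜.tw_mem).2 ⟨g, hg, 0, rfl⟩)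
    obtain ⟨f₁, hf₁, a₁, rfl⟩ := (isWeylChamber_iff h𝒜.tw_mem).1 hS₁
    obtain ⟨g₁, hg₁, b₁, rfl⟩ := (isWeylChamber_iff h𝒜.tw_mem).1 hS₂
    exact ⟨f₁, hf₁, g₁, hg₁, a₁, b₁, h1, h2, h, hh, h3⟩
  · intro f hf a b
    have hex : ∃ p : ModelSpace P F Λ × ModelSpace P F Λ, ∃ g ∈ 𝒜, g p.1 = f a ∧ g p.2 = f b :=
      ⟨(a, b), f, hf, rfl, rfl⟩
    obtain ⟨g, hg, h1, h2⟩ := hex.choose_spec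
    refine ⟨g, hg, _, _, h1, h2, ?_⟩
    rw [buildingDist, dif_pos hex, modelDist_eq]
  · intro f hf x hx
    obtain ⟨r, h1, h2, h3, -⟩ := h𝒜.A5 f hf x hx
    exact ⟨r, h1, h2, h3⟩
  · rintro f hf g hg h hh ⟨i, k, h1⟩ ⟨i', k', h2⟩ ⟨i'', k'', h3⟩
    exact h𝒜.A6 f hf g hg h hh ⟨f, hf, i, k, h1⟩ ⟨g, hg, i', k', h2⟩ ⟨f, hf, i'', k'', h3⟩

end IsAffineBuilding

end Concrete

/-! ### Retractions from centres; recognizing germs and parallel classes -/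

namespace Atlas

variable {ι F E W Λ M X : Type*} [Fintype ι] [Field F] [LinearOrder F]
    [IsStrictOrderedRing F] [AddCommGroup E] [Module F E] [Group W] [DistribMulAction W E]
    [AddCommGroup Λ] [LinearOrder Λ] [IsOrderedAddMonoid Λ] [Module F Λ] [PosSMulStrictMono F Λ]
    [Nontrivial Λ] [AddCommGroup M] [DistribMulAction W M]
    {D : WeylModel ι F E W Λ M} {𝒜 : Set (M → X)} {dX : X → X → Λ} (H : Atlas D 𝒜 dX)

variable (W) in
/-- The point `z` is obtained from `y` by passing from the chart `g` to the chart `f`. -/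
def Transport (f g : M → X) (y z : X) : Prop :=
  ∃ (u : W) (t : M), (∀ a, g a ∈ Set.range f → g a = f (u • a + t)) ∧
    ∃ a, g a = y ∧ z = f (u • a + t)

include H

section Retraction

variable {𝒢 : (M → X) → M → Prop} (hG : IsCentre D 𝒜 𝒢)
include hG

/-- The overlap of the two charts contains a regular segment, by coherence. This forces the affine
map in `Transport` to be the translation between the normalized coordinates. -/
theorem transport_iff {f g : M → X} (hf : f ∈ 𝒜) {u v : W} {b β : M} (hgb : 𝒢 (tw g u) b)
    (hfβ : 𝒢 (tw f v) β) {y z : X} :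
    Transport W f g y z ↔ ∃ q, tw g u q = y ∧ z = tw f v (q - b + β) := by
  constructor
  · rintro ⟨u₀, t, h, a, rfl, rfl⟩
    refine ⟨u⁻¹ • a, by rw [tw, smul_inv_smul], ?_⟩
    obtain ⟨x, s, hs, h1, h2⟩ := hG.coh hgb hfβ
    simp only [tw] at h1 h2
    have e1 := H.inj f hf (h1.symm.trans (h _ ⟨_, h1.symm⟩))
    have e2 := H.inj f hf (h2.symm.trans (h _ ⟨_, h2.symm⟩))
    have e3 : v • D.reg s = (u₀ * u) • D.reg s := by
      rw [smul_add, e1, smul_add, smul_add, add_right_comm] at e2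
      rw [mul_smul]
      exact add_left_cancel (add_right_cancel e2)
    have e4 := D.reg_cancel hs.ne' e3
    have e5 : t = v • (β - b) := by
      rw [e4, mul_smul, ← mul_smul u₀ u, ← mul_smul u₀ u, ← e4] at e1
      have : t = v • (x - b + β) - v • x := by rw [e1]; abel
      rw [this, ← smul_sub]
      congr 1; abel
    rw [tw, e5]
    congr 1
    rw [smul_add, smul_sub, smul_sub, e4, mul_smul, mul_smul, mul_smul, smul_inv_smul]
    abel
  · rintro ⟨q, rfl, rfl⟩
    have key : ∀ a, (v * u⁻¹) • a + v • (β - b) = v • (u⁻¹ • a - b + β) := by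
      intro a
      rw [mul_smul, ← smul_add]
      congr 1; abel
    refine ⟨v * u⁻¹, v • (β - b), fun a ha => ?_, u • q, rfl, ?_⟩
    · have := hG.eq H hgb hfβ (q := u⁻¹ • a) (by rw [tw, smul_inv_smul, range_tw]; exact ha)
      rw [tw, smul_inv_smul] at this
      rw [this, tw, key]
    · rw [key, inv_smul_smul, tw]

theorem existsUnique_retraction {C : (M → X) → Prop}
    (hC : ∀ g ∈ 𝒜, C g ↔ ∃ (u : W) (b : M), 𝒢 (tw g u) b) {f : M → X} (hf : f ∈ 𝒜) (hCf : C f) :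
    (∃! r : X → X, ∀ y, ∃ g ∈ 𝒜, C g ∧ Transport W f g y (r y)) ∧
    ∀ r : X → X, (∀ y, ∃ g ∈ 𝒜, C g ∧ Transport W f g y (r y)) →
      ∀ y z, dX (r y) (r z) ≤ dX y z := by
  obtain ⟨v, β, hv⟩ := (hC f hf).1 hCf
  have key : ∀ y z, (∃ g ∈ 𝒜, C g ∧ Transport W f g y z) ↔
      ∃ g b q, 𝒢 g b ∧ g q = y ∧ z = tw f v (q - b + β) := by
    intro y z
    constructor
    · rintro ⟨g, hg, hCg, ht⟩
      obtain ⟨u, b, hu⟩ := (hC g hg).1 hCg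
      obtain ⟨q, hq, hz⟩ := (transport_iff H hG hf hu hv).1 ht
      exact ⟨_, b, q, hu, hq, hz⟩
    · rintro ⟨g, b, q, hgb, hq, hz⟩
      have h1 : 𝒢 (tw g (1 : W)) b := by rwa [tw_one]
      refine ⟨g, hG.mem hgb, (hC g (hG.mem hgb)).2 ⟨1, b, h1⟩,
        (transport_iff H hG hf h1 hv).2 ⟨q, ?_, hz⟩⟩
      rwa [tw_one]
  simp only [key]
  have huniq : ∀ {y z z' : X}, (∃ g b q, 𝒢 g b ∧ g q = y ∧ z = tw f v (q - b + β)) →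
      (∃ g b q, 𝒢 g b ∧ g q = y ∧ z' = tw f v (q - b + β)) → z = z' := by
    rintro y _ _ ⟨g, b, q, h, hq, rfl⟩ ⟨g', b', q', h', hq', rfl⟩
    exact hG.unique H h h' (hq.trans hq'.symm)
  have hex : ∀ y, ∃ z, ∃ g b q, 𝒢 g b ∧ g q = y ∧ z = tw f v (q - b + β) := by
    intro y
    obtain ⟨g, b, h, q, hq⟩ := hG.exists_chart H y
    exact ⟨_, g, b, q, h, hq, rfl⟩
  choose r hr using hex
  refine ⟨⟨r, hr, fun r' hr' => funext fun y => huniq (hr' y) (hr y)⟩, fun r' hr' => ?_⟩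
  exact hG.dist_le H hv fun g b q h => huniq (hr' (g q)) ⟨g, b, q, h, rfl, rfl⟩

end Retraction

theorem exists_reg_nrm_lt {ε : Λ} (hε : 0 < ε) : ∃ s, 0 < s ∧ D.nrm (D.reg s) < ε := by
  have h0 : 0 ≤ D.anorm D.omega := Finset.sum_nonneg fun _ _ => abs_nonneg _
  have h1 : 0 < D.anorm D.omega + 1 := by linarith
  refine ⟨(D.anorm D.omega + 1)⁻¹ • ε, smul_pos (inv_pos.2 h1) hε, ?_⟩
  have h2 := D.two_nrm_tm D.omega (smul_nonneg (inv_nonneg.2 h1.le) hε.le)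
  rw [smul_smul, ← div_eq_mul_inv] at h2
  have h3 : (D.anorm D.omega / (D.anorm D.omega + 1)) • ε < (1 : F) • ε :=
    smul_lt_smul_of_pos_right ((div_lt_one h1).2 (lt_add_one _)) hε
  rw [← h2, one_smul] at h3
  have h4 := D.nrm_nonneg (D.reg ((D.anorm D.omega + 1)⁻¹ • ε))
  refine lt_of_le_of_lt (le_add_of_nonneg_right h4) ?_
  rwa [← two_nsmul]

theorem exists_dom_reg_sub {s : Λ} (hs : 0 < s) :
    ∃ ε : Λ, 0 < ε ∧ ∀ e, D.nrm e < ε → D.Dom (D.reg s - e) := by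
  obtain ⟨d, hd, h⟩ := WeylData.exists_small (F := F) Finset.univ (fun k => D.co k D.omega)
    fun _ => 1
  refine ⟨d • s, smul_pos hd hs, fun e he k hk => ?_⟩
  rw [map_sub, D.ev_reg, sub_nonneg]
  have h1 := h k (Finset.mem_univ k) (D.pos_omega hk)
  rw [mul_one] at h1
  exact (le_abs_self _).trans ((D.ev_le_nrm e).trans
    (he.le.trans (smul_le_smul_of_nonneg_right h1.le hs.le)))

omit H in
theorem _root_.LambdaBuilding.WeylModel.eq_one_of_dom {u : W} {s : Λ} (hs : 0 < s)
    (h : D.Dom (u • D.reg s)) : u = 1 := by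
  refine D.eq_one_of_nonneg fun i hi => ?_
  have := h i (D.simple_pos hi)
  rw [WeylModel.reg, D.smul_tm, D.ev_tm] at this
  exact nonneg_of_smul_nonneg_of_pos_right this hs

/-- The chambers `cone D f a` and `cone D g b` have the same germ if each contains the intersection
of the other with a ball. -/
theorem gEq_of_cone_inter_subset {f g : M → X} (hf : f ∈ 𝒜) (hg : g ∈ 𝒜) {a b : M}
    (hab : f a = g b) {ε : Λ} (hε : 0 < ε)
    (h : ∀ y ∈ cone D f a, dX (f a) y < ε → y ∈ cone D g b) : GEq D f a g b := by
  obtain ⟨s, hs, hsε⟩ := exists_reg_nrm_lt H hε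
  obtain ⟨e, he, hfe⟩ := h (f (a + D.reg s)) ⟨_, D.dom_reg hs.le, rfl⟩ (by
    rw [H.dist_eq f hf, add_sub_cancel_left]; exact hsε)
  refine ⟨hab, s, hs, ?_⟩
  obtain ⟨u, t, J, hu, -⟩ := H.trans f hf g hg a b hab
  have e1 := H.inj g hg (hab.symm.trans (hu a ⟨b, hab.symm⟩))
  have e2 := H.inj g hg (hfe.trans (hu _ ⟨_, hfe⟩))
  have e3 : e = u • D.reg s := by
    rw [e1, smul_add, add_right_comm] at e2
    exact add_left_cancel (add_right_cancel e2)
  rw [e3] at he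
  obtain rfl := WeylModel.eq_one_of_dom hs he
  rw [← hfe, e3, one_smul]

theorem exists_gEq_tw {f g : M → X} (hf : f ∈ 𝒜) (hg : g ∈ 𝒜) {a : M} {ε : Λ} (hε : 0 < ε)
    (h : ∀ y ∈ cone D f a, dX (f a) y < ε → y ∈ Set.range g) :
    ∃ (u : W) (b : M), GEq D (tw g u) b f a := by
  obtain ⟨s, hs, hsε⟩ := exists_reg_nrm_lt H hε
  obtain ⟨c, hc⟩ := h (f a) ⟨0, D.dom_zero, by rw [add_zero]⟩ (by
    rw [H.dist_eq f hf, sub_self, D.nrm_zero]; exact hε)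
  have h1 := h (f (a + D.reg s)) ⟨_, D.dom_reg hs.le, rfl⟩ (by
    rw [H.dist_eq f hf, add_sub_cancel_left]; exact hsε)
  obtain ⟨u, t, J, hu, -⟩ := H.trans f hf g hg a c hc.symm
  have e1 := H.inj g hg (hc.trans (hu a ⟨c, hc⟩))
  refine ⟨u, u⁻¹ • c, ?_, s, hs, ?_⟩
  · rw [tw, smul_inv_smul, hc]
  · rw [tw, smul_add, smul_inv_smul, hu _ h1, e1, smul_add]
    congr 1; abel

theorem exists_ball_inter_cone_subset {f g : M → X} (hf : f ∈ 𝒜) (hg : g ∈ 𝒜) {a b : M}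
    (h : GEq D g b f a) : ∃ ε : Λ, 0 < ε ∧
      ∀ y ∈ cone D f a, dX (f a) y < ε → y ∈ Set.range g := by
  obtain ⟨h0, s, hs, h1⟩ := h
  obtain ⟨ε, hε, h2⟩ := exists_dom_reg_sub H hs
  refine ⟨ε, hε, ?_⟩
  rintro _ ⟨e, he, rfl⟩ hlt
  rw [H.dist_eq f hf, add_sub_cancel_left] at hlt
  exact H.range_box hf hg ⟨b, h0⟩ ⟨_, h1⟩ he (h2 e hlt)

/-- In a common apartment the vectors `w⁻¹ • reg s` stay at bounded distance from dominant ones for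
all `s`. Hence `w⁻¹ • omega` is dominant and `w = 1`. -/
theorem asEq_of_bounded {f g : M → X} (hf : f ∈ 𝒜) (hg : g ∈ 𝒜) {a b : M} {n : Λ}
    (h : ∀ y ∈ cone D f a, ∃ z ∈ cone D g b, dX y z ≤ n) : AsEq D f g := by
  obtain ⟨k, hk, w, h1, h2⟩ := H.exists_common_apartment hf hg
  obtain ⟨n₁, hn₁⟩ := AsEq.dist H hf hk h1
  obtain ⟨n₂, hn₂⟩ := AsEq.dist H hg (H.tw_mem' hk w) h2
  have h3 : ∀ s : Λ, 0 ≤ s → ∃ e, D.Dom e ∧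
      D.nrm (w • e - D.reg s) ≤ n₁ + D.nrm a + n + D.nrm b + n₂ := by
    intro s hs
    obtain ⟨_, ⟨e, he, rfl⟩, hz⟩ := h _ ⟨_, D.dom_reg hs, rfl⟩
    refine ⟨e, he, ?_⟩
    have d1 := hn₁ _ (D.dom_reg hs)
    have d2 := hn₂ e he
    have d3 : dX (f (D.reg s)) (f (a + D.reg s)) = D.nrm a := by
      rw [H.dist_eq f hf, add_sub_cancel_right]
    have d4 : dX (g (b + e)) (g e) = D.nrm b := by
      rw [H.dist_eq g hg, sub_add_cancel_right, D.nrm_neg]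
    rw [← H.dist_eq k hk]
    refine (H.triangle _ (g e) _).trans (add_le_add ?_ d2)
    refine (H.triangle _ (g (b + e)) _).trans (add_le_add ?_ d4.le)
    refine (H.triangle _ (f (a + D.reg s)) _).trans (add_le_add ?_ hz)
    refine (H.triangle _ (f (D.reg s)) _).trans (add_le_add ?_ d3.le)
    rw [H.dist_comm]
    exact d1
  have hw : w⁻¹ = 1 := by
    refine D.eq_one_of_nonneg fun i hi => H.le_of_bounded
      (n := n₁ + D.nrm a + n + D.nrm b + n₂) fun s hs => ?_
    obtain ⟨e, he, hn⟩ := h3 s hs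
    rw [← D.nrm_smul w⁻¹, smul_sub, inv_smul_smul] at hn
    have h4 := (le_abs_self _).trans ((D.ev_le_nrm (k := i) _).trans hn)
    rw [map_sub, WeylModel.reg, D.smul_tm, D.ev_tm] at h4
    rw [zero_smul]
    have h5 := he i (D.simple_pos hi)
    rw [sub_le_iff_le_add'] at h4
    exact h5.trans h4
  rw [inv_eq_one.1 hw, tw_one] at h2
  exact h1.trans h2.symm

omit H in
theorem AsEq.cone_eq_cone {f g : M → X} {a b : M}
    (h : ∀ e, D.Dom e → f (a + e) = g (b + e)) : cone D f a = cone D g b := by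
  ext x
  constructor
  · rintro ⟨e, he, rfl⟩; exact ⟨e, he, (h e he).symm⟩
  · rintro ⟨e, he, rfl⟩; exact ⟨e, he, h e he⟩

theorem cone_bounded {f : M → X} (hf : f ∈ 𝒜) (a b : M) {y : X} (hy : y ∈ cone D f a) :
    ∃ z ∈ cone D f b, dX y z ≤ D.nrm (b - a) := by
  obtain ⟨e, he, rfl⟩ := hy
  refine ⟨_, ⟨e, he, rfl⟩, ?_⟩
  rw [H.dist_eq f hf, add_sub_add_right_eq_sub]

end Atlas

/-! ### Germs and chambers at infinity of the building in terms of charts -/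

noncomputable section Concrete

open Atlas

variable {ι V N Λ X : Type*} [Fintype ι] [AddCommGroup V] [Module ℝ V] [AddCommGroup N]
    [Module ℝ N] {P : RootPairing ι ℝ V N} [P.IsRootSystem] {B : RootBasis P} {F : Subfield ℝ}
    [P.IsValuedIn F] [AddCommGroup Λ] [LinearOrder Λ] [IsOrderedAddMonoid Λ] [Module F Λ]
    [PosSMulStrictMono F Λ] [Nontrivial Λ] {T : AddSubgroup (ModelSpace P F Λ)}
    {𝒜 : Set (ModelSpace P F Λ → X)}

theorem isTransport_iff {f g : ModelSpace P F Λ → X} {y z : X} :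
    IsTransport f g y z ↔ Transport (RootWeylGroup P F) f g y z := by
  constructor
  · rintro ⟨w, hw, h⟩
    obtain ⟨u, t, rfl⟩ := mem_affineWeylGroup_top_iff.1 hw
    exact ⟨u, t, h⟩
  · rintro ⟨u, t, h⟩
    exact ⟨_, mem_affineWeylGroup_top_iff.2 ⟨u, t, rfl⟩, h⟩

namespace IsAffineBuilding

variable (h𝒜 : IsAffineBuilding B 𝒜 T)
include h𝒜

/-- A common regular segment at the base point decides everything: it lies in every
ball-neighbourhood of the chamber once short, and its box contains the points of the chamber in a
small ball. -/
theorem germContained_iff {g₀ g : ModelSpace P F Λ → X} (hg₀ : g₀ ∈ 𝒜) (hg : g ∈ 𝒜)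
    (b₀ : ModelSpace P F Λ) :
    GermContained B 𝒜 (g₀ b₀) (germ B 𝒜 (g₀ b₀) (cone (B.weylModel F Λ) g₀ b₀)) (Set.range g) ↔
      ∃ (u : RootWeylGroup P F) (b : ModelSpace P F Λ),
        GEq (B.weylModel F Λ) (tw g u) b g₀ b₀ := by
  have H := h𝒜.atlas
  have hS := (isWeylChamberAt_iff (B := B) h𝒜.tw_mem).2 ⟨g₀, hg₀, b₀, rfl, rfl⟩
  constructor
  · rintro ⟨S', ⟨-, hS', ε', hε', h1, -⟩, ε, hε, h3⟩
    obtain ⟨g', hg', b', hb', rfl⟩ := (isWeylChamberAt_iff h𝒜.tw_mem).1 hS'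
    have hG := H.gEq_of_cone_inter_subset hg₀ hg' hb'.symm hε' fun y hy hlt => (h1 ⟨hy, hlt⟩).2
    obtain ⟨u, b, hu⟩ := H.exists_gEq_tw hg' hg (a := b') hε fun y hy hlt =>
      h3 ⟨hy, by rw [hb'] at hlt; exact hlt⟩
    exact ⟨u, b, GEq.trans H (H.tw_mem' hg u) hg' hg₀ hu hG.symm⟩
  · rintro ⟨u, b, hu⟩
    obtain ⟨ε, hε, h⟩ := H.exists_ball_inter_cone_subset hg₀ (H.tw_mem' hg u) hu
    refine ⟨_, ⟨hS, hS, ε, hε, ?_, ?_⟩, ε, hε, fun y hy => ?_⟩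
    · exact fun y hy => ⟨hy.1, hy.1⟩
    · exact fun y hy => ⟨hy.1, hy.1⟩
    · rw [← range_tw g u]
      exact h y hy.1 hy.2

/-- Parallel Weyl chambers are asymptotic by `asEq_of_bounded`, so they share a subchamber;
conversely, a translate of a chamber within one chart is parallel to it. -/
theorem memBoundary_iff {c g : ModelSpace P F Λ → X} (hc : c ∈ 𝒜) (hg : g ∈ 𝒜)
    (m : ModelSpace P F Λ) :
    MemBoundary (chamberAtInfinity B 𝒜 (cone (B.weylModel F Λ) c m)) (Set.range g) ↔
      ∃ (u : RootWeylGroup P F) (b : ModelSpace P F Λ), tw g u ∈ 𝒜 ∧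
        ∃ m, ∀ e, (B.weylModel F Λ).Dom e → c (m + e) = tw g u (m + b + e) := by
  have H := h𝒜.atlas
  constructor
  · rintro ⟨S, ⟨hS, n, hn, -⟩, hSg⟩
    obtain ⟨c', hc', m', rfl⟩ := (isWeylChamber_iff h𝒜.tw_mem).1 hS
    have h1 := H.asEq_of_bounded hc hc' hn
    obtain ⟨u, hu⟩ := H.exists_asEq_tw hc' hg (a := m') fun e he => hSg ⟨e, he, rfl⟩
    obtain ⟨a, a', ha⟩ := h1.trans hu
    refine ⟨u, a' - a, H.tw_mem' hg u, a, fun e he => ?_⟩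
    rw [ha e he, add_sub_cancel]
  · rintro ⟨u, b, hu, m', h⟩
    have h1 := AsEq.cone_eq_cone h
    refine ⟨cone _ c m', ⟨(isWeylChamber_iff h𝒜.tw_mem).2 ⟨c, hc, m', rfl⟩,
      (B.weylModel F Λ).nrm (m' - m), fun x hx => H.cone_bounded hc m m' hx, fun x hx => ?_⟩, ?_⟩
    · rw [← WeylModel.nrm_neg, neg_sub]
      exact H.cone_bounded hc m' m hx
    · rw [h1]
      rintro _ ⟨e, -, rfl⟩
      exact ⟨_, rfl⟩

end IsAffineBuilding

end Concrete

theorem nontrivial_of_ne_bot {ι V N Λ : Type*} [AddCommGroup V] [Module ℝ V]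
    [AddCommGroup N] [Module ℝ N] {P : RootPairing ι ℝ V N} {F : Subfield ℝ}
    [AddCommGroup Λ] [Module F Λ] {T : AddSubgroup (ModelSpace P F Λ)} (hT : T ≠ ⊥) :
    Nontrivial Λ := by
  by_contra hΛ
  rw [not_nontrivial_iff_subsingleton] at hΛ
  have h : ∀ x : ModelSpace P F Λ, x = 0 := fun x => by
    induction x using TensorProduct.induction_on with
    | zero => rfl
    | tmul v s => rw [Subsingleton.elim s 0, TensorProduct.tmul_zero]
    | add x y hx hy => rw [hx, hy, add_zero]
  exact hT ((AddSubgroup.eq_bot_iff_forall T).2 fun x _ => h x)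

end LambdaBuilding


theorem mainTheorem4 {ι V N Λ X : Type*} [Fintype ι]
    [AddCommGroup V] [Module ℝ V] [AddCommGroup N] [Module ℝ N]
    (P : RootPairing ι ℝ V N) [P.IsRootSystem] (B : RootBasis P)
    (F : Subfield ℝ) [P.IsValuedIn F]
    [AddCommGroup Λ] [LinearOrder Λ] [IsOrderedAddMonoid Λ] [Module F Λ] [PosSMulMono F Λ]
    (T : AddSubgroup (ModelSpace P F Λ)) (hT : T ≠ ⊥)
    (hTW : ∀ u ∈ sphericalWeylGroup P F Λ, ∀ t ∈ T, u t ∈ T)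
    (𝒜 : Set (ModelSpace P F Λ → X)) (h𝒜 : IsAffineBuilding B 𝒜 T)
    (f : ModelSpace P F Λ → X) (hf : f ∈ 𝒜) :
    (∀ (x : X) (S : Set X), IsWeylChamberAt B 𝒜 x S →
      GermContained B 𝒜 x (germ B 𝒜 x S) (Set.range f) →
      (∃! r : X → X, IsGermRetraction B 𝒜 f x (germ B 𝒜 x S) r) ∧
      ∀ r : X → X, IsGermRetraction B 𝒜 f x (germ B 𝒜 x S) r → NonIncreasing B 𝒜 r) ∧
    (∀ S : Set X, IsWeylChamber B 𝒜 S →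
      MemBoundary (chamberAtInfinity B 𝒜 S) (Set.range f) →
      (∃! ρ : X → X, IsRetractionAtInfinity 𝒜 f (chamberAtInfinity B 𝒜 S) ρ) ∧
      ∀ ρ : X → X, IsRetractionAtInfinity 𝒜 f (chamberAtInfinity B 𝒜 S) ρ →
        NonIncreasing B 𝒜 ρ) := by
  have : Nontrivial Λ := nontrivial_of_ne_bot hT
  -- Positive scalars of the field `F` are invertible, so a monotone scalar action is strictly
  -- monotone.
  have : PosSMulStrictMono F Λ := ⟨fun a ha x y hxy =>
    (smul_le_smul_of_nonneg_left hxy.le ha.le).lt_of_ne fun h => hxy.ne <| by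
      rw [← inv_smul_smul₀ ha.ne' x, ← inv_smul_smul₀ ha.ne' y]
      exact congrArg _ h⟩
  have H := h𝒜.atlas
  constructor
  · intro x S hS hfS
    obtain ⟨g₀, hg₀, b₀, rfl, rfl⟩ := (isWeylChamberAt_iff h𝒜.tw_mem).1 hS
    have := H.existsUnique_retraction (H.isCentre_germ hg₀ b₀) (C := fun g =>
      GermContained B 𝒜 (g₀ b₀) (germ B 𝒜 (g₀ b₀) (cone _ g₀ b₀)) (Set.range g))
      (fun g hg => by
        rw [h𝒜.germContained_iff hg₀ hg b₀]
        exact exists₂_congr fun u b => (and_iff_right (H.tw_mem' hg u)).symm) hf hfS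
    simp only [← isTransport_iff] at this
    exact this
  · intro S hS hfS
    obtain ⟨c, hc, m, rfl⟩ := (isWeylChamber_iff h𝒜.tw_mem).1 hS
    have := H.existsUnique_retraction (H.isCentre_infinity hc) (C := fun g =>
      MemBoundary (chamberAtInfinity B 𝒜 (cone _ c m)) (Set.range g))
      (fun g hg => h𝒜.memBoundary_iff hc hg m) hf hfS
    simp only [← isTransport_iff] at this
    exact this
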